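/- \textbf{Setting.} A weighted transducer $T$ (without $\epsilon$-transitions) over a commutative semiring $\mathbb K$ consists of a finite set of states, sets $I,F$ of initial and final states, a finite collection (multiset) $E$ of transitions $e$, each with an origin, an input letter $i[e]$, an output letter $o[e]$, a weight $w[e]\in\mathbb K$ and a destination $n[e]$, and initial and final weights $\lambda:I\to\mathbb K$, $\rho:F\to\mathbb K$. $T(x,y)$ is the sum, over all paths $\pi$ from a state $p\in I$ to a state $q\in F$ labelled with the strings $(x,y)$, of $\lambda(p)\,w[\pi]\,\rho(q)$. Write $|T|_Q$ and $|T|_E$ for the numbers of states and transitions, $E[q]$ for the transitions leaving $q$, and $d(T)=\max_q|E[q]|$. Let $T_1,T_2,T_3$ be such transducers, the output alphabet of $T_1$ (resp. $T_2$) being the input alphabet of $T_2$ (resp. $T_3$). \emph{3-way composition} starts from $I_1\times I_2\times I_3$ and examines, from a FIFO or LIFO queue, each triple $(q_1,q_2,q_3)$ of states that it finds, generating for every matching triple $e_i\in E[q_i]$ (that is, $o[e_1]=i[e_2]$ and $o[e_2]=i[e_3]$) one transition from $(q_1,q_2,q_3)$ to $(n[e_1],n[e_2],n[e_3])$, with labels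 $(i[e_1],o[e_3])$ and weight $w[e_1]w[e_2]w[e_3]$. The matches are found in hash tables: the \emph{lateral} strategy looks up $e_2$ for each pair $(e_1,e_3)\in E[q_1]\times E[q_3]$, in a table for $T_2$; the \emph{central} strategy looks up $e_1$ and $e_3$ for each $e_2\in E[q_2]$, in tables for $T_1$ and $T_3$; the \emph{combined} strategy is lateral at $(q_1,q_2,q_3)$ if $|E[q_1]|\,|E[q_3]|\le|E[q_2]|$ and central otherwise. The tables are built in a preprocessing phase by randomized two-level perfect hashing, keys (a state with the labels to be matched) being numbered injectively by residues modulo a prime $p$. Running times count elementary steps of a unit-cost random access machine (word operations including arithmetic modulo $p$, semiring multiplications, accesses to array cells, among them the membership bit of a triple of states, queue operations); the input transducers are given by adjacency lists. \textbf{Theorem.} There is an absolute constant $M$ such that, for all $\mathbb K$, $p$, $T_1,T_2,T_3$ as above, the following hold. (1) \emph{Preprocessing.} It ends with probability $1$, and its expected time is at most $M(h+1)$, where $h=|T_2|_E$ for the lateral strategy, $h=|T_1|_E+|T_3|_E$ for the central one, and $h=|T_1|_E+|T_2|_E+|T_3|_E$ for the combined one. (In detail: if every search for a hash function is cut off after $N$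 rounds, the expected time is at most $M(h+1)$ for every $N$, and the probability of being cut off tends to $0$ as $N\to\infty$.) (2) \emph{Composition.} For each strategy, every possible outcome of the preprocessing and both queue disciplines, the algorithm ends and returns $T=T_1\circ T_2\circ T_3$. That is, the states of $T$ are exactly the triples reachable from $I_1\times I_2\times I_3$ by matching transitions, with one transition for each matching triple, initial and final states and weights being the products of those of $T_1,T_2,T_3$; and for all strings $x,y$ \[T(x,y)=\sum_{z,z'}T_1(x,z)\,T_2(z,z')\,T_3(z',y),\] where only finitely many terms are nonzero. In the worst case its time is at most \[M\bigl(|T|_Q\max(1,b)+|T|_E+1\bigr),\] where $b=d(T_1)d(T_3)$ for the lateral strategy, $b=d(T_2)$ for the central one, and $b=\min(d(T_1)d(T_3),d(T_2))$ for the combined one. (3) \emph{Standard composition.} Let $U$ and $V$ be composable transducers over finite alphabets. Standard composition computes $U\circ V$ on pairs of states in the same way, by scanning the transitions of one of the two transducers and looking up those of the other one, hashed by the matching label. It ends, and for each strategy its result agrees, up to the renaming of states that forgets the only state of the identity transducer $\mathrm{Id}$ (one state, initial and final, a loop $a:a$ for each letter $a$, all weights $1$), with the results of 3-way composition of $(\mathrm{Id},U,V)$,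 of $(U,\mathrm{Id},V)$ and of $(U,V,\mathrm{Id})$. Moreover 3-way composition of $(\mathrm{Id},U,V)$ (resp. $(U,V,\mathrm{Id})$) with the central strategy takes, after the preprocessing, at most $M$ times the steps of standard composition scanning $U$ and hashing $V$ (resp. scanning $V$ and hashing $U$). -/

import Mathlib

open scoped ENNReal

universe u v

namespace ThreeWay

/-! ### Step-counted computations

A value of type `Comp α` is the outcome of a deterministic computation on a unit-cost random access
machine: the value it returns and the number of elementary steps it performed. An elementary step
is an arithmetic operation or a comparison on machine words (numbers of states, of labels, residues
modulo `p`), a semiring multiplication, a read or write of one array cell or record, a pointer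
operation on a linked list or queue (test for emptiness, removal of the head, insertion at an end).
The programs below are composed only of `op`, `alloc`, `bind`, the loops built from them,
conditionals on values already computed, and recursion. -/

structure Comp (α : Type*) where
  val : α
  time : ℕ

namespace Comp

variable {α : Type*} {β : Type*} {γ : Type*} {σ : Type*}

/-- One elementary step, with result `a`. -/
def op (a : α) : Comp α := ⟨a, 1⟩

/-- Sequential execution: the step counts add up. -/
def bind (x : Comp α) (f : α → Comp β) : Comp β :=
  ⟨(f x.val).val, x.time + (f x.val).time⟩

/-- Allocation of an array with `m` cells, all initialised to `a`: at least one step,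
and one step for each cell. -/
def alloc (m : ℕ) (a : α) : Comp (ℕ → α) := ⟨fun _ => a, m + 1⟩

/-- `for x in xs do s := f s x`; one step for each loop test, besides the steps of the body. -/
def forEach : List α → σ → (σ → α → Comp σ) → Comp σ
  | [], s, _ => op s
  | x :: xs, s, f => (op ()).bind fun _ => (f s x).bind fun s' => forEach xs s' f

/-- `for (x, y) in xs × ys do s := f s x y`, where nothing is scanned if `ys` is empty. -/
def forPairs (xs : List α) (ys : List β) (s : σ) (f : σ → α → β → Comp σ) : Comp σ :=
  (op ys.isEmpty).bind fun b =>
    if b then op s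
    else forEach xs s fun s x => forEach ys s fun s y => f s x y

/-- `for (x, y, z) in xs × ys × zs do s := f s x y z`, where nothing is scanned if `ys` or `zs`
is empty. -/
def forTriples (xs : List α) (ys : List β) (zs : List γ) (s : σ)
    (f : σ → α → β → γ → Comp σ) : Comp σ :=
  (op (ys.isEmpty || zs.isEmpty)).bind fun b =>
    if b then op s
    else forEach xs s fun s x => forEach ys s fun s y => forEach zs s fun s z => f s x y z

/-- Number of elements of a linked list, by traversal. -/
def count (xs : List α) : Comp ℕ := forEach xs 0 fun n _ => op (n + 1)

end Comp

/-- A randomized step-counted computation: the joint law of result and step count.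
The result is `none` if a loop was cut off (see `retry`). -/
abbrev Rand (α : Type*) := PMF (Comp (Option α))

namespace Rand

variable {α : Type u} {β : Type v}

noncomputable def lift (c : Comp α) : Rand α := PMF.pure ⟨some c.val, c.time⟩

noncomputable def bind (x : Rand α) (f : α → Rand β) : Rand β :=
  PMF.bind x fun r =>
    match r with
    | ⟨none, t⟩ => PMF.pure ⟨none, t⟩
    | ⟨some a, t⟩ => PMF.map (fun r' => ⟨r'.val, t + r'.time⟩) (f a)

/-- Expected number of steps. -/
noncomputable def expectedTime (x : Rand α) : ℝ≥0∞ := ∑' r, x r * (r.time : ℝ≥0∞)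

/-- Probability that the computation was cut off. -/
noncomputable def failure (x : Rand α) : ℝ≥0∞ := ∑' r, Set.indicator {r | r.val = none} x r

/-- `a` is a possible result of `x`. -/
def Returns (x : Rand α) (a : α) : Prop := ∃ t : ℕ, (⟨some a, t⟩ : Comp (Option α)) ∈ x.support

end Rand

/-! ### Perfect hashing

The two-level scheme of Fredman, Komlós and Szemerédi, with the universal family
`x ↦ ((a x + b) mod p) mod m`, `a ≠ 0`. Keys are residues modulo a prime `p`. Values with the same
key are kept together in a list. -/

section Hashing

variable {p : ℕ} {V : Type u}

abbrev Seed (p : ℕ) := (ZMod p)ˣ × ZMod p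

def hash (s : Seed p) (m : ℕ) (x : ZMod p) : ℕ := ((s.1 : ZMod p) * x + s.2).val % m

/-- `repeat draw a uniform seed s; r := trial s until r ≠ none`, cut off after `N` rounds.
The loop without cut-off is the limit `N → ∞`. -/
noncomputable def retry [Fact p.Prime] {α : Type u} (trial : Seed p → Comp (Option α)) :
    ℕ → Rand α
  | 0 => PMF.pure ⟨none, 0⟩
  | N + 1 => (PMF.uniformOfFintype (Seed p)).bind fun s =>
      match trial s with
      | ⟨some a, t⟩ => PMF.pure ⟨some a, t + 1⟩
      | ⟨none, t⟩ => PMF.map (fun r => ⟨r.val, t + 1 + r.time⟩) (retry trial N)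

/-- An association list from keys to lists of values. -/
abbrev Chain (p : ℕ) (V : Type u) := List (ZMod p × List V)

/-- Insert `v` under the key `k`, by linear search. -/
def insertKey (k : ZMod p) (v : V) : Chain p V → Comp (Chain p V)
  | [] => Comp.op [(k, [v])]
  | (k', vs) :: c => (Comp.op (decide (k' = k))).bind fun same =>
      if same then Comp.op ((k', v :: vs) :: c)
      else (insertKey k v c).bind fun c' => Comp.op ((k', vs) :: c')

/-- Distribute the values over `m` chains. -/
def distribute (key : V → ZMod p) (s : Seed p) (m : ℕ) (vs : List V) : Comp (ℕ → Chain p V) :=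
  (Comp.alloc m []).bind fun t =>
    Comp.forEach vs t fun t v =>
      (Comp.op (hash s m (key v))).bind fun j =>
      (Comp.op (t j)).bind fun c =>
      (insertKey (key v) v c).bind fun c' =>
      Comp.op (Function.update t j c')

/-- `∑ j < m, k j ^ 2`, where `k j` is the number of keys in the chain `j`. -/
def sumSquares (t : ℕ → Chain p V) (m : ℕ) : Comp ℕ :=
  Comp.forEach (List.range m) 0 fun acc j =>
    (Comp.op (t j)).bind fun c =>
    (Comp.count c).bind fun k =>
    Comp.op (acc + k * k)

/-- First level: as many chains as values; the seed is accepted if `∑ j, k j ^ 2 ≤ 4 m`. -/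
def levelOne (key : V → ZMod p) (m : ℕ) (vs : List V) (s : Seed p) :
    Comp (Option (Seed p × (ℕ → Chain p V))) :=
  (distribute key s m vs).bind fun t =>
  (sumSquares t m).bind fun c =>
  Comp.op (if c ≤ 4 * m then some (s, t) else none)

/-- A second-level table: each cell holds at most one key. -/
structure Slot (p : ℕ) (V : Type u) where
  size : ℕ
  seed : Seed p
  cells : ℕ → Option (ZMod p × List V)

def Slot.empty : Slot p V := ⟨0, (1, 0), fun _ => none⟩

/-- Store the keys of a chain in the cells; fails at the first collision. -/
def place (s : Seed p) (m : ℕ) :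
    Chain p V → (ℕ → Option (ZMod p × List V)) → Comp (Option (Slot p V))
  | [], t => Comp.op (some ⟨m, s, t⟩)
  | kv :: c, t =>
      (Comp.op (hash s m kv.1)).bind fun i =>
      (Comp.op (t i)).bind fun cell =>
      match cell with
      | some _ => Comp.op none
      | none => (Comp.op (Function.update t i (some kv))).bind fun t' => place s m c t'

/-- Second level: a chain with `k` keys gets `k ^ 2` cells; the seed is accepted if it is
injective on these keys. -/
def levelTwo (c : Chain p V) (s : Seed p) : Comp (Option (Slot p V)) :=
  (Comp.count c).bind fun k =>
  (Comp.alloc (k * k) none).bind fun t =>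
  place s (k * k) c t

structure HashTable (p : ℕ) (V : Type u) where
  size : ℕ
  seed : Seed p
  slots : ℕ → Slot p V

def HashTable.empty : HashTable p V := ⟨0, (1, 0), fun _ => Slot.empty⟩

noncomputable def buildSlots [Fact p.Prime] (N : ℕ) (t : ℕ → Chain p V) :
    List ℕ → (ℕ → Slot p V) → Rand (ℕ → Slot p V)
  | [], a => Rand.lift (Comp.op a)
  | j :: js, a =>
      (retry (levelTwo (t j)) N).bind fun b =>
      (Rand.lift (Comp.op (Function.update a j b))).bind fun a' =>
      buildSlots N t js a'

/-- Perfect hash table of the values `vs` with respect to `key`; every search for a seed is cut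
off after `N` rounds. -/
noncomputable def buildTable [Fact p.Prime] (N : ℕ) (key : V → ZMod p) (vs : List V) :
    Rand (HashTable p V) :=
  (Rand.lift (Comp.count vs)).bind fun m =>
  (retry (levelOne key m vs) N).bind fun st =>
  (Rand.lift (Comp.alloc m Slot.empty)).bind fun a =>
  (buildSlots N st.2 (List.range m) a).bind fun a' =>
  Rand.lift (Comp.op ⟨m, st.1, a'⟩)

/-- The list of stored values with key `k`. -/
def lookup (h : HashTable p V) (k : ZMod p) : Comp (List V) :=
  (Comp.op (hash h.seed h.size k)).bind fun j =>
  (Comp.op (h.slots j)).bind fun b =>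
  (Comp.op (hash b.seed b.size k)).bind fun i =>
  (Comp.op (b.cells i)).bind fun cell =>
  match cell with
  | none => Comp.op []
  | some (k', vs) => (Comp.op (decide (k' = k))).bind fun same =>
      if same then Comp.op vs else Comp.op []

end Hashing

/-! ### Weighted transducers without ε-transitions -/

@[ext] structure Transition (K A B S : Type*) where
  src : S
  inp : A
  out : B
  weight : K
  dst : S

/-- A weighted transducer without ε-transitions over the semiring `K`, with input labels in `A`,
output labels in `B` and states in `S`. The transitions form a finite collection in which a
transition may be repeated; the order of the lists is that in which they are stored, and does not
matter. The values of `initWeight` outside `init`, and of `finalWeight` outside `final`, are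
irrelevant. -/
structure WFST (K A B S : Type*) where
  states : List S
  init : List S
  final : List S
  trans : List (Transition K A B S)
  initWeight : S → K
  finalWeight : S → K

namespace WFST

variable {K A B S : Type*}

structure Valid (T : WFST K A B S) : Prop where
  states_nodup : T.states.Nodup
  init_nodup : T.init.Nodup
  final_nodup : T.final.Nodup
  init_subset : T.init ⊆ T.states
  final_subset : T.final ⊆ T.states
  src_mem : ∀ e ∈ T.trans, e.src ∈ T.states
  dst_mem : ∀ e ∈ T.trans, e.dst ∈ T.states

/-- `|T|_Q`. -/
def numStates (T : WFST K A B S) : ℕ := T.states.length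

/-- `|T|_E`. -/
def numTrans (T : WFST K A B S) : ℕ := T.trans.length

/-- `E[q]`, the transitions leaving `q`. -/
def leaving [DecidableEq S] (T : WFST K A B S) (q : S) : List (Transition K A B S) :=
  T.trans.filter fun e => e.src = q

/-- `d(T)`, the maximum out-degree. -/
def maxOutDegree [DecidableEq S] (T : WFST K A B S) : ℕ :=
  T.states.toFinset.sup fun q => (T.leaving q).length

/-- `π` is a path from `p` to `q`. A path is a sequence of transitions; these are given by
their positions, so that the copies of a repeated transition are told apart. -/
def IsPath (T : WFST K A B S) : S → List (Fin T.trans.length) → S → Prop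
  | p, [], q => p = q
  | p, e :: π, q => (T.trans.get e).src = p ∧ T.IsPath (T.trans.get e).dst π q

/-- `P(I, x, y, F)`, the paths labelled with `(x, y)` from an initial to a final state, each with
its origin and its destination. -/
def paths (T : WFST K A B S) (x : List A) (y : List B) :
    Set (S × List (Fin T.trans.length) × S) :=
  {π | π.1 ∈ T.init ∧ π.2.2 ∈ T.final ∧ T.IsPath π.1 π.2.1 π.2.2 ∧
    (π.2.1.map fun e => (T.trans.get e).inp) = x ∧ (π.2.1.map fun e => (T.trans.get e).out) = y}

/-- The sum that defines `weight` is finite. -/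
theorem paths_finite (T : WFST K A B S) (x : List A) (y : List B) : (T.paths x y).Finite := by
  have h1 : {p : S | p ∈ T.init}.Finite := T.init.finite_toSet
  have h2 : {p : S | p ∈ T.final}.Finite := T.final.finite_toSet
  have h3 := List.finite_length_eq (Fin T.trans.length) x.length
  refine (h1.prod (h3.prod h2)).subset ?_
  rintro ⟨p, π, q⟩ ⟨hp, hq, -, hx, -⟩
  refine ⟨hp, ?_, hq⟩
  have := congrArg List.length hx
  simpa using this

/-- `T(x, y)`, the weight that `T` assigns to the pair of strings `(x, y)`. -/
noncomputable def weight [Semiring K] (T : WFST K A B S) (x : List A) (y : List B) : K :=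
  ∑ᶠ π ∈ T.paths x y,
    T.initWeight π.1 * (π.2.1.map fun e => (T.trans.get e).weight).prod * T.finalWeight π.2.2

/-- `T'` is `T` with every state `q` renamed to `f q`, up to the order of the lists. -/
def RenamesTo {S' : Type*} (f : S → S') (T : WFST K A B S) (T' : WFST K A B S') : Prop :=
  (T.states.map f).Perm T'.states ∧
  (T.init.map f).Perm T'.init ∧
  (T.final.map f).Perm T'.final ∧
  (T.trans.map fun e => ⟨f e.src, e.inp, e.out, e.weight, f e.dst⟩).Perm T'.trans ∧
  (∀ q ∈ T.init, T'.initWeight (f q) = T.initWeight q) ∧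
  (∀ q ∈ T.final, T'.finalWeight (f q) = T.finalWeight q)

end WFST

/-- The identity transducer: one state, and a loop `a : a` with weight `1` for every letter. -/
noncomputable def identity (K : Type*) [Semiring K] (A : Type*) [Fintype A] :
    WFST K A A Unit where
  states := [()]
  init := [()]
  final := [()]
  trans := Finset.univ.toList.map fun a => ⟨(), a, a, 1, ()⟩
  initWeight := fun _ => 1
  finalWeight := fun _ => 1

/-! ### The composition of three transducers as a transducer -/

section Spec

variable {K A B C D S₁ S₂ S₃ : Type*} [CommSemiring K]

/-- The triples of states that can be reached from `I₁ × I₂ × I₃` by matching transitions. -/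
inductive Accessible (T₁ : WFST K A B S₁) (T₂ : WFST K B C S₂) (T₃ : WFST K C D S₃) :
    S₁ × S₂ × S₃ → Prop
  | start {q₁ : S₁} {q₂ : S₂} {q₃ : S₃} :
      q₁ ∈ T₁.init → q₂ ∈ T₂.init → q₃ ∈ T₃.init → Accessible T₁ T₂ T₃ (q₁, q₂, q₃)
  | step {e₁ : Transition K A B S₁} {e₂ : Transition K B C S₂} {e₃ : Transition K C D S₃} :
      e₁ ∈ T₁.trans → e₂ ∈ T₂.trans → e₃ ∈ T₃.trans → e₁.out = e₂.inp → e₂.out = e₃.inp →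
      Accessible T₁ T₂ T₃ (e₁.src, e₂.src, e₃.src) →
      Accessible T₁ T₂ T₃ (e₁.dst, e₂.dst, e₃.dst)

/-- The transition made of three matching transitions. -/
def combine (e₁ : Transition K A B S₁) (e₂ : Transition K B C S₂) (e₃ : Transition K C D S₃) :
    Transition K A D (S₁ × S₂ × S₃) :=
  ⟨(e₁.src, e₂.src, e₃.src), e₁.inp, e₃.out, e₁.weight * e₂.weight * e₃.weight,
    (e₁.dst, e₂.dst, e₃.dst)⟩

variable [DecidableEq B] [DecidableEq C] [DecidableEq S₁] [DecidableEq S₂] [DecidableEq S₃]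

/-- The transitions of the composed transducer that leave `q`, one for each matching triple. -/
def matchesAt (T₁ : WFST K A B S₁) (T₂ : WFST K B C S₂) (T₃ : WFST K C D S₃)
    (q : S₁ × S₂ × S₃) : List (Transition K A D (S₁ × S₂ × S₃)) :=
  (T₁.leaving q.1).flatMap fun e₁ => (T₂.leaving q.2.1).flatMap fun e₂ =>
    ((T₃.leaving q.2.2).filter fun e₃ => e₁.out = e₂.inp ∧ e₂.out = e₃.inp).map fun e₃ =>
      combine e₁ e₂ e₃

/-- `T` is the transducer on the accessible triples of states, with one transition for each
matching triple of transitions. -/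
structure IsTripleProduct (T₁ : WFST K A B S₁) (T₂ : WFST K B C S₂) (T₃ : WFST K C D S₃)
    (T : WFST K A D (S₁ × S₂ × S₃)) : Prop where
  valid : T.Valid
  mem_states : ∀ q, q ∈ T.states ↔ Accessible T₁ T₂ T₃ q
  mem_init : ∀ q, q ∈ T.init ↔ q.1 ∈ T₁.init ∧ q.2.1 ∈ T₂.init ∧ q.2.2 ∈ T₃.init
  mem_final : ∀ q, q ∈ T.final ↔
    q ∈ T.states ∧ q.1 ∈ T₁.final ∧ q.2.1 ∈ T₂.final ∧ q.2.2 ∈ T₃.final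
  initWeight_eq : ∀ q ∈ T.init,
    T.initWeight q = T₁.initWeight q.1 * T₂.initWeight q.2.1 * T₃.initWeight q.2.2
  finalWeight_eq : ∀ q ∈ T.final,
    T.finalWeight q = T₁.finalWeight q.1 * T₂.finalWeight q.2.1 * T₃.finalWeight q.2.2
  trans_perm : T.trans.Perm (T.states.flatMap (matchesAt T₁ T₂ T₃))

end Spec

/-! ### The algorithms

The input transducers are stored as adjacency lists: the list `E[q]`, its length, membership
of `q` in `I` or `F`, and `λ(q)`, `ρ(q)` are each available in one step. Membership of a tuple of
states in the set `Q` of the states found so far is a bit in a table addressed by that tuple. -/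

inductive Discipline
  | fifo
  | lifo

/-- The transducer built so far, and the queue of its unexamined states. -/
structure Config (K A D S : Type*) where
  out : WFST K A D S
  queue : List S

section Worklist

variable {K A D S : Type*} [CommSemiring K] [DecidableEq S]

def Config.start : Config K A D S := ⟨⟨[], [], [], [], fun _ => 0, fun _ => 0⟩, []⟩

def Config.enqueue (c : Config K A D S) : Discipline → S → Config K A D S
  | .fifo, q => { c with queue := c.queue ++ [q] }
  | .lifo, q => { c with queue := q :: c.queue }

/-- `if q ∉ Q then Q := Q ∪ {q}; Enqueue(S, q)`. -/
def discover (disc : Discipline) (c : Config K A D S) (q : S) : Comp (Config K A D S) :=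
  (Comp.op (decide (q ∈ c.out.states))).bind fun known =>
    if known then Comp.op c
    else
      (Comp.op { c with out := { c.out with states := q :: c.out.states } }).bind fun c' =>
      Comp.op (c'.enqueue disc q)

/-- Add a transition to `E`, and its destination to `Q`. -/
def emit (disc : Discipline) (c : Config K A D S) (e : Transition K A D S) :
    Comp (Config K A D S) :=
  (Comp.op { c with out := { c.out with trans := e :: c.out.trans } }).bind fun c' =>
    discover disc c' e.dst

def markInit (c : Config K A D S) (q : S) (w : K) : Comp (Config K A D S) :=
  Comp.op { c with out := { c.out with
    init := q :: c.out.init, initWeight := Function.update c.out.initWeight q w } }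

def markFinal (c : Config K A D S) (q : S) (w : K) : Comp (Config K A D S) :=
  Comp.op { c with out := { c.out with
    final := q :: c.out.final, finalWeight := Function.update c.out.finalWeight q w } }

/-- `while S ≠ ∅ do q := Head(S); Dequeue(S); visit q`, followed by the return of the transducer.
The result is `none` if the loop has not ended within `N` tests of its condition. -/
def worklist (visit : Config K A D S → S → Comp (Config K A D S)) :
    ℕ → Config K A D S → Comp (Option (WFST K A D S))
  | 0, _ => ⟨none, 0⟩
  | N + 1, c =>
      match c.queue with
      | [] => Comp.op (some c.out)
      | q :: rest =>
          (Comp.op { c with queue := rest }).bind fun c' =>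
          (visit c' q).bind fun c'' => worklist visit N c''

end Worklist

/-- Numbering of the hash keys by residues modulo `p`: transitions of `T₁` are hashed by source and
output label, those of `T₂` by source and both labels, those of `T₃` by source and input label. -/
structure Codes (p : ℕ) (B C S₁ S₂ S₃ : Type*) where
  code₁ : S₁ × B ↪ ZMod p
  code₂ : S₂ × B × C ↪ ZMod p
  code₃ : S₃ × C ↪ ZMod p

structure Tables (p : ℕ) (K A B C D S₁ S₂ S₃ : Type*) where
  table₁ : HashTable p (Transition K A B S₁)
  table₂ : HashTable p (Transition K B C S₂)
  table₃ : HashTable p (Transition K C D S₃)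

inductive Strategy
  | lateral
  | central
  | combined

section Algorithm

variable {p : ℕ} {K A B C D S₁ S₂ S₃ : Type*} [CommSemiring K]
variable [DecidableEq S₁] [DecidableEq S₂] [DecidableEq S₃]

/-- Preprocessing: the lateral strategy hashes `T₂`, the central one `T₁` and `T₃`, the combined
one all three. -/
noncomputable def preprocess [Fact p.Prime] (N : ℕ) (cd : Codes p B C S₁ S₂ S₃)
    (T₁ : WFST K A B S₁) (T₂ : WFST K B C S₂) (T₃ : WFST K C D S₃) :
    Strategy → Rand (Tables p K A B C D S₁ S₂ S₃)
  | .lateral =>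
      (buildTable N (fun e => cd.code₂ (e.src, e.inp, e.out)) T₂.trans).bind fun h₂ =>
      Rand.lift (Comp.op ⟨HashTable.empty, h₂, HashTable.empty⟩)
  | .central =>
      (buildTable N (fun e => cd.code₁ (e.src, e.out)) T₁.trans).bind fun h₁ =>
      (buildTable N (fun e => cd.code₃ (e.src, e.inp)) T₃.trans).bind fun h₃ =>
      Rand.lift (Comp.op ⟨h₁, HashTable.empty, h₃⟩)
  | .combined =>
      (buildTable N (fun e => cd.code₁ (e.src, e.out)) T₁.trans).bind fun h₁ =>
      (buildTable N (fun e => cd.code₂ (e.src, e.inp, e.out)) T₂.trans).bind fun h₂ =>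
      (buildTable N (fun e => cd.code₃ (e.src, e.inp)) T₃.trans).bind fun h₃ =>
      Rand.lift (Comp.op ⟨h₁, h₂, h₃⟩)

/-- The number of transitions that the preprocessing has to hash. -/
def hashedTrans (T₁ : WFST K A B S₁) (T₂ : WFST K B C S₂) (T₃ : WFST K C D S₃) : Strategy → ℕ
  | .lateral => T₂.numTrans
  | .central => T₁.numTrans + T₃.numTrans
  | .combined => T₁.numTrans + T₂.numTrans + T₃.numTrans

/-- The bound for the number of matches to look up in one state. -/
def branching (T₁ : WFST K A B S₁) (T₂ : WFST K B C S₂) (T₃ : WFST K C D S₃) : Strategy → ℕ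
  | .lateral => T₁.maxOutDegree * T₃.maxOutDegree
  | .central => T₂.maxOutDegree
  | .combined => min (T₁.maxOutDegree * T₃.maxOutDegree) T₂.maxOutDegree

/-- Add the transition made of three matching transitions. -/
def emitTriple (disc : Discipline) (c : Config K A D (S₁ × S₂ × S₃))
    (e₁ : Transition K A B S₁) (e₂ : Transition K B C S₂) (e₃ : Transition K C D S₃) :
    Comp (Config K A D (S₁ × S₂ × S₃)) :=
  (Comp.op (e₁.weight * e₂.weight)).bind fun w =>
  (Comp.op (w * e₃.weight)).bind fun w' =>
  emit disc c ⟨(e₁.src, e₂.src, e₃.src), e₁.inp, e₃.out, w', (e₁.dst, e₂.dst, e₃.dst)⟩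

/-- For each `(e₁, e₃) ∈ E[q₁] × E[q₃]`, look up the matching `e₂ ∈ E[q₂]`. -/
def lateral (cd : Codes p B C S₁ S₂ S₃) (tab : Tables p K A B C D S₁ S₂ S₃)
    (T₁ : WFST K A B S₁) (T₃ : WFST K C D S₃) (disc : Discipline)
    (c : Config K A D (S₁ × S₂ × S₃)) (q : S₁ × S₂ × S₃) : Comp (Config K A D (S₁ × S₂ × S₃)) :=
  Comp.forPairs (T₁.leaving q.1) (T₃.leaving q.2.2) c fun c e₁ e₃ =>
    (lookup tab.table₂ (cd.code₂ (q.2.1, e₁.out, e₃.inp))).bind fun G =>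
    Comp.forEach G c fun c e₂ => emitTriple disc c e₁ e₂ e₃

/-- For each `e₂ ∈ E[q₂]`, look up the matching `e₁ ∈ E[q₁]` and `e₃ ∈ E[q₃]`. -/
def central (cd : Codes p B C S₁ S₂ S₃) (tab : Tables p K A B C D S₁ S₂ S₃)
    (T₂ : WFST K B C S₂) (disc : Discipline)
    (c : Config K A D (S₁ × S₂ × S₃)) (q : S₁ × S₂ × S₃) : Comp (Config K A D (S₁ × S₂ × S₃)) :=
  Comp.forEach (T₂.leaving q.2.1) c fun c e₂ =>
    (lookup tab.table₁ (cd.code₁ (q.1, e₂.inp))).bind fun G₁ =>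
    (lookup tab.table₃ (cd.code₃ (q.2.2, e₂.out))).bind fun G₃ =>
    Comp.forPairs G₁ G₃ c fun c e₁ e₃ => emitTriple disc c e₁ e₂ e₃

/-- Generate the transitions leaving `q`. The combined strategy is lateral at `q` if
`|E[q₁]| |E[q₃]| ≤ |E[q₂]|`, and central otherwise. -/
def expand (cd : Codes p B C S₁ S₂ S₃) (tab : Tables p K A B C D S₁ S₂ S₃)
    (T₁ : WFST K A B S₁) (T₂ : WFST K B C S₂) (T₃ : WFST K C D S₃) (disc : Discipline)
    (c : Config K A D (S₁ × S₂ × S₃)) (q : S₁ × S₂ × S₃) :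
    Strategy → Comp (Config K A D (S₁ × S₂ × S₃))
  | .lateral => lateral cd tab T₁ T₃ disc c q
  | .central => central cd tab T₂ disc c q
  | .combined =>
      (Comp.op ((T₁.leaving q.1).length * (T₃.leaving q.2.2).length)).bind fun m =>
      (Comp.op (decide (m ≤ (T₂.leaving q.2.1).length))).bind fun b =>
      if b then lateral cd tab T₁ T₃ disc c q else central cd tab T₂ disc c q

/-- Examination of one state: mark it as initial or final if it is, then expand it. -/
def visit (strat : Strategy) (cd : Codes p B C S₁ S₂ S₃) (tab : Tables p K A B C D S₁ S₂ S₃)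
    (T₁ : WFST K A B S₁) (T₂ : WFST K B C S₂) (T₃ : WFST K C D S₃) (disc : Discipline)
    (c : Config K A D (S₁ × S₂ × S₃)) (q : S₁ × S₂ × S₃) : Comp (Config K A D (S₁ × S₂ × S₃)) :=
  (Comp.op (decide (q.1 ∈ T₁.init ∧ q.2.1 ∈ T₂.init ∧ q.2.2 ∈ T₃.init))).bind fun isInit =>
  (if isInit then
      (Comp.op (T₁.initWeight q.1 * T₂.initWeight q.2.1)).bind fun w =>
      (Comp.op (w * T₃.initWeight q.2.2)).bind fun w' => markInit c q w'
    else Comp.op c).bind fun c' =>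
  (Comp.op (decide (q.1 ∈ T₁.final ∧ q.2.1 ∈ T₂.final ∧ q.2.2 ∈ T₃.final))).bind fun isFinal =>
  (if isFinal then
      (Comp.op (T₁.finalWeight q.1 * T₂.finalWeight q.2.1)).bind fun w =>
      (Comp.op (w * T₃.finalWeight q.2.2)).bind fun w' => markFinal c' q w'
    else Comp.op c').bind fun c'' =>
  expand cd tab T₁ T₂ T₃ disc c'' q strat

/-- 3-way composition, after the preprocessing. -/
def threeWay (strat : Strategy) (cd : Codes p B C S₁ S₂ S₃)
    (tab : Tables p K A B C D S₁ S₂ S₃)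
    (T₁ : WFST K A B S₁) (T₂ : WFST K B C S₂) (T₃ : WFST K C D S₃) (disc : Discipline) (N : ℕ) :
    Comp (Option (WFST K A D (S₁ × S₂ × S₃))) :=
  (Comp.forTriples T₁.init T₂.init T₃.init Config.start fun c q₁ q₂ q₃ =>
    discover disc c (q₁, q₂, q₃)).bind fun c =>
  worklist (visit strat cd tab T₁ T₂ T₃ disc) N c

/-- The 3-way composition algorithm ends, in `t` steps, with result `T`. -/
def ThreeWayEnds (strat : Strategy) (cd : Codes p B C S₁ S₂ S₃)
    (tab : Tables p K A B C D S₁ S₂ S₃)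
    (T₁ : WFST K A B S₁) (T₂ : WFST K B C S₂) (T₃ : WFST K C D S₃) (disc : Discipline)
    (T : WFST K A D (S₁ × S₂ × S₃)) (t : ℕ) : Prop :=
  ∃ N, threeWay strat cd tab T₁ T₂ T₃ disc N = ⟨some T, t⟩

end Algorithm

/-! ### Standard composition of two transducers -/

section Standard

variable {p : ℕ} {K A B C S₁ S₂ : Type*} [CommSemiring K]
variable [DecidableEq S₁] [DecidableEq S₂]

/-- The transducer that is hashed; the transitions of the other one are scanned. -/
inductive Hashed (p : ℕ) (K A B C S₁ S₂ : Type*)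
  | first (code : S₁ × B ↪ ZMod p) (table : HashTable p (Transition K A B S₁))
  | second (code : S₂ × B ↪ ZMod p) (table : HashTable p (Transition K B C S₂))

/-- The table is a possible outcome of the preprocessing. -/
def Hashed.Prepared [Fact p.Prime] (T₁ : WFST K A B S₁) (T₂ : WFST K B C S₂) :
    Hashed p K A B C S₁ S₂ → Prop
  | .first code h => ∃ N, (buildTable N (fun e => code (e.src, e.out)) T₁.trans).Returns h
  | .second code h => ∃ N, (buildTable N (fun e => code (e.src, e.inp)) T₂.trans).Returns h

def emitPair (disc : Discipline) (c : Config K A C (S₁ × S₂))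
    (e₁ : Transition K A B S₁) (e₂ : Transition K B C S₂) : Comp (Config K A C (S₁ × S₂)) :=
  (Comp.op (e₁.weight * e₂.weight)).bind fun w =>
  emit disc c ⟨(e₁.src, e₂.src), e₁.inp, e₂.out, w, (e₁.dst, e₂.dst)⟩

def expandPair (T₁ : WFST K A B S₁) (T₂ : WFST K B C S₂) (disc : Discipline)
    (c : Config K A C (S₁ × S₂)) (q : S₁ × S₂) :
    Hashed p K A B C S₁ S₂ → Comp (Config K A C (S₁ × S₂))
  | .first code h => Comp.forEach (T₂.leaving q.2) c fun c e₂ =>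
      (lookup h (code (q.1, e₂.inp))).bind fun G =>
      Comp.forEach G c fun c e₁ => emitPair disc c e₁ e₂
  | .second code h => Comp.forEach (T₁.leaving q.1) c fun c e₁ =>
      (lookup h (code (q.2, e₁.out))).bind fun G =>
      Comp.forEach G c fun c e₂ => emitPair disc c e₁ e₂

def visitPair (hs : Hashed p K A B C S₁ S₂) (T₁ : WFST K A B S₁) (T₂ : WFST K B C S₂)
    (disc : Discipline) (c : Config K A C (S₁ × S₂)) (q : S₁ × S₂) :
    Comp (Config K A C (S₁ × S₂)) :=
  (Comp.op (decide (q.1 ∈ T₁.init ∧ q.2 ∈ T₂.init))).bind fun isInit =>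
  (if isInit then
      (Comp.op (T₁.initWeight q.1 * T₂.initWeight q.2)).bind fun w => markInit c q w
    else Comp.op c).bind fun c' =>
  (Comp.op (decide (q.1 ∈ T₁.final ∧ q.2 ∈ T₂.final))).bind fun isFinal =>
  (if isFinal then
      (Comp.op (T₁.finalWeight q.1 * T₂.finalWeight q.2)).bind fun w => markFinal c' q w
    else Comp.op c').bind fun c'' =>
  expandPair T₁ T₂ disc c'' q hs

/-- Standard composition, after the preprocessing. -/
def standard (hs : Hashed p K A B C S₁ S₂) (T₁ : WFST K A B S₁) (T₂ : WFST K B C S₂)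
    (disc : Discipline) (N : ℕ) : Comp (Option (WFST K A C (S₁ × S₂))) :=
  (Comp.forPairs T₁.init T₂.init Config.start fun c q₁ q₂ => discover disc c (q₁, q₂)).bind fun c =>
  worklist (visitPair hs T₁ T₂ disc) N c

/-- The standard composition algorithm ends, in `t` steps, with result `T`. -/
def StandardEnds (hs : Hashed p K A B C S₁ S₂) (T₁ : WFST K A B S₁) (T₂ : WFST K B C S₂)
    (disc : Discipline) (T : WFST K A C (S₁ × S₂)) (t : ℕ) : Prop :=
  ∃ N, standard hs T₁ T₂ disc N = ⟨some T, t⟩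

end Standard

end ThreeWay

open Filter Topology ThreeWay

/-! What a program computes is separated from what it costs. `Emits` says that a program folds a
fixed update over a fixed list, with step bounds that do not depend on the current state; this is
stable under sequencing and nested loops. So the expansion of a state emits a definite list of
transitions, at a cost linear in the number of lookups plus the number of transitions emitted.

The search is analysed once, for 3-way and for standard composition. The invariant `SearchInv` is
stated up to permutation, so the queue discipline is irrelevant. The states found are distinct
members of a finite set, so the loop ends (`worklist_ends`), its result satisfies `Explored`, and
its cost is the sum of the costs of the states reached. Initial triples are themselves states of the
result, which pays for the first loop.

A table returns exactly the transitions with a given key, and keys are coded injectively. Hence each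
strategy is an iterated sum over the three transition lists with a condition equivalent to matching;
the strategies differ only in the order of summation, and all give `tripleMatches`.

Perfect hashing follows Fredman, Komlós and Szemerédi. Two distinct keys collide in `m` cells with
probability at most `1/m` (`card_collisions_le`). On the first level the expected sum of squared
chain lengths is at most `2m`, so by Markov the threshold `4m` is met with probability at least 1/2.
On the second level `k` keys in `k^2` cells have fewer than one colliding ordered pair on average,
so a seed is injective with probability at least 1/2. Retrying therefore costs twice one round on
average and fails `N` times with probability at most `2^(-N)`. The accepted threshold `4m` makes the
second-level tables linear in total.

For the weights, paths are read letter by letter (`weightFrom`). Without ε-transitions the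
intermediate strings have the length of `x`, so the sum over them is finite, and induction on `x`
with commutativity factors the weight of the product.

A matching triple that involves the identity transducer uses a loop whose letter is forced and whose
weight is 1, so its transitions correspond to matching pairs. As `Explored` determines a transducer
up to the order of its lists, a bijection of states that respects the transitions gives the
renaming. The time comparison holds because the upper bound for the central strategy and the lower
bound for standard composition are multiples of the same sum over states. -/

namespace ThreeWay

/-! ### Loops whose effect is a fold -/

/-- Whatever the current state, `x` folds `step` over `L`, in at least `lo` and at most `hi`
steps. -/
def Emits {σ ε : Type*} (x : σ → Comp σ) (step : σ → ε → σ) (L : List ε) (lo hi : ℕ) : Prop :=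
  ∀ s, (x s).val = L.foldl step s ∧ lo ≤ (x s).time ∧ (x s).time ≤ hi

theorem flatMap_nil_right {α β : Type*} (xs : List α) :
    (xs.flatMap fun _ => ([] : List β)) = [] := by
  simp

namespace Emits

variable {σ ε α β γ : Type*} {step : σ → ε → σ}

theorem mono {x : σ → Comp σ} {L : List ε} {lo hi lo' hi' : ℕ} (h : Emits x step L lo hi)
    (h1 : lo' ≤ lo) (h2 : hi ≤ hi') : Emits x step L lo' hi' :=
  fun s => ⟨(h s).1, h1.trans (h s).2.1, (h s).2.2.trans h2⟩

theorem bind_left (y : Comp β) {f : β → σ → Comp σ} {L : List ε} {lo hi : ℕ}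
    (h : Emits (f y.val) step L lo hi) :
    Emits (fun s => y.bind fun b => f b s) step L (y.time + lo) (y.time + hi) := by
  intro s
  obtain ⟨h1, h2, h3⟩ := h s
  exact ⟨h1, Nat.add_le_add_left h2 _, Nat.add_le_add_left h3 _⟩

theorem forEach {f : σ → α → Comp σ} {L : α → List ε} {lo hi : α → ℕ} {xs : List α}
    (h : ∀ x ∈ xs, Emits (fun s => f s x) step (L x) (lo x) (hi x)) :
    Emits (fun s => Comp.forEach xs s f) step (xs.flatMap L)
      ((xs.map fun x => lo x + 1).sum + 1) ((xs.map fun x => hi x + 1).sum + 1) := by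
  induction xs with
  | nil => intro s; simp [Comp.forEach, Comp.op]
  | cons x xs ih =>
    intro s
    obtain ⟨h1, h2, h3⟩ := h x (by simp) s
    obtain ⟨i1, i2, i3⟩ := ih (fun y hy => h y (by simp [hy])) (f s x).val
    simp only [Comp.forEach, Comp.bind, Comp.op, List.flatMap_cons, List.foldl_append,
      List.map_cons, List.sum_cons]
    refine ⟨by rw [i1, h1], ?_, ?_⟩ <;> simp only at * <;> omega

/-- The inner loop costs two extra steps for each `x`. The early exit for empty `ys` allows them to
be charged to an element of `ys`, hence the 3. Without it, the cost would not be bounded by the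
number of pairs. -/
theorem forPairs {f : σ → α → β → Comp σ} {L : α → β → List ε} {hi : α → β → ℕ}
    {xs : List α} {ys : List β}
    (h : ∀ x ∈ xs, ∀ y ∈ ys, Emits (fun s => f s x y) step (L x y) 0 (hi x y)) :
    Emits (fun s => Comp.forPairs xs ys s f) step (xs.flatMap fun x => ys.flatMap (L x))
      1 ((xs.map fun x => (ys.map fun y => hi x y + 3).sum).sum + 2) := by
  have key := forEach (xs := xs) (f := fun s x => Comp.forEach ys s fun s y => f s x y)
    (fun x hx => forEach (h x hx))
  intro s
  by_cases hy : ys = []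
  · subst hy
    simp [Comp.forPairs, Comp.bind, Comp.op, flatMap_nil_right]
  · obtain ⟨h1, h2, h3⟩ := key s
    have hlen : 1 ≤ ys.length := List.length_pos_iff.2 hy
    have hle : (xs.map fun x => (ys.map fun y => hi x y + 1).sum + 1 + 1).sum
        ≤ (xs.map fun x => (ys.map fun y => hi x y + 3).sum).sum := by
      refine List.sum_le_sum fun x _ => ?_
      have e1 : (ys.map fun y => hi x y + 3).sum
          = (ys.map fun y => hi x y + 1).sum + ys.length * 2 := by
        have := List.sum_map_add (l := ys) (f := fun y => hi x y + 1) (g := fun _ => 2)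
        simpa [add_assoc] using this
      omega
    have hy' : ys.isEmpty = false := by simpa using hy
    simp only [Comp.forPairs, Comp.bind, Comp.op, hy', Bool.false_eq_true, if_false]
    beta_reduce at h1 h2 h3
    refine ⟨h1, ?_, ?_⟩ <;> omega

/-- As for pairs: 1 step is the innermost test, and the two outer levels charge 2 steps each to
elements of nonempty inner lists, which gives `hi + 5`. -/
theorem forTriples {f : σ → α → β → γ → Comp σ} {L : α → β → γ → List ε} {hi : ℕ}
    {xs : List α} {ys : List β} {zs : List γ}
    (h : ∀ x ∈ xs, ∀ y ∈ ys, ∀ z ∈ zs, Emits (fun s => f s x y z) step (L x y z) 0 hi) :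
    Emits (fun s => Comp.forTriples xs ys zs s f) step
      (xs.flatMap fun x => ys.flatMap fun y => zs.flatMap (L x y))
      1 (xs.length * (ys.length * (zs.length * (hi + 5))) + 2) := by
  have key := forEach (xs := xs)
    (f := fun s x => Comp.forEach ys s fun s y => Comp.forEach zs s fun s z => f s x y z)
    (fun x hx => forEach fun y hy => forEach (h x hx y hy))
  intro s
  by_cases hy : ys = []
  · subst hy
    simp [Comp.forTriples, Comp.bind, Comp.op, flatMap_nil_right]
  by_cases hz : zs = []
  · subst hz
    simp [Comp.forTriples, Comp.bind, Comp.op, flatMap_nil_right]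
  obtain ⟨h1, h2, h3⟩ := key s
  have hylen : 1 ≤ ys.length := List.length_pos_iff.2 hy
  have hzlen : 1 ≤ zs.length := List.length_pos_iff.2 hz
  simp only [List.map_const', List.sum_replicate, smul_eq_mul] at h3
  have e1 : zs.length * (hi + 1) + 1 + 1 ≤ zs.length * (hi + 3) := by nlinarith
  have e2 : ys.length * (zs.length * (hi + 1) + 1 + 1) + 1 + 1
      ≤ ys.length * (zs.length * (hi + 5)) := by
    have : 1 ≤ ys.length * zs.length := Nat.mul_pos hylen hzlen
    have := Nat.mul_le_mul_left ys.length e1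
    nlinarith
  have e3 := Nat.mul_le_mul_left xs.length e2
  have hyz : (ys.isEmpty || zs.isEmpty) = false := by simp [hy, hz]
  simp only [Comp.forTriples, Comp.bind, Comp.op, hyz, Bool.false_eq_true, if_false]
  beta_reduce at h1 h2 h3
  refine ⟨h1, ?_, ?_⟩ <;> omega

end Emits

/-! ### Exploration of a graph of states -/

section Exploration

variable {K A D S : Type*}

/-- The states that can be reached from those in `start` along the transitions listed in `L`. -/
inductive Reach (start : S → Bool) (L : S → List (Transition K A D S)) : S → Prop
  | start {q : S} : start q = true → Reach start L q
  | step {q : S} {e : Transition K A D S} : Reach start L q → e ∈ L q → Reach start L e.dst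

variable [DecidableEq S]

/-- The effect of `discover` stripped of its cost, to serve as the update that is folded in `Emits`.
-/
def discoverVal (disc : Discipline) (c : Config K A D S) (q : S) : Config K A D S :=
  if q ∈ c.out.states then c
  else Config.enqueue { c with out := { c.out with states := q :: c.out.states } } disc q

def emitVal (disc : Discipline) (c : Config K A D S) (e : Transition K A D S) : Config K A D S :=
  discoverVal disc { c with out := { c.out with trans := e :: c.out.trans } } e.dst

theorem emits_discover (disc : Discipline) (q : S) :
    Emits (fun c : Config K A D S => discover disc c q) (discoverVal disc) [q] 2 3 := by
  intro c
  by_cases h : q ∈ c.out.states <;> simp [discover, discoverVal, Comp.bind, Comp.op, h]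

theorem emits_emit (disc : Discipline) (e : Transition K A D S) :
    Emits (fun c : Config K A D S => emit disc c e) (emitVal disc) [e] 3 4 := by
  intro c
  have := emits_discover (K := K) (A := A) (D := D) disc e.dst
    { c with out := { c.out with trans := e :: c.out.trans } }
  simp only [emit, Comp.bind, Comp.op, emitVal, List.foldl_cons, List.foldl_nil] at *
  exact ⟨this.1, by omega, by omega⟩

/-- What a search step that finds the states `ds` and adds the transitions `es` does. -/
structure Extends (c c' : Config K A D S) (es : List (Transition K A D S)) (ds : List S) :
    Prop where
  init : c'.out.init = c.out.init
  final : c'.out.final = c.out.final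
  initWeight : c'.out.initWeight = c.out.initWeight
  finalWeight : c'.out.finalWeight = c.out.finalWeight
  trans : c'.out.trans.Perm (es ++ c.out.trans)
  states : ∃ new : List S, new ⊆ ds ∧ c'.out.states.Perm (new ++ c.out.states) ∧
    c'.queue.Perm (new ++ c.queue)
  nodup : c.out.states.Nodup → c'.out.states.Nodup
  found : ds ⊆ c'.out.states

omit [DecidableEq S] in
theorem Extends.refl (c : Config K A D S) : Extends c c [] [] :=
  ⟨rfl, rfl, rfl, rfl, by simp, ⟨[], by simp⟩, id, by simp⟩

omit [DecidableEq S] in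
theorem Extends.mono {c c' : Config K A D S} {es : List (Transition K A D S)} {ds : List S}
    (h : Extends c c' es ds) : c.out.states ⊆ c'.out.states := by
  obtain ⟨new, -, h2, -⟩ := h.states
  intro q hq
  exact h2.mem_iff.2 (by simp [hq])

omit [DecidableEq S] in
theorem Extends.trans' {c c' c'' : Config K A D S} {es es' : List (Transition K A D S)}
    {ds ds' : List S} (h : Extends c c' es ds) (h' : Extends c' c'' es' ds') :
    Extends c c'' (es' ++ es) (ds' ++ ds) := by
  obtain ⟨new, n1, n2, n3⟩ := h.states
  obtain ⟨new', n1', n2', n3'⟩ := h'.states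
  refine ⟨h'.init.trans h.init, h'.final.trans h.final, h'.initWeight.trans h.initWeight,
    h'.finalWeight.trans h.finalWeight, ?_, ⟨new' ++ new, ?_, ?_, ?_⟩,
    fun hn => h'.nodup (h.nodup hn), ?_⟩
  · simpa using h'.trans.trans (h.trans.append_left es')
  · exact List.append_subset.2 ⟨fun q hq => by simp [n1' hq], fun q hq => by simp [n1 hq]⟩
  · simpa using n2'.trans (n2.append_left new')
  · simpa using n3'.trans (n3.append_left new')
  · exact List.append_subset.2 ⟨h'.found, fun q hq => h'.mono (h.found hq)⟩

/-- The only place where the queue discipline is inspected: insertion at either end gives the same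
queue up to permutation. -/
theorem extends_discoverVal (disc : Discipline) (c : Config K A D S) (q : S) :
    Extends c (discoverVal disc c q) [] [q] := by
  by_cases h : q ∈ c.out.states
  · rw [discoverVal, if_pos h]
    exact ⟨rfl, rfl, rfl, rfl, by simp, ⟨[], by simp⟩, id, by simpa using h⟩
  · rw [discoverVal, if_neg h]
    cases disc
    · refine ⟨rfl, rfl, rfl, rfl, by simp [Config.enqueue], ⟨[q], by simp, ?_, ?_⟩, ?_, ?_⟩
      · simp [Config.enqueue]
      · simp [Config.enqueue]
      · simpa [Config.enqueue] using fun hn => ⟨h, hn⟩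
      · simp [Config.enqueue]
    · refine ⟨rfl, rfl, rfl, rfl, by simp [Config.enqueue], ⟨[q], by simp, ?_, ?_⟩, ?_, ?_⟩
      · simp [Config.enqueue]
      · simp [Config.enqueue]
      · simpa [Config.enqueue] using fun hn => ⟨h, hn⟩
      · simp [Config.enqueue]

theorem extends_emitVal (disc : Discipline) (c : Config K A D S) (e : Transition K A D S) :
    Extends c (emitVal disc c e) [e] [e.dst] := by
  have h := extends_discoverVal disc
    { c with out := { c.out with trans := e :: c.out.trans } } e.dst
  exact ⟨h.init, h.final, h.initWeight, h.finalWeight, h.trans, h.states, h.nodup,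
    h.found⟩

/-- The list is only recovered up to order, because `Extends.trans'` puts the later finds in front.
-/
theorem extends_foldl_discoverVal (disc : Discipline) (ds : List S) (c : Config K A D S) :
    ∃ ds', ds'.Perm ds ∧ Extends c (ds.foldl (discoverVal disc) c) [] ds' := by
  induction ds generalizing c with
  | nil => exact ⟨[], .refl _, Extends.refl c⟩
  | cons d ds ih =>
    obtain ⟨ds', h1, h2⟩ := ih (discoverVal disc c d)
    refine ⟨ds' ++ [d], ?_, (extends_discoverVal disc c d).trans' h2⟩
    exact List.perm_append_comm.trans (h1.cons d)

theorem extends_foldl_emitVal (disc : Discipline) (es : List (Transition K A D S))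
    (c : Config K A D S) :
    ∃ es', es'.Perm es ∧ Extends c (es.foldl (emitVal disc) c) es' (es'.map (·.dst)) := by
  induction es generalizing c with
  | nil => exact ⟨[], .refl _, Extends.refl c⟩
  | cons e es ih =>
    obtain ⟨es', h1, h2⟩ := ih (emitVal disc c e)
    refine ⟨es' ++ [e], List.perm_append_comm.trans (h1.cons e), ?_⟩
    simpa using (extends_emitVal disc c e).trans' h2

/-- `c'` is `c` with `q` marked as initial and final where the flags say so. -/
def markVal (isInit isFinal : S → Bool) (wi wf : S → K) (c : Config K A D S) (q : S) :
    Config K A D S :=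
  let c' := if isInit q then (markInit c q (wi q)).val else c
  if isFinal q then (markFinal c' q (wf q)).val else c'

/-- `T` is the transducer on the states reached, with the transitions listed in `L`. -/
structure Explored (isInit isFinal : S → Bool) (wi wf : S → K)
    (L : S → List (Transition K A D S)) (T : WFST K A D S) : Prop where
  nodup : T.states.Nodup
  mem_states : ∀ q, q ∈ T.states ↔ Reach isInit L q
  init_perm : T.init.Perm (T.states.filter isInit)
  final_perm : T.final.Perm (T.states.filter isFinal)
  initWeight_eq : ∀ q ∈ T.init, T.initWeight q = wi q
  finalWeight_eq : ∀ q ∈ T.final, T.finalWeight q = wf q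
  trans_perm : T.trans.Perm (T.states.flatMap L)

/-- The loop invariant of the search; `P` lists the states examined so far. -/
structure SearchInv (isInit isFinal : S → Bool) (wi wf : S → K)
    (L : S → List (Transition K A D S)) (c : Config K A D S) (P : List S) : Prop where
  nodup : c.out.states.Nodup
  perm : c.out.states.Perm (P ++ c.queue)
  reach : ∀ q ∈ c.out.states, Reach isInit L q
  start : ∀ q, isInit q = true → q ∈ c.out.states
  closed : ∀ q ∈ P, ∀ e ∈ L q, e.dst ∈ c.out.states
  init_perm : c.out.init.Perm (P.filter isInit)
  final_perm : c.out.final.Perm (P.filter isFinal)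
  initWeight_eq : ∀ q ∈ c.out.init, c.out.initWeight q = wi q
  finalWeight_eq : ∀ q ∈ c.out.final, c.out.finalWeight q = wf q
  trans_perm : c.out.trans.Perm (P.flatMap L)

variable {isInit isFinal : S → Bool} {wi wf : S → K} {L : S → List (Transition K A D S)}

-- With an empty queue every state found has been examined, so the set found contains the initial
-- states and is closed under `L`: it contains everything reachable.
omit [DecidableEq S] in
theorem SearchInv.explored {c : Config K A D S} {P : List S}
    (h : SearchInv isInit isFinal wi wf L c P) (hq : c.queue = []) :
    Explored isInit isFinal wi wf L c.out := by
  have hp : c.out.states.Perm P := by simpa [hq] using h.perm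
  refine ⟨h.nodup, fun q => ⟨h.reach q, fun hr => ?_⟩, h.init_perm.trans (hp.symm.filter _),
    h.final_perm.trans (hp.symm.filter _), h.initWeight_eq, h.finalWeight_eq,
    h.trans_perm.trans (hp.symm.flatMap_right _)⟩
  induction hr with
  | start hs => exact h.start _ hs
  | step _ he ih => exact h.closed _ (hp.mem_iff.1 ih) _ he

theorem markVal_states (c : Config K A D S) (q : S) :
    (markVal isInit isFinal wi wf c q).out.states = c.out.states := by
  unfold markVal; cases isInit q <;> cases isFinal q <;> rfl

theorem markVal_trans (c : Config K A D S) (q : S) :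
    (markVal isInit isFinal wi wf c q).out.trans = c.out.trans := by
  unfold markVal; cases isInit q <;> cases isFinal q <;> rfl

theorem markVal_queue (c : Config K A D S) (q : S) :
    (markVal isInit isFinal wi wf c q).queue = c.queue := by
  unfold markVal; cases isInit q <;> cases isFinal q <;> rfl

theorem markVal_init (c : Config K A D S) (q : S) :
    (markVal isInit isFinal wi wf c q).out.init = [q].filter isInit ++ c.out.init := by
  unfold markVal; cases h : isInit q <;> cases isFinal q <;> simp [h, markInit, markFinal, Comp.op]

theorem markVal_final (c : Config K A D S) (q : S) :
    (markVal isInit isFinal wi wf c q).out.final = [q].filter isFinal ++ c.out.final := by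
  unfold markVal; cases isInit q <;> cases h : isFinal q <;> simp [h, markInit, markFinal, Comp.op]

theorem markVal_initWeight (c : Config K A D S) (q : S)
    (h : ∀ r ∈ c.out.init, c.out.initWeight r = wi r) :
    ∀ r ∈ (markVal isInit isFinal wi wf c q).out.init,
      (markVal isInit isFinal wi wf c q).out.initWeight r = wi r := by
  intro r hr
  rw [markVal_init] at hr
  unfold markVal
  cases hi : isInit q <;> cases isFinal q <;>
    simp [hi, markInit, markFinal, Comp.op, Function.update_apply] at hr ⊢ <;> grind

theorem markVal_finalWeight (c : Config K A D S) (q : S)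
    (h : ∀ r ∈ c.out.final, c.out.finalWeight r = wf r) :
    ∀ r ∈ (markVal isInit isFinal wi wf c q).out.final,
      (markVal isInit isFinal wi wf c q).out.finalWeight r = wf r := by
  intro r hr
  rw [markVal_final] at hr
  unfold markVal
  cases isInit q <;> cases hi : isFinal q <;>
    simp [hi, markInit, markFinal, Comp.op, Function.update_apply] at hr ⊢ <;> grind

/-- Marking touches only the initial and final data, and emission only the transitions, states and
queue, so the two effects can be read off separately. -/
theorem SearchInv.step {disc : Discipline} {c : Config K A D S} {P : List S} {q : S}
    {rest : List S} (h : SearchInv isInit isFinal wi wf L c P) (hq : c.queue = q :: rest) :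
    SearchInv isInit isFinal wi wf L
      ((L q).foldl (emitVal disc) (markVal isInit isFinal wi wf { c with queue := rest } q))
      (q :: P) := by
  obtain ⟨es, hes, hx⟩ := extends_foldl_emitVal disc (L q)
    (markVal isInit isFinal wi wf { c with queue := rest } q)
  obtain ⟨new, n1, n2, n3⟩ := hx.states
  rw [markVal_states] at n2
  rw [markVal_queue] at n3
  have hqs : q ∈ c.out.states := h.perm.mem_iff.2 (by simp [hq])
  have hmono := hx.mono
  rw [markVal_states] at hmono
  refine ⟨hx.nodup ?_, ?_, ?_, fun r hr => hmono (h.start r hr), ?_, ?_, ?_, ?_, ?_, ?_⟩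
  · rw [markVal_states]; exact h.nodup
  -- The same list `new` enters the states and the queue, while `q` moves from the queue to the
  -- examined states; as multisets this is an additive identity.
  · refine n2.trans ((h.perm.append_left new).trans ?_)
    refine List.Perm.trans ?_ (n3.symm.append_left (q :: P))
    rw [hq]
    simp only [← Multiset.coe_eq_coe, ← Multiset.coe_add, ← Multiset.cons_coe]
    simp only [← Multiset.singleton_add]
    abel
  · intro r hr
    rcases List.mem_append.1 (n2.mem_iff.1 hr) with hr | hr
    · obtain ⟨e, he, rfl⟩ := List.mem_map.1 (n1 hr)
      exact Reach.step (h.reach q hqs) (hes.mem_iff.1 he)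
    · exact h.reach r hr
  · intro r hr e he
    rcases List.mem_cons.1 hr with rfl | hr
    · exact hx.found (List.mem_map_of_mem (hes.mem_iff.2 he))
    · exact hmono (h.closed r hr e he)
  · rw [hx.init, markVal_init]
    change ([q].filter isInit ++ c.out.init).Perm (([q] ++ P).filter isInit)
    rw [List.filter_append]
    exact h.init_perm.append_left _
  · rw [hx.final, markVal_final]
    change ([q].filter isFinal ++ c.out.final).Perm (([q] ++ P).filter isFinal)
    rw [List.filter_append]
    exact h.final_perm.append_left _
  · rw [hx.init, hx.initWeight]; exact markVal_initWeight _ _ h.initWeight_eq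
  · rw [hx.final, hx.finalWeight]; exact markVal_finalWeight _ _ h.finalWeight_eq
  · refine hx.trans.trans ?_
    rw [markVal_trans, List.flatMap_cons]
    exact hes.append h.trans_perm

theorem SearchInv.initial [CommSemiring K] (disc : Discipline) (ds : List S)
    (hds : ∀ q, q ∈ ds ↔ isInit q = true) :
    SearchInv isInit isFinal wi wf L (ds.foldl (discoverVal disc) Config.start) [] := by
  obtain ⟨ds', hp, hx⟩ := extends_foldl_discoverVal disc ds (Config.start (K := K) (A := A) (D := D))
  obtain ⟨new, n1, n2, n3⟩ := hx.states
  refine ⟨hx.nodup (by simp [Config.start]), ?_, ?_, ?_, by simp, ?_, ?_, ?_, ?_, ?_⟩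
  · exact (n2.trans n3.symm)
  · intro q hq
    have := n2.mem_iff.1 hq
    simp only [Config.start, List.append_nil] at this
    exact .start ((hds q).1 (hp.mem_iff.1 (n1 this)))
  · intro q hq
    exact hx.found (hp.mem_iff.2 ((hds q).2 hq))
  · rw [hx.init]; simp [Config.start]
  · rw [hx.final]; simp [Config.start]
  · rw [hx.init]; simp [Config.start]
  · rw [hx.final]; simp [Config.start]
  · simpa [Config.start] using hx.trans

/-- Induction on `n`, a bound for the number of states of `U` not yet examined. `R` lists the states
examined from now on. The cost bounds depend on `R` only, with one step for each dequeuing and one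
for the return. -/
theorem worklist_ends {visit : Config K A D S → S → Comp (Config K A D S)} {disc : Discipline}
    {lo hi : S → ℕ}
    (hval : ∀ c q, (visit c q).val = (L q).foldl (emitVal disc) (markVal isInit isFinal wi wf c q))
    (hlo : ∀ c q, lo q ≤ (visit c q).time) (hhi : ∀ c q, (visit c q).time ≤ hi q)
    (U : Finset S) (hU : ∀ q, Reach isInit L q → q ∈ U) (n : ℕ) :
    ∀ (c : Config K A D S) (P : List S), SearchInv isInit isFinal wi wf L c P →
      U.card ≤ n + P.length →
      ∃ N T t R, worklist visit N c = ⟨some T, t⟩ ∧ Explored isInit isFinal wi wf L T ∧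
        T.states.Perm (P ++ R) ∧ (R.map fun q => lo q + 1).sum + 1 ≤ t ∧
        t ≤ (R.map fun q => hi q + 1).sum + 1 := by
  induction n with
  | zero =>
    intro c P h hn
    have hq : c.queue = [] := by
      have h1 : c.out.states.toFinset ⊆ U := fun q hq => hU q (h.reach q (by simpa using hq))
      have h2 := Finset.card_le_card h1
      rw [List.toFinset_card_of_nodup h.nodup, h.perm.length_eq, List.length_append] at h2
      exact List.length_eq_zero_iff.1 (by omega)
    exact ⟨1, c.out, 1, [], by simp [worklist, hq, Comp.op], h.explored hq,
      by simpa [hq] using h.perm, by simp, by simp⟩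
  | succ n ih =>
    intro c P h hn
    match hq : c.queue with
    | [] =>
      exact ⟨1, c.out, 1, [], by simp [worklist, hq, Comp.op], h.explored hq,
        by simpa [hq] using h.perm, by simp, by simp⟩
    | q :: rest =>
      obtain ⟨N, T, t, R, h1, h2, h3, h4, h5⟩ :=
        ih _ _ (h.step (disc := disc) hq) (by simp only [List.length_cons]; omega)
      have a1 := hlo { c with queue := rest } q
      have a2 := hhi { c with queue := rest } q
      refine ⟨N + 1, T, 1 + ((visit { c with queue := rest } q).time + t), q :: R, ?_, h2,
        ?_, ?_, ?_⟩
      · rw [← hval] at h1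
        simp [worklist, hq, Comp.bind, Comp.op, h1]
      · exact h3.trans (List.perm_middle.symm)
      · simp only [List.map_cons, List.sum_cons]; omega
      · simp only [List.map_cons, List.sum_cons]; omega

-- A larger cut-off does not alter a run that has ended. Hence result and step count are unique,
-- which is needed where a theorem speaks of an arbitrary terminating run.
omit [DecidableEq S] in
theorem worklist_add {visit : Config K A D S → S → Comp (Config K A D S)} {N : ℕ}
    {c : Config K A D S} {T : WFST K A D S} {t : ℕ} (h : worklist visit N c = ⟨some T, t⟩)
    (k : ℕ) : worklist visit (N + k) c = ⟨some T, t⟩ := by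
  induction N generalizing c t with
  | zero => simp [worklist] at h
  | succ N ih =>
    rw [Nat.add_right_comm]
    match hq : c.queue with
    | [] => simpa [worklist, hq] using h
    | q :: rest =>
      simp only [worklist, hq, Comp.bind, Comp.op, Comp.mk.injEq] at h ⊢
      obtain ⟨h1, h2⟩ := h
      have := ih (c := (visit { c with queue := rest } q).val)
        (t := (worklist visit N (visit { c with queue := rest } q).val).time) (by rw [← h1])
      rw [this]
      exact ⟨rfl, h2⟩

omit [DecidableEq S] in
theorem worklist_unique {visit : Config K A D S → S → Comp (Config K A D S)} {N N' : ℕ}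
    {c : Config K A D S} {T T' : WFST K A D S} {t t' : ℕ}
    (h : worklist visit N c = ⟨some T, t⟩) (h' : worklist visit N' c = ⟨some T', t'⟩) :
    T = T' ∧ t = t' := by
  have h1 := worklist_add h N'
  have h2 := worklist_add h' N
  rw [Nat.add_comm, h2] at h1
  simpa [eq_comm] using h1

end Exploration


/-! ### Perfect hashing: values returned and running times -/

section HashValues

variable {p : ℕ} {V : Type u}

/-- The values stored under the key `k`. -/
def stored (k : ZMod p) : Chain p V → List V
  | [] => []
  | (k', vs) :: c => if k' = k then vs else stored k c

theorem stored_eq_nil {k : ZMod p} {c : Chain p V} (h : k ∉ c.map Prod.fst) :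
    stored k c = [] := by
  induction c with
  | nil => rfl
  | cons kv c ih =>
    simp only [List.map_cons, List.mem_cons, not_or] at h
    simp [stored, Ne.symm h.1, ih h.2]

theorem stored_eq_of_mem {c : Chain p V} (hc : (c.map Prod.fst).Nodup) {kv : ZMod p × List V}
    (h : kv ∈ c) : stored kv.1 c = kv.2 := by
  induction c with
  | nil => simp at h
  | cons kv' c ih =>
    simp only [List.map_cons, List.nodup_cons] at hc
    rcases List.mem_cons.1 h with rfl | h
    · simp [stored]
    · have : kv'.1 ≠ kv.1 := fun e => hc.1 (e ▸ List.mem_map_of_mem h)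
      simp [stored, this, ih hc.2 h]

theorem stored_insertKey (k k' : ZMod p) (v : V) (c : Chain p V) :
    stored k' (insertKey k v c).val = if k = k' then v :: stored k' c else stored k' c := by
  induction c with
  | nil => simp [insertKey, Comp.op, stored]
  | cons kv c ih =>
    by_cases h : kv.1 = k
    · simp only [insertKey, Comp.bind, Comp.op, h, decide_true, if_true, stored]
      split_ifs <;> rfl
    · simp only [insertKey, Comp.bind, Comp.op, h, decide_false, stored, ih, Bool.false_eq_true,
        if_false]
      split_ifs <;> grind

theorem keys_insertKey (k : ZMod p) (v : V) (c : Chain p V) :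
    (insertKey k v c).val.map Prod.fst =
      if k ∈ c.map Prod.fst then c.map Prod.fst else c.map Prod.fst ++ [k] := by
  induction c with
  | nil => simp [insertKey, Comp.op]
  | cons kv c ih =>
    by_cases h : kv.1 = k
    · simp [insertKey, Comp.bind, Comp.op, h]
    · simp only [insertKey, Comp.bind, Comp.op, h, decide_false, ih, Bool.false_eq_true,
        if_false, List.map_cons, List.mem_cons, Ne.symm h, false_or]
      split_ifs <;> rfl

theorem time_insertKey (k : ZMod p) (v : V) (c : Chain p V) :
    (insertKey k v c).time ≤ 2 * c.length + 1 := by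
  induction c with
  | nil => simp [insertKey, Comp.op]
  | cons kv c ih =>
    by_cases h : kv.1 = k
    · simp [insertKey, Comp.bind, Comp.op, h]; omega
    · simp [insertKey, Comp.bind, Comp.op, h]; omega

theorem count_val_time {α : Type*} (xs : List α) : Comp.count xs = ⟨xs.length, 2 * xs.length + 1⟩ := by
  have h : ∀ n, Comp.forEach xs n (fun n _ => Comp.op (n + 1))
      = ⟨n + xs.length, 2 * xs.length + 1⟩ := by
    induction xs with
    | nil => intro n; simp [Comp.forEach, Comp.op]
    | cons x xs ih =>
      intro n
      simp only [Comp.forEach, Comp.bind, Comp.op] at ih ⊢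
      rw [ih]
      simp only [List.length_cons, Comp.mk.injEq]
      omega
  simpa [Comp.count] using h 0

/-- The keys that are hashed to `j`. -/
def bucket (key : V → ZMod p) (s : Seed p) (m : ℕ) (vs : List V) (j : ℕ) : Finset (ZMod p) :=
  (vs.map key).toFinset.filter fun k => hash s m k = j

/-- The values `vs` are distributed over the chains `t`, with respect to `key`. -/
structure Distributed (key : V → ZMod p) (s : Seed p) (m : ℕ) (K : Finset (ZMod p)) (vs : List V)
    (t : ℕ → Chain p V) : Prop where
  nodup : ∀ j, ((t j).map Prod.fst).Nodup
  mem : ∀ j, ∀ k ∈ (t j).map Prod.fst, k ∈ K ∧ hash s m k = j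
  stored : ∀ k, (stored k (t (hash s m k))).Perm (vs.filter fun v => key v = k)

/-- `K` is the set of all keys to be inserted, not only those present. So at every moment of the
loop a chain is bounded by the final bucket, which depends on the seed alone. -/
theorem Distributed.length_le {key : V → ZMod p} {s : Seed p} {m : ℕ} {K : Finset (ZMod p)}
    {vs : List V} {t : ℕ → Chain p V} (h : Distributed key s m K vs t) (j : ℕ) :
    (t j).length ≤ (K.filter fun k => hash s m k = j).card := by
  rw [← List.length_map (f := Prod.fst), ← List.toFinset_card_of_nodup (h.nodup j)]
  exact Finset.card_le_card fun k hk => by simpa using h.mem j k (by simpa using hk)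

theorem Distributed.insert {key : V → ZMod p} {s : Seed p} {m : ℕ} {K : Finset (ZMod p)}
    {vs : List V} {t : ℕ → Chain p V} (h : Distributed key s m K vs t) {v : V} (hv : key v ∈ K) :
    Distributed key s m K (v :: vs) (Function.update t (hash s m (key v))
      (insertKey (key v) v (t (hash s m (key v)))).val) := by
  refine ⟨fun j => ?_, fun j k hk => ?_, fun k => ?_⟩
  · by_cases hj : j = hash s m (key v)
    · subst hj
      have := h.nodup (hash s m (key v))
      rw [Function.update_self, keys_insertKey]
      split_ifs with hm
      · exact this
      · exact List.Nodup.append this (by simp) (by simpa using hm)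
    · rw [Function.update_of_ne hj]; exact h.nodup j
  · by_cases hj : j = hash s m (key v)
    · subst hj
      rw [Function.update_self, keys_insertKey] at hk
      split_ifs at hk with hm
      · exact h.mem _ _ hk
      · rcases List.mem_append.1 hk with hk | hk
        · exact h.mem _ _ hk
        · rw [List.mem_singleton.1 hk]; exact ⟨hv, rfl⟩
    · rw [Function.update_of_ne hj] at hk; exact h.mem j k hk
  · by_cases hj : hash s m k = hash s m (key v)
    · rw [hj, Function.update_self, stored_insertKey, ← hj]
      by_cases hk : key v = k
      · simpa [hk] using h.stored k
      · simpa [hk] using h.stored k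
    · have hk : key v ≠ k := fun e => hj (by rw [e])
      rw [Function.update_of_ne hj]
      simpa [hk] using h.stored k

/-- Values are put in front of their lists, hence the reversal. Each insertion is a linear search
through at most the final bucket of its key. -/
theorem distribute_spec (key : V → ZMod p) (s : Seed p) (m : ℕ) (vs : List V) :
    Distributed key s m (vs.map key).toFinset vs.reverse (distribute key s m vs).val ∧
    (distribute key s m vs).time ≤
      m + 2 + (vs.map fun v => 2 * (bucket key s m vs (hash s m (key v))).card + 6).sum := by
  have loop : ∀ (ws done : List V) (t : ℕ → Chain p V),
      (∀ v ∈ ws, v ∈ vs) → Distributed key s m (vs.map key).toFinset done t →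
      Distributed key s m (vs.map key).toFinset (ws.reverse ++ done)
        (Comp.forEach ws t fun t v =>
          (Comp.op (hash s m (key v))).bind fun j =>
          (Comp.op (t j)).bind fun c =>
          (insertKey (key v) v c).bind fun c' =>
          Comp.op (Function.update t j c')).val ∧
      (Comp.forEach ws t fun t v =>
          (Comp.op (hash s m (key v))).bind fun j =>
          (Comp.op (t j)).bind fun c =>
          (insertKey (key v) v c).bind fun c' =>
          Comp.op (Function.update t j c')).time ≤
        1 + (ws.map fun v => 2 * (bucket key s m vs (hash s m (key v))).card + 6).sum := by
    intro ws
    induction ws with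
    | nil => intro done t _ h; exact ⟨by simpa [Comp.forEach, Comp.op] using h, by simp [Comp.forEach, Comp.op]⟩
    | cons v ws ih =>
      intro done t hws h
      have hv : key v ∈ (vs.map key).toFinset :=
        List.mem_toFinset.2 (List.mem_map_of_mem (hws v (by simp)))
      have h' := h.insert hv
      obtain ⟨i1, i2⟩ := ih _ _ (fun w hw => hws w (by simp [hw])) h'
      have ht := time_insertKey (key v) v (t (hash s m (key v)))
      have hl := h.length_le (hash s m (key v))
      simp only [Comp.forEach, Comp.bind, Comp.op, List.map_cons, List.sum_cons,
        List.reverse_cons, List.append_assoc, List.cons_append, List.nil_append, bucket] at *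
      exact ⟨i1, by omega⟩
  obtain ⟨h1, h2⟩ := loop vs [] (fun _ => []) (fun _ h => h)
    ⟨by simp, by simp, by simp [stored]⟩
  simp only [List.append_nil] at h1
  refine ⟨h1, ?_⟩
  simp only [distribute, Comp.bind, Comp.alloc, Comp.op] at h2 ⊢
  omega

theorem sum_map_range (f : ℕ → ℕ) (m : ℕ) :
    ((List.range m).map f).sum = ∑ j ∈ Finset.range m, f j := by
  induction m with
  | zero => simp
  | succ m ih => simp [List.range_succ, Finset.sum_range_succ, ih]

theorem sumSquares_spec (t : ℕ → Chain p V) (m : ℕ) :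
    (sumSquares t m).val = ∑ j ∈ Finset.range m, (t j).length ^ 2 ∧
    (sumSquares t m).time ≤ 1 + 6 * ∑ j ∈ Finset.range m, ((t j).length ^ 2 + 1) := by
  have loop : ∀ (js : List ℕ) (a : ℕ),
      (Comp.forEach js a fun acc j => (Comp.op (t j)).bind fun c =>
        (Comp.count c).bind fun k => Comp.op (acc + k * k)).val
        = a + (js.map fun j => (t j).length ^ 2).sum ∧
      (Comp.forEach js a fun acc j => (Comp.op (t j)).bind fun c =>
        (Comp.count c).bind fun k => Comp.op (acc + k * k)).time
        ≤ 1 + 6 * (js.map fun j => (t j).length ^ 2 + 1).sum := by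
    intro js
    induction js with
    | nil => intro a; simp [Comp.forEach, Comp.op]
    | cons j js ih =>
      intro a
      obtain ⟨h1, h2⟩ := ih (a + (t j).length * (t j).length)
      -- Traversing a chain is linear in its length; bounding this by the square lets one quantity,
      -- the sum of squares, control the cost.
      have : (t j).length ≤ (t j).length ^ 2 := Nat.le_self_pow (by norm_num) _
      simp only [Comp.forEach, Comp.bind, Comp.op, count_val_time, List.map_cons,
        List.sum_cons] at *
      refine ⟨by rw [h1]; ring, ?_⟩
      omega
  obtain ⟨h1, h2⟩ := loop (List.range m) 0
  rw [sumSquares]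
  rw [sum_map_range] at h1 h2
  exact ⟨by rw [h1, zero_add], h2⟩

/-- The last clause excludes stray entries: a lookup of an absent key can then only meet some other
key of the chain. -/
theorem place_some {s : Seed p} {m : ℕ} (c : Chain p V) (t : ℕ → Option (ZMod p × List V))
    {b : Slot p V} (h : (place s m c t).val = some b) :
    b.size = m ∧ b.seed = s ∧ (∀ i kv, t i = some kv → b.cells i = some kv) ∧
    (∀ kv ∈ c, b.cells (hash s m kv.1) = some kv) ∧
    ∀ i kv, b.cells i = some kv → t i = some kv ∨ kv ∈ c := by
  induction c generalizing t with
  | nil =>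
    simp only [place, Comp.op, Option.some.injEq] at h
    subst h
    simp
  | cons kv c ih =>
    simp only [place, Comp.bind, Comp.op] at h
    cases ht : t (hash s m kv.1) with
    | some w => simp [ht] at h
    | none =>
      simp only [ht] at h
      obtain ⟨h1, h2, h3, h4, h5⟩ := ih _ h
      refine ⟨h1, h2, fun i kv' hi => h3 i kv' ?_, ?_, fun i kv' hi => ?_⟩
      -- The updated cell was empty, so a cell already filled is a different one.
      · rw [Function.update_of_ne, hi]
        rintro rfl
        simp [ht] at hi
      · intro kv' hkv
        rcases List.mem_cons.1 hkv with rfl | hkv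
        · exact h3 _ _ (by simp)
        · exact h4 _ hkv
      · rcases h5 i kv' hi with h | h
        · by_cases hi' : i = hash s m kv.1
          · subst hi'
            simp only [Function.update_self, Option.some.injEq] at h
            simp [h]
          · rw [Function.update_of_ne hi'] at h; exact Or.inl h
        · simp [h]

theorem place_isSome {s : Seed p} {m : ℕ} (c : Chain p V) (t : ℕ → Option (ZMod p × List V))
    (hc : c.Pairwise fun a b => hash s m a.1 ≠ hash s m b.1)
    (ht : ∀ kv ∈ c, t (hash s m kv.1) = none) : (place s m c t).val.isSome := by
  induction c generalizing t with
  | nil => simp [place, Comp.op]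
  | cons kv c ih =>
    rw [List.pairwise_cons] at hc
    simp only [place, Comp.bind, Comp.op, ht kv (by simp)]
    refine ih _ hc.2 fun kv' h => ?_
    rw [Function.update_of_ne (hc.1 kv' h).symm]
    exact ht kv' (by simp [h])

theorem time_place (s : Seed p) (m : ℕ) (c : Chain p V) (t : ℕ → Option (ZMod p × List V)) :
    (place s m c t).time ≤ 3 * c.length + 1 := by
  induction c generalizing t with
  | nil => simp [place, Comp.op]
  | cons kv c ih =>
    simp only [place, Comp.bind, Comp.op]
    cases ht : t (hash s m kv.1) with
    | some w => simp; omega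
    | none =>
      have := ih (Function.update t (hash s m kv.1) (some kv))
      simp only [List.length_cons]; omega

theorem levelTwo_some {c : Chain p V} {s : Seed p} {b : Slot p V}
    (h : (levelTwo c s).val = some b) :
    (∀ kv ∈ c, b.cells (hash b.seed b.size kv.1) = some kv) ∧
    ∀ i kv, b.cells i = some kv → kv ∈ c := by
  simp only [levelTwo, Comp.bind, Comp.alloc, count_val_time] at h
  obtain ⟨h1, h2, h3, h4, h5⟩ := place_some _ _ h
  rw [h1, h2]
  exact ⟨h4, fun i kv hi => by simpa using h5 i kv hi⟩

theorem time_levelTwo (c : Chain p V) (s : Seed p) :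
    (levelTwo c s).time ≤ 6 * c.length ^ 2 + 3 := by
  have h := time_place s (c.length * c.length) c (fun _ => none)
  have : c.length ≤ c.length ^ 2 := Nat.le_self_pow (by norm_num) _
  simp only [levelTwo, Comp.bind, Comp.alloc, count_val_time]
  rw [← sq] at *
  omega

theorem levelTwo_isSome {c : Chain p V} {s : Seed p}
    (hc : c.Pairwise fun a b => hash s (c.length ^ 2) a.1 ≠ hash s (c.length ^ 2) b.1) :
    (levelTwo c s).val.isSome := by
  simp only [levelTwo, Comp.bind, Comp.alloc, count_val_time]
  rw [← sq]
  exact place_isSome _ _ hc (by simp)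

theorem time_lookup (h : HashTable p V) (k : ZMod p) : (lookup h k).time ≤ 6 := by
  simp only [lookup, Comp.bind, Comp.op]
  cases (h.slots (hash h.seed h.size k)).cells _ with
  | none => simp
  | some kv => simp only; cases decide (kv.1 = k) <;> simp

/-- `h` is a hash table of the values `vs` with respect to `key`. -/
def Represents (h : HashTable p V) (key : V → ZMod p) (vs : List V) : Prop :=
  ∀ k, (lookup h k).val.Perm (vs.filter fun v => key v = k)

theorem lookup_empty_slot {h : HashTable p V} {k : ZMod p}
    (hs : h.slots (hash h.seed h.size k) = Slot.empty) : (lookup h k).val = [] := by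
  simp [lookup, Comp.bind, Comp.op, hs, Slot.empty]

/-- A present key finds its own cell. An absent one may hit the cell of another key, and is rejected
by the final comparison of keys. -/
theorem lookup_slot {h : HashTable p V} {k : ZMod p} {c : Chain p V}
    (hc : (c.map Prod.fst).Nodup)
    (h1 : ∀ kv ∈ c, (h.slots (hash h.seed h.size k)).cells
      (hash (h.slots (hash h.seed h.size k)).seed (h.slots (hash h.seed h.size k)).size kv.1)
        = some kv)
    (h2 : ∀ i kv, (h.slots (hash h.seed h.size k)).cells i = some kv → kv ∈ c) :
    (lookup h k).val = stored k c := by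
  simp only [lookup, Comp.bind, Comp.op]
  by_cases hk : k ∈ c.map Prod.fst
  · obtain ⟨kv, hkv, rfl⟩ := List.mem_map.1 hk
    rw [h1 kv hkv, stored_eq_of_mem hc hkv]
    simp
  · rw [stored_eq_nil hk]
    cases hi : (h.slots (hash h.seed h.size k)).cells
      (hash (h.slots (hash h.seed h.size k)).seed (h.slots (hash h.seed h.size k)).size k) with
    | none => rfl
    | some kv =>
      have hne : kv.1 ≠ k := fun e => hk (e ▸ List.mem_map_of_mem (h2 _ _ hi))
      simp [hne]

end HashValues


/-! ### Randomized computations -/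

/-- The expectation of `g` under `x`. -/
noncomputable def expect {α : Type*} (x : PMF α) (g : α → ℝ≥0∞) : ℝ≥0∞ := ∑' a, x a * g a

section Expect

variable {α β : Type*}

theorem expect_pure (a : α) (g : α → ℝ≥0∞) : expect (PMF.pure a) g = g a := by
  classical
  rw [expect, tsum_eq_single a]
  · simp
  · intro b hb; simp [PMF.pure_apply, hb]

theorem expect_bind (x : PMF α) (f : α → PMF β) (g : β → ℝ≥0∞) :
    expect (x.bind f) g = expect x fun a => expect (f a) g := by
  simp only [expect, PMF.bind_apply, ← ENNReal.tsum_mul_right, ← ENNReal.tsum_mul_left]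
  rw [ENNReal.tsum_comm]
  simp only [mul_assoc]

theorem expect_map (f : α → β) (x : PMF α) (g : β → ℝ≥0∞) :
    expect (x.map f) g = expect x fun a => g (f a) := by
  rw [PMF.map, expect_bind]
  simp [expect_pure]

theorem expect_mono (x : PMF α) {g g' : α → ℝ≥0∞} (h : ∀ a ∈ x.support, g a ≤ g' a) :
    expect x g ≤ expect x g' := by
  refine ENNReal.tsum_le_tsum fun a => ?_
  by_cases ha : x a = 0
  · simp [ha]
  · exact mul_le_mul_right (h a ha) _

theorem expect_add (x : PMF α) (g g' : α → ℝ≥0∞) :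
    expect x (fun a => g a + g' a) = expect x g + expect x g' := by
  simp only [expect, mul_add, ENNReal.tsum_add]

theorem expect_const (x : PMF α) (c : ℝ≥0∞) : expect x (fun _ => c) = c := by
  simp [expect, ENNReal.tsum_mul_right, x.tsum_coe]

theorem expect_add_const (x : PMF α) (g : α → ℝ≥0∞) (c : ℝ≥0∞) :
    expect x (fun a => g a + c) = expect x g + c := by
  rw [expect_add, expect_const]

theorem expect_const_add (x : PMF α) (g : α → ℝ≥0∞) (c : ℝ≥0∞) :
    expect x (fun a => c + g a) = c + expect x g := by
  rw [expect_add, expect_const]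

theorem expect_uniform [Fintype α] [Nonempty α] (g : α → ℝ≥0∞) :
    expect (PMF.uniformOfFintype α) g = (∑ a, g a) / Fintype.card α := by
  rw [expect, tsum_fintype]
  simp [PMF.uniformOfFintype_apply, Finset.sum_mul, div_eq_mul_inv, mul_comm]

end Expect

/-! ### Expected time and failure of sequenced random computations -/

namespace Rand

variable {α : Type u} {β : Type v}

theorem expectedTime_eq (x : Rand α) : x.expectedTime = expect x fun r => (r.time : ℝ≥0∞) := rfl

/-- The indicator of being cut off. -/
def isCut (r : Comp (Option α)) : ℝ≥0∞ := if r.val.isNone then 1 else 0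

theorem failure_eq (x : Rand α) : x.failure = expect x isCut := by
  refine tsum_congr fun r => ?_
  rcases r with ⟨_ | a, t⟩ <;> simp [Set.indicator, isCut]

theorem expect_bind_rand (x : Rand α) (f : α → Rand β) (g : Comp (Option β) → ℝ≥0∞) :
    expect (x.bind f) g = expect x fun r => match r with
      | ⟨none, t⟩ => g ⟨none, t⟩
      | ⟨some a, t⟩ => expect (f a) fun r' => g ⟨r'.val, t + r'.time⟩ := by
  rw [Rand.bind, expect_bind]
  congr 1
  funext r
  rcases r with ⟨_ | a, t⟩
  · exact expect_pure _ _
  · exact expect_map _ _ _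

theorem expectedTime_lift (c : Comp α) : (lift c).expectedTime = c.time := by
  rw [expectedTime_eq, lift, expect_pure]

theorem failure_lift (c : Comp α) : (lift c).failure = 0 := by
  rw [failure_eq, lift, expect_pure]; simp [isCut]

/-- A cut-off skips the continuation, so its cost needs to be bounded only after possible results.
This is how acceptance conditions of an earlier phase enter the cost of a later one. -/
theorem expectedTime_bind_le (x : Rand α) (f : α → Rand β) {C : ℝ≥0∞}
    (h : ∀ a, x.Returns a → (f a).expectedTime ≤ C) :
    (x.bind f).expectedTime ≤ x.expectedTime + C := by
  rw [expectedTime_eq, expect_bind_rand, expectedTime_eq, ← expect_add_const]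
  refine expect_mono _ fun r hr => ?_
  rcases r with ⟨_ | a, t⟩
  · simp
  · simp only [Nat.cast_add, expect_const_add]
    exact add_le_add_right (h a ⟨t, hr⟩) _

theorem failure_bind_le (x : Rand α) (f : α → Rand β) {C : ℝ≥0∞}
    (h : ∀ a, x.Returns a → (f a).failure ≤ C) :
    (x.bind f).failure ≤ x.failure + C := by
  rw [failure_eq, expect_bind_rand, failure_eq, ← expect_add_const]
  refine expect_mono _ fun r hr => ?_
  rcases r with ⟨_ | a, t⟩
  · simp [isCut]
  · refine le_trans ?_ (le_add_of_nonneg_left (zero_le))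
    refine le_trans (le_of_eq ?_) (h a ⟨t, hr⟩)
    rw [failure_eq]
    rfl

theorem returns_lift {c : Comp α} {a : α} : (lift c).Returns a ↔ a = c.val := by
  constructor
  · rintro ⟨t, h⟩
    simp only [lift, PMF.support_pure, Set.mem_singleton_iff, Comp.mk.injEq, Option.some.injEq] at h
    exact h.1
  · rintro rfl
    exact ⟨c.time, by simp [lift]⟩

theorem returns_bind {x : Rand α} {f : α → Rand β} {b : β} (h : (x.bind f).Returns b) :
    ∃ a, x.Returns a ∧ (f a).Returns b := by
  obtain ⟨t, h⟩ := h
  rw [Rand.bind, PMF.mem_support_bind_iff] at h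
  obtain ⟨⟨_ | a, t'⟩, h1, h2⟩ := h
  · simp at h2
  · rw [PMF.mem_support_map_iff] at h2
    obtain ⟨⟨v, t''⟩, h3, h4⟩ := h2
    simp only [Comp.mk.injEq] at h4
    obtain ⟨rfl, -⟩ := h4
    exact ⟨a, ⟨t', h1⟩, ⟨t'', h3⟩⟩

end Rand

/-! ### Repetition until success -/

section Retry

variable {p : ℕ} [Fact p.Prime] {α : Type u}

open ThreeWay.Rand

theorem returns_retry {trial : Seed p → Comp (Option α)} {N : ℕ} {a : α}
    (h : (retry trial N).Returns a) : ∃ s, (trial s).val = some a := by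
  induction N with
  | zero => obtain ⟨t, h⟩ := h; simp [retry] at h
  | succ N ih =>
    obtain ⟨t, h⟩ := h
    rw [retry, PMF.mem_support_bind_iff] at h
    obtain ⟨s, -, h⟩ := h
    rcases hs : trial s with ⟨_ | b, t'⟩
    · rw [hs] at h
      simp only [PMF.mem_support_map_iff] at h
      obtain ⟨⟨v, t''⟩, h3, h4⟩ := h
      simp only [Comp.mk.injEq] at h4
      obtain ⟨rfl, -⟩ := h4
      exact ih ⟨t'', h3⟩
    · rw [hs] at h
      simp only [PMF.support_pure, Set.mem_singleton_iff, Comp.mk.injEq] at h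
      exact ⟨s, by rw [hs, h.1]⟩

theorem expect_retry_succ (trial : Seed p → Comp (Option α)) (N : ℕ)
    (g : Comp (Option α) → ℝ≥0∞) :
    expect (retry trial (N + 1)) g = (∑ s, match trial s with
      | ⟨some a, t⟩ => g ⟨some a, t + 1⟩
      | ⟨none, t⟩ => expect (retry trial N) fun r => g ⟨r.val, t + 1 + r.time⟩)
        / Fintype.card (Seed p) := by
  rw [retry, expect_bind, expect_uniform]
  congr 2
  funext s
  rcases trial s with ⟨_ | a, t⟩
  · exact expect_map _ _ _
  · exact expect_pure _ _

theorem card_seed_pos : 0 < Fintype.card (Seed p) := Fintype.card_pos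

theorem sum_fail_le (trial : Seed p → Comp (Option α))
    (hb : 2 * (Finset.univ.filter fun s => (trial s).val = none).card ≤ Fintype.card (Seed p))
    (c : ℝ≥0∞) :
    2 * (∑ s, if (trial s).val = none then c else 0) ≤ Fintype.card (Seed p) * c := by
  rw [← Finset.sum_filter, Finset.sum_const, nsmul_eq_mul, ← mul_assoc]
  refine mul_le_mul_left ?_ c
  exact_mod_cast hb

/-- If at most half of the seeds are rejected, the expectations satisfy `E (N + 1) ≤ (C + 1) + E N /
2`, the extra step being the draw of the seed; `2 * (C + 1)` is the fixed point. -/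
theorem expectedTime_retry_le (trial : Seed p → Comp (Option α)) {C : ℕ}
    (hb : 2 * (Finset.univ.filter fun s => (trial s).val = none).card ≤ Fintype.card (Seed p))
    (ht : ∑ s, (trial s).time ≤ C * Fintype.card (Seed p)) (N : ℕ) :
    (retry trial N).expectedTime ≤ ((2 * (C + 1) : ℕ) : ℝ≥0∞) := by
  induction N with
  | zero => rw [expectedTime_eq, retry, expect_pure]; simp
  | succ N ih =>
    have hc : (Fintype.card (Seed p) : ℝ≥0∞) ≠ 0 := by
      exact_mod_cast card_seed_pos.ne'
    rw [expectedTime_eq, expect_retry_succ]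
    refine ENNReal.div_le_of_le_mul ?_
    -- Every seed pays for its own round; only rejected seeds also pay for the remaining rounds.
    have h1 : (∑ s, match trial s with
        | ⟨some a, t⟩ => (((⟨some a, t + 1⟩ : Comp (Option α)).time : ℕ) : ℝ≥0∞)
        | ⟨none, t⟩ => expect (retry trial N) fun r =>
            (((⟨r.val, t + 1 + r.time⟩ : Comp (Option α)).time : ℕ) : ℝ≥0∞))
        ≤ (∑ s, (((trial s).time + 1 : ℕ) : ℝ≥0∞)) +
          ∑ s, (if (trial s).val = none then ((2 * (C + 1) : ℕ) : ℝ≥0∞) else 0) := by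
      rw [← Finset.sum_add_distrib]
      refine Finset.sum_le_sum fun s _ => ?_
      rcases trial s with ⟨_ | a, t⟩
      · simp only [Nat.cast_add, expect_const_add, if_true]
        refine add_le_add le_rfl ?_
        simpa [expectedTime_eq] using ih
      · simp
    refine h1.trans ?_
    have h2 : (∑ s, (if (trial s).val = none then ((2 * (C + 1) : ℕ) : ℝ≥0∞) else 0))
        ≤ ((Fintype.card (Seed p) * (C + 1) : ℕ) : ℝ≥0∞) := by
      rw [← Finset.sum_filter, Finset.sum_const, nsmul_eq_mul, ← Nat.cast_mul]
      exact_mod_cast (by nlinarith)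
    have h3 : (∑ s, (((trial s).time + 1 : ℕ) : ℝ≥0∞))
        ≤ ((Fintype.card (Seed p) * (C + 1) : ℕ) : ℝ≥0∞) := by
      rw [← Nat.cast_sum]
      refine Nat.cast_le.2 ?_
      rw [Finset.sum_add_distrib]
      simp only [Finset.sum_const, Finset.card_univ, smul_eq_mul]
      nlinarith
    refine (add_le_add h3 h2).trans (le_of_eq ?_)
    push_cast
    ring

/-- Each further round multiplies the probability of failure by at most 1/2. -/
theorem failure_retry_le (trial : Seed p → Comp (Option α))
    (hb : 2 * (Finset.univ.filter fun s => (trial s).val = none).card ≤ Fintype.card (Seed p))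
    (N : ℕ) : (retry trial N).failure ≤ (2⁻¹ : ℝ≥0∞) ^ N := by
  induction N with
  | zero => rw [failure_eq, retry, expect_pure]; simp [isCut]
  | succ N ih =>
    rw [failure_eq, expect_retry_succ]
    refine ENNReal.div_le_of_le_mul ?_
    have h1 : (∑ s, match trial s with
        | ⟨some a, t⟩ => isCut (⟨some a, t + 1⟩ : Comp (Option α))
        | ⟨none, t⟩ => expect (retry trial N) fun r =>
            isCut (⟨r.val, t + 1 + r.time⟩ : Comp (Option α)))
        ≤ ∑ s, (if (trial s).val = none then (2⁻¹ : ℝ≥0∞) ^ N else 0) := by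
      refine Finset.sum_le_sum fun s _ => ?_
      rcases trial s with ⟨_ | a, t⟩
      · simp only [if_true]
        rw [failure_eq] at ih
        exact ih
      · simp [isCut]
    refine h1.trans ?_
    have h2 := mul_le_mul_right (sum_fail_le trial hb ((2⁻¹ : ℝ≥0∞) ^ N)) (2⁻¹)
    rw [← mul_assoc, ENNReal.inv_mul_cancel (by norm_num) (by norm_num), one_mul] at h2
    refine h2.trans (le_of_eq ?_)
    rw [pow_succ]
    ring

end Retry


/-! ### Universality of the hash family -/

section Universal

variable {p : ℕ} [Fact p.Prime]

/-- The residue class of `u` modulo `m` has `p / m` or `p / m + 1` members below `p`, and `u` itself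
is removed. -/
theorem card_congruent_le {m : ℕ} (hm : 0 < m) (u : ZMod p) :
    m * (Finset.univ.filter fun v : ZMod p => v ≠ u ∧ v.val % m = u.val % m).card ≤ p - 1 := by
  have hp : 0 < p := (Fact.out : p.Prime).pos
  have h1 : (Finset.univ.filter fun v : ZMod p => v.val % m = u.val % m).card
      ≤ p.count (· ≡ u.val [MOD m]) := by
    rw [Nat.count_eq_card_filter_range]
    refine Finset.card_le_card_of_injOn ZMod.val (fun v hv => ?_) (ZMod.val_injective p).injOn
    simp only [Finset.coe_filter, Finset.mem_univ, true_and, Set.mem_ofPred_eq] at hv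
    simp only [Finset.coe_filter, Finset.mem_range, Set.mem_ofPred_eq]
    exact ⟨ZMod.val_lt v, hv⟩
  have h2 : (Finset.univ.filter fun v : ZMod p => v ≠ u ∧ v.val % m = u.val % m)
      = (Finset.univ.filter fun v : ZMod p => v.val % m = u.val % m).erase u := by
    ext v; simp
  rw [h2, Finset.card_erase_of_mem (by simp)]
  rw [Nat.count_modEq_card p hm] at h1
  have h3 := Nat.div_add_mod p m
  have h4 : (Finset.univ.filter fun v : ZMod p => v.val % m = u.val % m).card - 1
      ≤ p / m + (if u.val % m < p % m then 1 else 0) - 1 := Nat.sub_le_sub_right h1 1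
  refine (Nat.mul_le_mul_left m h4).trans ?_
  -- If the class has the extra member, then `p % m > 0` and `m * (p / m) ≤ p - 1`. Otherwise one
  -- member is lost, leaving at most `p - m`; the case `p / m = 0` is separated because of truncated
  -- subtraction.
  split_ifs with h
  · rw [Nat.add_sub_cancel]; omega
  · rcases Nat.eq_zero_or_pos (p / m) with h0 | h0
    · simp [h0]
    · have : m * (p / m + 0 - 1) + m = m * (p / m) := by
        rw [add_zero]
        obtain ⟨k, hk⟩ := Nat.exists_eq_add_of_lt h0
        rw [hk]; simp; ring
      omega

theorem card_seed : Fintype.card (Seed p) = p * (p - 1) := by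
  rw [Fintype.card_prod, ZMod.card_units, ZMod.card, mul_comm]

/-- For `x ≠ y` the map from a seed `(a, b)` to `(a x + b, a y + b)` is injective into pairs of
distinct residues. A collision is such a pair congruent modulo `m`, and each of the `p` first
entries has at most `(p - 1) / m` partners. -/
theorem card_collisions_le {m : ℕ} (hm : 0 < m) {x y : ZMod p} (hxy : x ≠ y) :
    m * (Finset.univ.filter fun s : Seed p => hash s m x = hash s m y).card
      ≤ Fintype.card (Seed p) := by
  have h1 : (Finset.univ.filter fun s : Seed p => hash s m x = hash s m y).card ≤
      ((Finset.univ : Finset (ZMod p)).sigma fun u =>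
        Finset.univ.filter fun v : ZMod p => v ≠ u ∧ v.val % m = u.val % m).card := by
    refine Finset.card_le_card_of_injOn
      (fun s => ⟨(s.1 : ZMod p) * x + s.2, (s.1 : ZMod p) * y + s.2⟩) (fun s hs => ?_) ?_
    · simp only [Finset.coe_filter, Finset.mem_univ, true_and, Set.mem_ofPred_eq] at hs
      simp only [Finset.coe_sigma, Set.mem_sigma_iff, Finset.coe_univ, Set.mem_univ, true_and,
        Finset.coe_filter, Finset.mem_univ, Set.mem_ofPred_eq]
      refine ⟨fun h => hxy ?_, hs.symm⟩
      have := add_right_cancel h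
      exact (mul_left_cancel₀ s.1.ne_zero this).symm
    · rintro ⟨a, b⟩ - ⟨a', b'⟩ - h
      simp only [Sigma.mk.injEq, heq_eq_eq] at h
      obtain ⟨h1, h2⟩ := h
      -- Subtracting the two equations eliminates `b`.
      have h3 : ((a : ZMod p) - a') * (x - y) = 0 := by linear_combination h1 - h2
      have h4 : (a : ZMod p) = a' := by
        rcases mul_eq_zero.1 h3 with h | h
        · exact sub_eq_zero.1 h
        · exact absurd (sub_eq_zero.1 h) hxy
      rw [h4] at h1
      exact Prod.ext (Units.ext h4) (add_left_cancel h1)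
  rw [Finset.card_sigma] at h1
  calc m * _ ≤ m * _ := Nat.mul_le_mul_left m h1
    _ = ∑ u : ZMod p,
        m * (Finset.univ.filter fun v : ZMod p => v ≠ u ∧ v.val % m = u.val % m).card := by
        rw [Finset.mul_sum]
    _ ≤ ∑ _u : ZMod p, (p - 1) := Finset.sum_le_sum fun u _ => card_congruent_le hm u
    _ = _ := by rw [card_seed]; simp [ZMod.card]

/-- The number of keys that collide with a given one, summed over all seeds. -/
theorem sum_card_bucket_le (m : ℕ) (K : Finset (ZMod p)) (hK : K.card ≤ m) (x : ZMod p) :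
    ∑ s : Seed p, (K.filter fun y => hash s m y = hash s m x).card
      ≤ 2 * Fintype.card (Seed p) := by
  rcases Nat.eq_zero_or_pos m with rfl | hm
  · have : K = ∅ := Finset.card_eq_zero.1 (by omega)
    simp [this]
  have h0 : ∑ s : Seed p, (K.filter fun y => hash s m y = hash s m x).card
      = ∑ y ∈ K, (Finset.univ.filter fun s : Seed p => hash s m y = hash s m x).card := by
    simp only [Finset.card_filter]
    exact Finset.sum_comm
  rw [h0]
  -- The key `x` collides with itself for every seed; each other key does so for a fraction at most
  -- `1 / m` of the seeds. As `K` has at most `m` keys, the average is at most 2.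
  have h1 : ∀ y ∈ K, m * (Finset.univ.filter fun s : Seed p => hash s m y = hash s m x).card
      ≤ Fintype.card (Seed p) + if y = x then m * Fintype.card (Seed p) else 0 := by
    intro y _
    split_ifs with h
    · exact (Nat.mul_le_mul_left m (Finset.card_le_univ _)).trans (Nat.le_add_left _ _)
    · simpa using card_collisions_le hm h
  have h2 := Finset.sum_le_sum h1
  rw [← Finset.mul_sum, Finset.sum_add_distrib, Finset.sum_const, smul_eq_mul,
    Finset.sum_ite_eq'] at h2
  refine Nat.le_of_mul_le_mul_left (h2.trans ?_) hm
  have h3 : (if x ∈ K then m * Fintype.card (Seed p) else 0) ≤ m * Fintype.card (Seed p) := by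
    split_ifs <;> simp
  have h4 := Nat.mul_le_mul_right (Fintype.card (Seed p)) hK
  linarith

/-- The pairs of keys that collide, summed over all seeds. -/
theorem sum_sum_sq_bucket_le (m : ℕ) (K : Finset (ZMod p)) (hK : K.card ≤ m) :
    ∑ s : Seed p, ∑ j ∈ Finset.range m, (K.filter fun y => hash s m y = j).card ^ 2
      ≤ 2 * m * Fintype.card (Seed p) := by
  have h : ∀ s : Seed p, ∑ j ∈ Finset.range m, (K.filter fun y => hash s m y = j).card ^ 2
      ≤ ∑ x ∈ K, (K.filter fun y => hash s m y = hash s m x).card := by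
    intro s
    -- A square counts ordered pairs in the bucket: each member contributes the size of its own
    -- bucket.
    have e : ∀ j, (K.filter fun y => hash s m y = j).card ^ 2
        = ∑ x ∈ K.filter (fun y => hash s m y = j),
            (K.filter fun y => hash s m y = hash s m x).card := by
      intro j
      rw [Finset.sum_congr rfl (g := fun _ => (K.filter fun y => hash s m y = j).card)]
      · rw [Finset.sum_const, smul_eq_mul, sq]
      · intro x hx
        rw [(Finset.mem_filter.1 hx).2]
    rw [Finset.sum_congr rfl fun j _ => e j]
    simp only [Finset.sum_filter (s := K)]
    rw [Finset.sum_comm]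
    refine Finset.sum_le_sum fun x _ => ?_
    -- A key lies in at most one bucket, so the sum over `j` leaves at most one term.
    rw [Finset.sum_ite_eq]
    split_ifs <;> simp
  refine (Finset.sum_le_sum fun s _ => h s).trans ?_
  rw [Finset.sum_comm]
  refine (Finset.sum_le_sum fun x _ => sum_card_bucket_le m K hK x).trans ?_
  rw [Finset.sum_const, smul_eq_mul]
  have := Nat.mul_le_mul_right (2 * Fintype.card (Seed p)) hK
  linarith

end Universal

/-! ### The two levels of a perfect hash table -/

section Levels

variable {p : ℕ} [Fact p.Prime] {V : Type u}

omit [Fact p.Prime] in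
theorem card_keys_le (key : V → ZMod p) (vs : List V) : (vs.map key).toFinset.card ≤ vs.length := by
  simpa using List.toFinset_card_le (vs.map key)

omit [Fact p.Prime] in
theorem levelOne_some {key : V → ZMod p} {m : ℕ} {vs : List V} {s : Seed p}
    {st : Seed p × (ℕ → Chain p V)} (h : (levelOne key m vs s).val = some st) :
    Distributed key st.1 m (vs.map key).toFinset vs.reverse st.2 ∧
    ∑ j ∈ Finset.range m, (st.2 j).length ^ 2 ≤ 4 * m := by
  simp only [levelOne, Comp.bind, Comp.op, (sumSquares_spec _ _).1] at h
  split_ifs at h with hs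
  simp only [Option.some.injEq] at h
  subst h
  exact ⟨(distribute_spec key s m vs).1, hs⟩

omit [Fact p.Prime] in
theorem levelOne_none {key : V → ZMod p} {m : ℕ} {vs : List V} {s : Seed p}
    (h : (levelOne key m vs s).val = none) :
    4 * m < ∑ j ∈ Finset.range m, (bucket key s m vs j).card ^ 2 := by
  simp only [levelOne, Comp.bind, Comp.op, (sumSquares_spec _ _).1] at h
  split_ifs at h with hs
  refine (not_le.1 hs).trans_le (Finset.sum_le_sum fun j _ => ?_)
  exact Nat.pow_le_pow_left ((distribute_spec key s m vs).1.length_le j) 2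

/-- Markov's inequality: the mean of the sum of squares is at most `2 * m`, so at most half of the
seeds exceed `4 * m`. -/
theorem levelOne_accepts (key : V → ZMod p) (vs : List V) :
    2 * (Finset.univ.filter fun s : Seed p => (levelOne key vs.length vs s).val = none).card
      ≤ Fintype.card (Seed p) := by
  rcases Nat.eq_zero_or_pos vs.length with h0 | h0
  · have : (Finset.univ.filter fun s : Seed p => (levelOne key vs.length vs s).val = none) = ∅ := by
      refine Finset.filter_eq_empty_iff.2 fun s _ h => ?_
      simpa [h0] using levelOne_none h
    simp [this]
  have h1 := sum_sum_sq_bucket_le vs.length (vs.map key).toFinset (card_keys_le key vs)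
  have h2 : (Finset.univ.filter fun s : Seed p => (levelOne key vs.length vs s).val = none).card
      * (4 * vs.length) ≤ 2 * vs.length * Fintype.card (Seed p) := by
    refine le_trans ?_ h1
    rw [← smul_eq_mul, ← Finset.sum_const, Finset.sum_filter]
    refine Finset.sum_le_sum fun s _ => ?_
    split_ifs with h
    · exact (levelOne_none h).le
    · exact Nat.zero_le _
  refine le_of_mul_le_mul_left (a := 2 * vs.length) ?_ (by omega)
  linarith

omit [Fact p.Prime] in
theorem time_levelOne_le (key : V → ZMod p) (m : ℕ) (vs : List V) (s : Seed p) :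
    (levelOne key m vs s).time ≤ m + 4 +
      (vs.map fun v => 2 * (bucket key s m vs (hash s m (key v))).card + 6).sum +
      6 * ∑ j ∈ Finset.range m, ((bucket key s m vs j).card ^ 2 + 1) := by
  have h1 := (distribute_spec key s m vs).2
  have h2 := (sumSquares_spec (distribute key s m vs).val m).2
  have h3 : ∑ j ∈ Finset.range m, (((distribute key s m vs).val j).length ^ 2 + 1)
      ≤ ∑ j ∈ Finset.range m, ((bucket key s m vs j).card ^ 2 + 1) :=
    Finset.sum_le_sum fun j _ => Nat.succ_le_succ
      (Nat.pow_le_pow_left ((distribute_spec key s m vs).1.length_le j) 2)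
  simp only [levelOne, Comp.bind, Comp.op]
  omega

/-- Averages of the terms of `time_levelOne_le`: with `n` values, each sees a bucket of mean size at
most 2, giving `10 n`; the sum of squares gives `6 * (2 n + n)`; the array gives `n + 4`. -/
theorem sum_time_levelOne_le (key : V → ZMod p) (vs : List V) :
    ∑ s, (levelOne key vs.length vs s).time ≤ (29 * vs.length + 4) * Fintype.card (Seed p) := by
  refine (Finset.sum_le_sum fun s _ => time_levelOne_le key vs.length vs s).trans ?_
  have h1 := sum_sum_sq_bucket_le vs.length (vs.map key).toFinset (card_keys_le key vs)
  have h2 : ∑ s : Seed p, (vs.map fun v =>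
      2 * (bucket key s vs.length vs (hash s vs.length (key v))).card + 6).sum
      ≤ 10 * vs.length * Fintype.card (Seed p) := by
    have e : ∀ s : Seed p, (vs.map fun v =>
        2 * (bucket key s vs.length vs (hash s vs.length (key v))).card + 6).sum
        = ∑ i : Fin vs.length,
          (2 * (bucket key s vs.length vs (hash s vs.length (key (vs.get i)))).card + 6) := by
      intro s
      exact (Fin.sum_univ_fun_getElem vs _).symm
    simp only [e]
    rw [Finset.sum_comm]
    have : ∀ i ∈ (Finset.univ : Finset (Fin vs.length)), ∑ s : Seed p,
        (2 * (bucket key s vs.length vs (hash s vs.length (key (vs.get i)))).card + 6)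
        ≤ 10 * Fintype.card (Seed p) := by
      intro i _
      have := sum_card_bucket_le vs.length (vs.map key).toFinset (card_keys_le key vs)
        (key (vs.get i))
      rw [Finset.sum_add_distrib, ← Finset.mul_sum, Finset.sum_const, Finset.card_univ, smul_eq_mul]
      unfold bucket
      linarith
    refine (Finset.sum_le_sum this).trans ?_
    simp [mul_assoc, mul_left_comm]
  simp only [Finset.sum_add_distrib, ← Finset.mul_sum, Finset.sum_const, Finset.card_univ,
    smul_eq_mul, Finset.card_range] at h2 ⊢
  unfold bucket at *
  nlinarith

/-- A rejected seed has a colliding pair of keys. On average there are at most `k * (k - 1) / k ^ 2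
≤ 1` colliding ordered pairs, and a rejection accounts for two of them. -/
theorem levelTwo_accepts (c : Chain p V) (hc : (c.map Prod.fst).Nodup) :
    2 * (Finset.univ.filter fun s : Seed p => (levelTwo c s).val = none).card
      ≤ Fintype.card (Seed p) := by
  rcases Nat.eq_zero_or_pos c.length with h0 | h0
  · obtain rfl := List.length_eq_zero_iff.1 h0
    have : (Finset.univ.filter fun s : Seed p =>
        (levelTwo ([] : Chain p V) s).val = none) = ∅ := by
      refine Finset.filter_eq_empty_iff.2 fun s _ h => ?_
      have := levelTwo_isSome (s := s) (c := ([] : Chain p V)) (by simp)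
      simp [h] at this
    simp [this]
  set K := (c.map Prod.fst).toFinset with hK
  have hcard : K.card = c.length := by
    rw [hK, List.toFinset_card_of_nodup hc, List.length_map]
  have h1 : ∀ s : Seed p, (if (levelTwo c s).val = none then 2 else 0)
      ≤ (K.offDiag.filter fun xy =>
        hash s (c.length ^ 2) xy.1 = hash s (c.length ^ 2) xy.2).card := by
    intro s
    split_ifs with h
    · have hp : ¬ c.Pairwise fun a b => hash s (c.length ^ 2) a.1 ≠ hash s (c.length ^ 2) b.1 := by
        intro hp
        have := levelTwo_isSome hp
        simp [h] at this
      have hinj : ∃ x ∈ K, ∃ y ∈ K, x ≠ y ∧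
          hash s (c.length ^ 2) x = hash s (c.length ^ 2) y := by
        by_contra! hn
        refine hp ?_
        have hc' := List.pairwise_map.1 hc
        refine hc'.imp_of_mem fun {a b} ha hb hab => ?_
        exact hn _ (List.mem_toFinset.2 (List.mem_map_of_mem ha)) _
          (List.mem_toFinset.2 (List.mem_map_of_mem hb)) hab
      obtain ⟨x, hx, y, hy, hxy, he⟩ := hinj
      -- Counting both orders of the collision supplies the factor 2, hence the probability 1/2.
      have : ({(x, y), (y, x)} : Finset (ZMod p × ZMod p)) ⊆ K.offDiag.filter fun xy =>
          hash s (c.length ^ 2) xy.1 = hash s (c.length ^ 2) xy.2 := by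
        intro z hz
        simp only [Finset.mem_insert, Finset.mem_singleton] at hz
        rcases hz with rfl | rfl
        · simp [hx, hy, hxy, he]
        · simp [hx, hy, hxy.symm, he]
      refine le_trans (le_of_eq ?_) (Finset.card_le_card this)
      rw [Finset.card_pair]
      exact fun e => hxy (Prod.ext_iff.1 e).1
    · exact Nat.zero_le _
  have h2 := Finset.sum_le_sum fun s (_ : s ∈ (Finset.univ : Finset (Seed p))) => h1 s
  rw [← Finset.sum_filter, Finset.sum_const, smul_eq_mul] at h2
  simp only [Finset.card_filter _ K.offDiag] at h2
  rw [Finset.sum_comm] at h2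
  simp only [← Finset.card_filter] at h2
  have h3 : ∀ xy ∈ K.offDiag, c.length ^ 2 * (Finset.univ.filter fun s : Seed p =>
      hash s (c.length ^ 2) xy.1 = hash s (c.length ^ 2) xy.2).card ≤ Fintype.card (Seed p) :=
    fun xy h => card_collisions_le (by positivity) (Finset.mem_offDiag.1 h).2.2
  have h4 := Finset.sum_le_sum h3
  rw [← Finset.mul_sum, Finset.sum_const, smul_eq_mul, Finset.offDiag_card, hcard] at h4
  refine le_of_mul_le_mul_left (a := c.length ^ 2) ?_ (by positivity)
  refine le_trans (Nat.mul_le_mul_left _ ?_) (h4.trans (Nat.mul_le_mul_right _ ?_))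
  · linarith
  · rw [sq]; exact Nat.sub_le _ _

end Levels


/-! ### Construction of the hash tables -/

section Build

variable {p : ℕ} [Fact p.Prime] {V : Type u}

open ThreeWay.Rand

theorem expectedTime_bind_le_nat {α β : Type*} {x : Rand α} {f : α → Rand β} {a b c : ℕ}
    (hx : x.expectedTime ≤ (a : ℝ≥0∞)) (hf : ∀ r, x.Returns r → (f r).expectedTime ≤ (b : ℝ≥0∞))
    (h : a + b ≤ c) : (x.bind f).expectedTime ≤ (c : ℝ≥0∞) := by
  refine (expectedTime_bind_le x f hf).trans ((add_le_add_left hx _).trans ?_)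
  exact_mod_cast h

/-- Each index in the list ends with a slot accepted for its chain; the others keep the initial one,
which matters for a table of size 0. -/
theorem returns_buildSlots {N : ℕ} {t : ℕ → Chain p V} {js : List ℕ} {a a' : ℕ → Slot p V}
    (h : (buildSlots N t js a).Returns a') (j : ℕ) :
    (j ∈ js ∧ ∃ s, (levelTwo (t j) s).val = some (a' j)) ∨ (j ∉ js ∧ a' j = a j) := by
  induction js generalizing a with
  | nil =>
    rw [buildSlots, returns_lift] at h
    subst h
    simp
  | cons i js ih =>
    rw [buildSlots] at h
    obtain ⟨b, hb, h⟩ := returns_bind h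
    obtain ⟨a₁, ha₁, h⟩ := returns_bind h
    rw [returns_lift] at ha₁
    subst ha₁
    rcases ih h with ⟨h1, h2⟩ | ⟨h1, h2⟩
    · exact Or.inl ⟨by simp [h1], h2⟩
    · by_cases hj : j = i
      · subst hj
        refine Or.inl ⟨by simp, ?_⟩
        rw [h2]
        simpa [Comp.op] using returns_retry hb
      · refine Or.inr ⟨by simp [hj, h1], ?_⟩
        rw [h2]
        simp [Comp.op, hj]

/-- One slot costs twice a round of at most `6 k ^ 2 + 3` steps and its draw, that is `12 k ^ 2 +
8`, and one more step for the write. -/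
theorem expectedTime_buildSlots_le (N : ℕ) (t : ℕ → Chain p V)
    (ht : ∀ j, ((t j).map Prod.fst).Nodup) (js : List ℕ) (a : ℕ → Slot p V) :
    (buildSlots N t js a).expectedTime
      ≤ (((js.map fun j => 12 * (t j).length ^ 2 + 9).sum + 1 : ℕ) : ℝ≥0∞) := by
  induction js generalizing a with
  | nil => rw [buildSlots, expectedTime_lift]; simp [Comp.op]
  | cons j js ih =>
    rw [buildSlots]
    refine expectedTime_bind_le_nat (expectedTime_retry_le (levelTwo (t j))
      (C := 6 * (t j).length ^ 2 + 3) (levelTwo_accepts _ (ht j)) ?_ N) (fun b _ =>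
      expectedTime_bind_le_nat (expectedTime_lift _).le (fun a' _ => ih a')
      (c := (js.map fun j => 12 * (t j).length ^ 2 + 9).sum + 2) (by simp only [Comp.op]; omega)) ?_
    · refine (Finset.sum_le_sum fun s _ => time_levelTwo (t j) s).trans ?_
      simp [mul_comm]
    · simp only [List.map_cons, List.sum_cons]
      omega

/-- Union bound over the searches, one for each slot. -/
theorem failure_buildSlots_le (N : ℕ) (t : ℕ → Chain p V)
    (ht : ∀ j, ((t j).map Prod.fst).Nodup) (js : List ℕ) (a : ℕ → Slot p V) :
    (buildSlots N t js a).failure ≤ js.length * (2⁻¹ : ℝ≥0∞) ^ N := by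
  induction js generalizing a with
  | nil => rw [buildSlots, failure_lift]; simp
  | cons j js ih =>
    rw [buildSlots]
    refine (failure_bind_le _ _ (C := js.length * (2⁻¹ : ℝ≥0∞) ^ N) fun b _ =>
      (failure_bind_le _ _ (C := js.length * (2⁻¹ : ℝ≥0∞) ^ N) fun a' _ => ih a').trans
        (by rw [failure_lift, zero_add])).trans ?_
    refine (add_le_add_left (failure_retry_le (levelTwo (t j)) (levelTwo_accepts _ (ht j)) N)
      _).trans (le_of_eq ?_)
    push_cast [List.length_cons]
    ring

variable (key : V → ZMod p) (vs : List V)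

/-- For `n` values: counting takes `2 n + 1` steps, the first level `58 n + 10` on average, the
array `n + 1`, and the slots `12 * 4 n + 9 n + 1` by the accepted bound on the sum of squares. The
auxiliary bounds are the partial sums from the end. -/
theorem expectedTime_buildTable_le (N : ℕ) :
    (buildTable N key vs).expectedTime ≤ ((120 * (vs.length + 1) : ℕ) : ℝ≥0∞) := by
  rw [buildTable]
  refine expectedTime_bind_le_nat (b := 116 * vs.length + 13) (expectedTime_lift _).le
    (fun m hm => ?_) (c := 120 * (vs.length + 1))
    (by simp only [count_val_time]; omega)
  rw [returns_lift, count_val_time] at hm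
  simp only at hm
  subst hm
  refine expectedTime_bind_le_nat (b := 58 * vs.length + 3)
    (expectedTime_retry_le _ (levelOne_accepts key vs) (sum_time_levelOne_le key vs) N)
    (fun st hst => ?_) (by omega)
  obtain ⟨s, hs⟩ := returns_retry hst
  obtain ⟨hd, hsum⟩ := levelOne_some hs
  refine expectedTime_bind_le_nat (b := 57 * vs.length + 2) (expectedTime_lift _).le
    (fun a _ => ?_) (by simp only [Comp.alloc]; omega)
  refine expectedTime_bind_le_nat (b := 1) (expectedTime_buildSlots_le N st.2 hd.nodup _ a)
    (fun a' _ => by rw [expectedTime_lift]; simp [Comp.op]) ?_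
  have : ((List.range vs.length).map fun j => 12 * (st.2 j).length ^ 2 + 9).sum
      = 12 * (∑ j ∈ Finset.range vs.length, (st.2 j).length ^ 2) + 9 * vs.length := by
    rw [sum_map_range]
    simp [Finset.sum_add_distrib, Finset.mul_sum, mul_comm]
  omega

theorem failure_buildTable_le (N : ℕ) :
    (buildTable N key vs).failure ≤ (vs.length + 1) * (2⁻¹ : ℝ≥0∞) ^ N := by
  rw [buildTable]
  refine (failure_bind_le _ _ (C := (vs.length + 1) * (2⁻¹ : ℝ≥0∞) ^ N) fun m hm => ?_).trans
    (by rw [failure_lift, zero_add])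
  rw [returns_lift, count_val_time] at hm
  simp only at hm
  subst hm
  refine (failure_bind_le _ _ (C := vs.length * (2⁻¹ : ℝ≥0∞) ^ N) fun st hst => ?_).trans ?_
  · obtain ⟨s, hs⟩ := returns_retry hst
    obtain ⟨hd, -⟩ := levelOne_some hs
    refine (failure_bind_le _ _ (C := vs.length * (2⁻¹ : ℝ≥0∞) ^ N) fun a _ => ?_).trans
      (by rw [failure_lift, zero_add])
    refine (failure_bind_le _ _ (C := 0) fun a' _ => by rw [failure_lift]).trans ?_
    rw [add_zero]
    simpa using failure_buildSlots_le N st.2 hd.nodup (List.range vs.length) a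
  · refine (add_le_add_left (failure_retry_le _ (levelOne_accepts key vs) N) _).trans
      (le_of_eq (by ring))

variable {key vs}

/-- Every possible outcome is correct, since only accepted seeds are returned: the slot of a key
holds exactly its chain, and the chain holds exactly the values with that key. -/
theorem represents_of_returns {N : ℕ} {h : HashTable p V}
    (hr : (buildTable N key vs).Returns h) : Represents h key vs := by
  rw [buildTable] at hr
  obtain ⟨m, hm, hr⟩ := returns_bind hr
  rw [returns_lift, count_val_time] at hm
  simp only at hm
  subst hm
  obtain ⟨st, hst, hr⟩ := returns_bind hr
  obtain ⟨s, hs⟩ := returns_retry hst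
  obtain ⟨hd, -⟩ := levelOne_some hs
  obtain ⟨a, ha, hr⟩ := returns_bind hr
  obtain ⟨a', ha', hr⟩ := returns_bind hr
  rw [returns_lift] at hr ha
  simp only [Comp.op] at hr
  simp only [Comp.alloc] at ha
  intro k
  have hperm := (hd.stored k).trans ((List.reverse_perm vs).filter fun v => key v = k)
  rcases returns_buildSlots ha' (hash st.1 vs.length k) with ⟨-, s', h2⟩ | ⟨h1, h2⟩
  · obtain ⟨h3, h4⟩ := levelTwo_some h2
    subst hr
    rw [lookup_slot (c := st.2 (hash st.1 vs.length k)) (hd.nodup _) h3 h4]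
    exact hperm
  -- Reduction modulo a positive size stays in range, so this case means size 0. There the remainder
  -- is the residue itself, and the slot read is still the empty default.
  · have hv : vs = [] := by
      by_contra hv
      exact h1 (List.mem_range.2 (Nat.mod_lt _ (List.length_pos_iff.2 hv)))
    rw [lookup_empty_slot]
    · simp [hv]
    · subst hr
      change a' (hash st.1 vs.length k) = _
      rw [h2, ha]

end Build

/-! ### The preprocessing of the three strategies -/

section Preprocess

open ThreeWay.Rand

variable {p : ℕ} [Fact p.Prime] {K A B C D S₁ S₂ S₃ : Type*}
variable (cd : Codes p B C S₁ S₂ S₃)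
variable (T₁ : WFST K A B S₁) (T₂ : WFST K B C S₂) (T₃ : WFST K C D S₃)

/-- Three tables cost `120 * (h + 3)` in total and the final record one step, whence 361. -/
theorem expectedTime_preprocess_le (N : ℕ)
    (strat : Strategy) :
    (preprocess N cd T₁ T₂ T₃ strat).expectedTime
      ≤ ((361 * (hashedTrans T₁ T₂ T₃ strat + 1) : ℕ) : ℝ≥0∞) := by
  have h1 := expectedTime_buildTable_le (fun e => cd.code₁ (e.src, e.out)) T₁.trans N
  have h2 := expectedTime_buildTable_le (fun e => cd.code₂ (e.src, e.inp, e.out)) T₂.trans N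
  have h3 := expectedTime_buildTable_le (fun e => cd.code₃ (e.src, e.inp)) T₃.trans N
  cases strat <;> simp only [preprocess, hashedTrans, WFST.numTrans]
  · exact expectedTime_bind_le_nat h2 (fun r _ => (expectedTime_lift _).le)
      (by simp only; omega)
  · exact expectedTime_bind_le_nat h1 (fun r _ => expectedTime_bind_le_nat h3
      (fun r _ => (expectedTime_lift _).le) le_rfl) (by simp only; omega)
  · exact expectedTime_bind_le_nat h1 (fun r _ => expectedTime_bind_le_nat h2
      (fun r _ => expectedTime_bind_le_nat h3 (fun r _ => (expectedTime_lift _).le) le_rfl) le_rfl)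
      (by simp only; omega)

theorem failure_preprocess_le (N : ℕ) (strat : Strategy) :
    (preprocess N cd T₁ T₂ T₃ strat).failure
      ≤ (T₁.trans.length + 1 + (T₂.trans.length + 1) + (T₃.trans.length + 1))
        * (2⁻¹ : ℝ≥0∞) ^ N := by
  have h1 := failure_buildTable_le (fun e => cd.code₁ (e.src, e.out)) T₁.trans N
  have h2 := failure_buildTable_le (fun e => cd.code₂ (e.src, e.inp, e.out)) T₂.trans N
  have h3 := failure_buildTable_le (fun e => cd.code₃ (e.src, e.inp)) T₃.trans N
  rw [add_mul, add_mul]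
  cases strat <;> simp only [preprocess]
  · refine (failure_bind_le _ _ (C := 0) fun r _ => (failure_lift _).le).trans ?_
    rw [add_zero]
    exact h2.trans ((le_add_left le_rfl).trans le_self_add)
  · refine (failure_bind_le _ _ fun r _ => (failure_bind_le _ _ (C := 0) fun r _ =>
      (failure_lift _).le)).trans ?_
    rw [add_zero]
    exact add_le_add (h1.trans le_self_add) h3
  · refine (failure_bind_le _ _ fun r _ => (failure_bind_le _ _ fun r _ =>
      (failure_bind_le _ _ (C := 0) fun r _ => (failure_lift _).le))).trans ?_
    rw [add_zero, ← add_assoc]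
    exact add_le_add (add_le_add h1 h2) h3

theorem tendsto_failure_preprocess (strat : Strategy) :
    Tendsto (fun N => (preprocess N cd T₁ T₂ T₃ strat).failure) atTop (𝓝 0) := by
  have h : Tendsto (fun N : ℕ => ((T₁.trans.length : ℝ≥0∞) + 1 + (T₂.trans.length + 1)
      + (T₃.trans.length + 1)) * (2⁻¹ : ℝ≥0∞) ^ N) atTop (𝓝 0) := by
    have := ENNReal.Tendsto.const_mul (a := (T₁.trans.length : ℝ≥0∞) + 1 + (T₂.trans.length + 1)
      + (T₃.trans.length + 1))
      (ENNReal.tendsto_pow_atTop_nhds_zero_of_lt_one (r := 2⁻¹) (by norm_num))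
      (Or.inr (by simp))
    simpa using this
  exact tendsto_of_tendsto_of_tendsto_of_le_of_le tendsto_const_nhds h (fun _ => zero_le)
    fun N => failure_preprocess_le cd T₁ T₂ T₃ N strat

/-- The tables that the strategy uses represent the transitions of the transducers. -/
def TablesFor (cd : Codes p B C S₁ S₂ S₃) (T₁ : WFST K A B S₁) (T₂ : WFST K B C S₂)
    (T₃ : WFST K C D S₃) (tab : Tables p K A B C D S₁ S₂ S₃) (strat : Strategy) : Prop :=
  (strat ≠ .lateral → Represents tab.table₁ (fun e => cd.code₁ (e.src, e.out)) T₁.trans ∧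
    Represents tab.table₃ (fun e => cd.code₃ (e.src, e.inp)) T₃.trans) ∧
  (strat ≠ .central → Represents tab.table₂ (fun e => cd.code₂ (e.src, e.inp, e.out)) T₂.trans)

variable {cd T₁ T₂ T₃}

theorem tablesFor_of_returns {N : ℕ} {strat : Strategy} {tab : Tables p K A B C D S₁ S₂ S₃}
    (h : (preprocess N cd T₁ T₂ T₃ strat).Returns tab) : TablesFor cd T₁ T₂ T₃ tab strat := by
  cases strat <;> simp only [preprocess] at h
  · obtain ⟨h₂, r₂, h⟩ := returns_bind h
    obtain rfl := returns_lift.1 h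
    exact ⟨fun h => absurd rfl h, fun _ => represents_of_returns r₂⟩
  · obtain ⟨h₁, r₁, h⟩ := returns_bind h
    obtain ⟨h₃, r₃, h⟩ := returns_bind h
    obtain rfl := returns_lift.1 h
    exact ⟨fun _ => ⟨represents_of_returns r₁, represents_of_returns r₃⟩, fun h => absurd rfl h⟩
  · obtain ⟨h₁, r₁, h⟩ := returns_bind h
    obtain ⟨h₂, r₂, h⟩ := returns_bind h
    obtain ⟨h₃, r₃, h⟩ := returns_bind h
    obtain rfl := returns_lift.1 h
    exact ⟨fun _ => ⟨represents_of_returns r₁, represents_of_returns r₃⟩,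
      fun _ => represents_of_returns r₂⟩

end Preprocess


/-! ### Correctness and running time of 3-way composition -/

/-! ### Rewriting nested loops as multiset sums with conditions -/

section MultisetBind

variable {α β : Type*}

theorem bind_filter (l : List α) (P : α → Bool) (f : α → Multiset β) :
    ((l.filter P : List α) : Multiset α).bind f
      = (l : Multiset α).bind fun a => if P a = true then f a else 0 := by
  induction l with
  | nil => simp
  | cons a l ih =>
    rw [← Multiset.cons_coe, Multiset.cons_bind, ← ih, List.filter_cons]
    split_ifs with h
    · rw [← Multiset.cons_coe, Multiset.cons_bind]
    · rw [zero_add]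

theorem ite_bind (P : Prop) [Decidable P] (s : Multiset α) (f : α → Multiset β) :
    (if P then s.bind f else 0) = s.bind fun a => if P then f a else 0 := by
  split_ifs <;> simp

/-- The two decidability instances are arbitrary, so classical and computed tests can be exchanged
as well. -/
theorem ite_eq_ite_of_iff {P Q : Prop} {_ : Decidable P} {_ : Decidable Q} (h : P ↔ Q) (a b : α) :
    (if P then a else b) = if Q then a else b := by
  by_cases hp : P
  · rw [if_pos hp, if_pos (h.1 hp)]
  · rw [if_neg hp, if_neg (mt h.2 hp)]

theorem coe_flatMap (l : List α) (f : α → List β) :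
    ((l.flatMap f : List β) : Multiset β) = (l : Multiset α).bind fun a => (f a : Multiset β) :=
  (Multiset.coe_bind l f).symm

theorem sum_map_linear (l : List α) (a b : ℕ) (f : α → ℕ) :
    (l.map fun x => a + b * f x).sum = a * l.length + b * (l.map f).sum := by
  induction l with
  | nil => simp
  | cons x l ih => simp only [List.map_cons, List.sum_cons, ih, List.length_cons]; ring

end MultisetBind

section

variable {p : ℕ} {V : Type u}

/-- A lookup becomes a sum over all transitions with an indicator. With `bind_leaving`, which does
the same for `E[q]`, the loops of all strategies take a common shape. -/
theorem Represents.bind_lookup {h : HashTable p V} {key : V → ZMod p} {vs : List V}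
    (hr : Represents h key vs) (k : ZMod p) {β : Type*} (f : V → Multiset β) :
    ((lookup h k).val : Multiset V).bind f
      = (vs : Multiset V).bind fun v => if key v = k then f v else 0 := by
  rw [Multiset.coe_eq_coe.2 (hr k), bind_filter]
  simp

variable {K A B S : Type*} [DecidableEq S]

theorem bind_leaving (T : WFST K A B S) (q : S) {β : Type*} (f : Transition K A B S → Multiset β) :
    (T.leaving q : Multiset (Transition K A B S)).bind f
      = (T.trans : Multiset (Transition K A B S)).bind fun e => if e.src = q then f e else 0 := by
  rw [WFST.leaving, bind_filter]
  simp

/-- The maximum ranges over the listed states; at any other `q` validity leaves no transition. -/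
theorem length_leaving_le {T : WFST K A B S} (hT : T.Valid) (q : S) :
    (T.leaving q).length ≤ T.maxOutDegree := by
  by_cases hq : q ∈ T.states
  · exact Finset.le_sup (f := fun q => (T.leaving q).length) (List.mem_toFinset.2 hq)
  · have : T.leaving q = [] := by
      refine List.filter_eq_nil_iff.2 fun e he h => hq ?_
      simp only [decide_eq_true_eq] at h
      exact h ▸ hT.src_mem e he
    simp [this]

end

/-! ### The matches found by each strategy, and their cost -/

section Correctness

variable {p : ℕ} {K A B C D S₁ S₂ S₃ : Type*} [CommSemiring K]

open Classical in
/-- The transitions of the composed transducer that leave `q`. -/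
noncomputable def tripleMatches (T₁ : WFST K A B S₁) (T₂ : WFST K B C S₂) (T₃ : WFST K C D S₃)
    (q : S₁ × S₂ × S₃) : Multiset (Transition K A D (S₁ × S₂ × S₃)) :=
  (T₁.trans : Multiset (Transition K A B S₁)).bind fun e₁ =>
    (T₂.trans : Multiset (Transition K B C S₂)).bind fun e₂ =>
    (T₃.trans : Multiset (Transition K C D S₃)).bind fun e₃ =>
      if (e₁.src = q.1 ∧ e₂.src = q.2.1 ∧ e₃.src = q.2.2) ∧ e₁.out = e₂.inp ∧ e₂.out = e₃.inp
      then {combine e₁ e₂ e₃} else 0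

variable {T₁ : WFST K A B S₁} {T₂ : WFST K B C S₂} {T₃ : WFST K C D S₃}

theorem mem_tripleMatches {q : S₁ × S₂ × S₃} {e : Transition K A D (S₁ × S₂ × S₃)} :
    e ∈ tripleMatches T₁ T₂ T₃ q ↔ ∃ e₁ ∈ T₁.trans, ∃ e₂ ∈ T₂.trans, ∃ e₃ ∈ T₃.trans,
      (e₁.src, e₂.src, e₃.src) = q ∧ e₁.out = e₂.inp ∧ e₂.out = e₃.inp ∧
      e = combine e₁ e₂ e₃ := by
  classical
  simp only [tripleMatches, Multiset.mem_bind, Multiset.mem_coe]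
  refine exists_congr fun e₁ => and_congr_right fun _ => exists_congr fun e₂ =>
    and_congr_right fun _ => exists_congr fun e₃ => and_congr_right fun _ => ?_
  obtain ⟨q₁, q₂, q₃⟩ := q
  split_ifs with h
  · obtain ⟨⟨rfl, rfl, rfl⟩, h1, h2⟩ := h
    simp [h1, h2]
  · simp only [Multiset.notMem_zero, Prod.mk.injEq, false_iff]
    exact fun h' => h ⟨h'.1, h'.2.1, h'.2.2.1⟩

variable [DecidableEq S₁] [DecidableEq S₂] [DecidableEq S₃]

theorem coe_matchesAt [DecidableEq B] [DecidableEq C] (q : S₁ × S₂ × S₃) :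
    (matchesAt T₁ T₂ T₃ q : Multiset _) = tripleMatches T₁ T₂ T₃ q := by
  classical
  simp only [matchesAt, coe_flatMap, bind_leaving, tripleMatches, ite_bind]
  refine Multiset.bind_congr fun e₁ _ => Multiset.bind_congr fun e₂ _ => ?_
  rw [← Multiset.map_coe, ← Multiset.bind_singleton, bind_filter, bind_leaving]
  simp only [ite_bind]
  refine Multiset.bind_congr fun e₃ _ => ?_
  simp only [← ite_and, decide_eq_true_eq]
  refine ite_eq_ite_of_iff ?_ _ _
  tauto

variable (cd : Codes p B C S₁ S₂ S₃) (tab : Tables p K A B C D S₁ S₂ S₃)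

/-- The transitions that the lateral strategy generates at `q`. -/
def lateralList (T₁ : WFST K A B S₁) (T₃ : WFST K C D S₃) (q : S₁ × S₂ × S₃) :
    List (Transition K A D (S₁ × S₂ × S₃)) :=
  (T₁.leaving q.1).flatMap fun e₁ => (T₃.leaving q.2.2).flatMap fun e₃ =>
    (lookup tab.table₂ (cd.code₂ (q.2.1, e₁.out, e₃.inp))).val.flatMap fun e₂ =>
      [combine e₁ e₂ e₃]

/-- The transitions that the central strategy generates at `q`. -/
def centralList (T₂ : WFST K B C S₂) (q : S₁ × S₂ × S₃) :
    List (Transition K A D (S₁ × S₂ × S₃)) :=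
  (T₂.leaving q.2.1).flatMap fun e₂ =>
    (lookup tab.table₁ (cd.code₁ (q.1, e₂.inp))).val.flatMap fun e₁ =>
      (lookup tab.table₃ (cd.code₃ (q.2.2, e₂.out))).val.flatMap fun e₃ => [combine e₁ e₂ e₃]

def expandList (T₁ : WFST K A B S₁) (T₂ : WFST K B C S₂) (T₃ : WFST K C D S₃)
    (strat : Strategy) (q : S₁ × S₂ × S₃) : List (Transition K A D (S₁ × S₂ × S₃)) :=
  match strat with
  | .lateral => lateralList cd tab T₁ T₃ q
  | .central => centralList cd tab T₂ q
  | .combined => if (T₁.leaving q.1).length * (T₃.leaving q.2.2).length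
      ≤ (T₂.leaving q.2.1).length then lateralList cd tab T₁ T₃ q else centralList cd tab T₂ q

/-- The number of matches looked up at `q`. -/
def lookups (T₁ : WFST K A B S₁) (T₂ : WFST K B C S₂) (T₃ : WFST K C D S₃)
    (strat : Strategy) (q : S₁ × S₂ × S₃) : ℕ :=
  match strat with
  | .lateral => (T₁.leaving q.1).length * (T₃.leaving q.2.2).length
  | .central => (T₂.leaving q.2.1).length
  | .combined => min ((T₁.leaving q.1).length * (T₃.leaving q.2.2).length)
      (T₂.leaving q.2.1).length

omit [CommSemiring K] in
theorem lookups_le (h₁ : T₁.Valid) (h₂ : T₂.Valid) (h₃ : T₃.Valid) (strat : Strategy)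
    (q : S₁ × S₂ × S₃) : lookups T₁ T₂ T₃ strat q ≤ branching T₁ T₂ T₃ strat := by
  have h13 := Nat.mul_le_mul (length_leaving_le h₁ q.1) (length_leaving_le h₃ q.2.2)
  have h2 := length_leaving_le h₂ q.2.1
  cases strat
  · exact h13
  · exact h2
  · exact min_le_min h13 h2

variable {cd tab}

/-- Injectivity of the code turns equality of keys into the matching condition together with `e₂.src
= q.2.1`. The sums over `e₂` and `e₃` are then exchanged. -/
theorem coe_lateralList
    (hr : Represents tab.table₂ (fun e => cd.code₂ (e.src, e.inp, e.out)) T₂.trans)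
    (q : S₁ × S₂ × S₃) :
    (lateralList cd tab T₁ T₃ q : Multiset _) = tripleMatches T₁ T₂ T₃ q := by
  classical
  simp only [lateralList, coe_flatMap, bind_leaving, hr.bind_lookup, ite_bind, tripleMatches]
  refine Multiset.bind_congr fun e₁ _ => ?_
  rw [Multiset.bind_bind]
  refine Multiset.bind_congr fun e₂ _ => Multiset.bind_congr fun e₃ _ => ?_
  simp only [← ite_and, EmbeddingLike.apply_eq_iff_eq, Prod.mk.injEq, Multiset.coe_singleton]
  refine ite_eq_ite_of_iff ?_ _ _
  grind

theorem coe_centralList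
    (hr₁ : Represents tab.table₁ (fun e => cd.code₁ (e.src, e.out)) T₁.trans)
    (hr₃ : Represents tab.table₃ (fun e => cd.code₃ (e.src, e.inp)) T₃.trans)
    (q : S₁ × S₂ × S₃) :
    (centralList cd tab T₂ q : Multiset _) = tripleMatches T₁ T₂ T₃ q := by
  classical
  simp only [centralList, coe_flatMap, bind_leaving, hr₁.bind_lookup, hr₃.bind_lookup, ite_bind,
    tripleMatches]
  rw [Multiset.bind_bind]
  refine Multiset.bind_congr fun e₁ _ => Multiset.bind_congr fun e₂ _ =>
    Multiset.bind_congr fun e₃ _ => ?_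
  simp only [← ite_and, EmbeddingLike.apply_eq_iff_eq, Prod.mk.injEq, Multiset.coe_singleton]
  refine ite_eq_ite_of_iff ?_ _ _
  grind

theorem coe_expandList {strat : Strategy} (h : TablesFor cd T₁ T₂ T₃ tab strat)
    (q : S₁ × S₂ × S₃) :
    (expandList cd tab T₁ T₂ T₃ strat q : Multiset _) = tripleMatches T₁ T₂ T₃ q := by
  cases strat
  · exact coe_lateralList (h.2 (by simp)) q
  · exact coe_centralList (h.1 (by simp)).1 (h.1 (by simp)).2 q
  · simp only [expandList]
    split_ifs
    · exact coe_lateralList (h.2 (by simp)) q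
    · exact coe_centralList (h.1 (by simp)).1 (h.1 (by simp)).2 q

theorem emits_emitTriple (disc : Discipline) (e₁ : Transition K A B S₁)
    (e₂ : Transition K B C S₂) (e₃ : Transition K C D S₃) :
    Emits (fun c => emitTriple disc c e₁ e₂ e₃) (emitVal disc) [combine e₁ e₂ e₃] 0 6 :=
  ((emits_emit disc (combine e₁ e₂ e₃)).bind_left (Comp.op (e₁.weight * e₂.weight * e₃.weight))
    |>.bind_left (Comp.op (e₁.weight * e₂.weight))).mono (Nat.zero_le _) (by simp [Comp.op])

/-- Per pair: at most 6 steps for the lookup, 1 to end the inner loop and 3 from `forPairs`. Per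
match: 6 steps to emit and 1 loop test. -/
theorem emits_lateral (disc : Discipline) (q : S₁ × S₂ × S₃) :
    Emits (fun c => lateral cd tab T₁ T₃ disc c q) (emitVal disc) (lateralList cd tab T₁ T₃ q) 0
      (2 + 10 * ((T₁.leaving q.1).length * (T₃.leaving q.2.2).length)
        + 7 * (lateralList cd tab T₁ T₃ q).length) := by
  have h : ∀ e₁ ∈ T₁.leaving q.1, ∀ e₃ ∈ T₃.leaving q.2.2,
      Emits (fun c => (lookup tab.table₂ (cd.code₂ (q.2.1, e₁.out, e₃.inp))).bind fun G =>
        Comp.forEach G c fun c e₂ => emitTriple disc c e₁ e₂ e₃) (emitVal disc)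
        ((lookup tab.table₂ (cd.code₂ (q.2.1, e₁.out, e₃.inp))).val.flatMap fun e₂ =>
          [combine e₁ e₂ e₃]) 0
        (7 + 7 * (lookup tab.table₂ (cd.code₂ (q.2.1, e₁.out, e₃.inp))).val.length) := by
    intro e₁ _ e₃ _
    refine (Emits.bind_left (lookup tab.table₂ (cd.code₂ (q.2.1, e₁.out, e₃.inp)))
      (f := fun G c => Comp.forEach G c fun c e₂ => emitTriple disc c e₁ e₂ e₃)
      (Emits.forEach fun e₂ _ => emits_emitTriple disc e₁ e₂ e₃)).mono (Nat.zero_le _) ?_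
    have := time_lookup tab.table₂ (cd.code₂ (q.2.1, e₁.out, e₃.inp))
    simp only [List.map_const', List.sum_replicate, smul_eq_mul]
    omega
  refine (Emits.forPairs h).mono (Nat.zero_le _) (le_of_eq ?_)
  simp only [lateralList, List.length_flatMap, List.length_singleton, List.map_const',
    List.sum_replicate, smul_eq_mul, mul_one, add_right_comm 7 _ 3, sum_map_linear]
  ring

/-- Per scanned transition: two lookups, 2 steps of `forPairs` and the loop test, hence 15. The
pairs of found transitions are exactly the matches, at 6 + 3 steps each. -/
theorem emits_central (disc : Discipline) (q : S₁ × S₂ × S₃) :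
    Emits (fun c => central cd tab T₂ disc c q) (emitVal disc) (centralList cd tab T₂ q) 0
      (2 + 15 * (T₂.leaving q.2.1).length + 9 * (centralList cd tab T₂ q).length) := by
  have h : ∀ e₂ ∈ T₂.leaving q.2.1,
      Emits (fun c => (lookup tab.table₁ (cd.code₁ (q.1, e₂.inp))).bind fun G₁ =>
        (lookup tab.table₃ (cd.code₃ (q.2.2, e₂.out))).bind fun G₃ =>
        Comp.forPairs G₁ G₃ c fun c e₁ e₃ => emitTriple disc c e₁ e₂ e₃) (emitVal disc)
        ((lookup tab.table₁ (cd.code₁ (q.1, e₂.inp))).val.flatMap fun e₁ =>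
          (lookup tab.table₃ (cd.code₃ (q.2.2, e₂.out))).val.flatMap fun e₃ =>
            [combine e₁ e₂ e₃]) 0
        (14 + 9 * ((lookup tab.table₁ (cd.code₁ (q.1, e₂.inp))).val.flatMap fun e₁ =>
          (lookup tab.table₃ (cd.code₃ (q.2.2, e₂.out))).val.flatMap fun e₃ =>
            [combine e₁ e₂ e₃]).length) := by
    intro e₂ _
    refine (Emits.bind_left (lookup tab.table₁ (cd.code₁ (q.1, e₂.inp)))
      (f := fun G₁ c => (lookup tab.table₃ (cd.code₃ (q.2.2, e₂.out))).bind fun G₃ =>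
        Comp.forPairs G₁ G₃ c fun c e₁ e₃ => emitTriple disc c e₁ e₂ e₃)
      (Emits.bind_left (lookup tab.table₃ (cd.code₃ (q.2.2, e₂.out)))
        (f := fun G₃ c => Comp.forPairs (lookup tab.table₁ (cd.code₁ (q.1, e₂.inp))).val G₃ c
          fun c e₁ e₃ => emitTriple disc c e₁ e₂ e₃)
        (Emits.forPairs fun e₁ _ e₃ _ => emits_emitTriple disc e₁ e₂ e₃))).mono
      (Nat.zero_le _) ?_
    have h1 := time_lookup tab.table₁ (cd.code₁ (q.1, e₂.inp))
    have h2 := time_lookup tab.table₃ (cd.code₃ (q.2.2, e₂.out))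
    simp only [List.length_flatMap, List.length_singleton, List.map_const',
      List.sum_replicate, smul_eq_mul, mul_one]
    nlinarith
  refine (Emits.forEach h).mono (Nat.zero_le _) ?_
  simp only [centralList, List.length_flatMap (l := T₂.leaving q.2.1), add_right_comm 14 _ 1,
    sum_map_linear]
  omega

theorem emits_expand (strat : Strategy) (disc : Discipline) (q : S₁ × S₂ × S₃) :
    Emits (fun c => expand cd tab T₁ T₂ T₃ disc c q strat) (emitVal disc)
      (expandList cd tab T₁ T₂ T₃ strat q) 0
      (4 + 15 * lookups T₁ T₂ T₃ strat q + 9 * (expandList cd tab T₁ T₂ T₃ strat q).length) := by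
  cases strat
  · exact (emits_lateral disc q).mono le_rfl (by simp only [lookups, expandList]; omega)
  · exact (emits_central disc q).mono le_rfl (by simp only [lookups, expandList]; omega)
  · intro c
    by_cases h : (T₁.leaving q.1).length * (T₃.leaving q.2.2).length ≤ (T₂.leaving q.2.1).length
    · obtain ⟨h1, -, h2⟩ := emits_lateral (cd := cd) (tab := tab) (T₁ := T₁) (T₃ := T₃) disc q c
      simp only [expand, Comp.bind, Comp.op, h, decide_true, if_true, expandList, lookups,
        min_eq_left h]
      beta_reduce at h2
      exact ⟨h1, Nat.zero_le _, by omega⟩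
    · obtain ⟨h1, -, h2⟩ := emits_central (cd := cd) (tab := tab) (T₂ := T₂) disc q c
      simp only [expand, Comp.bind, Comp.op, h, decide_false, if_false, expandList, lookups,
        min_eq_right (not_le.1 h).le, Bool.false_eq_true]
      beta_reduce at h2
      exact ⟨h1, Nat.zero_le _, by omega⟩

/-! #### The search -/

def isInitTriple (T₁ : WFST K A B S₁) (T₂ : WFST K B C S₂) (T₃ : WFST K C D S₃)
    (q : S₁ × S₂ × S₃) : Bool := q.1 ∈ T₁.init ∧ q.2.1 ∈ T₂.init ∧ q.2.2 ∈ T₃.init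

def isFinalTriple (T₁ : WFST K A B S₁) (T₂ : WFST K B C S₂) (T₃ : WFST K C D S₃)
    (q : S₁ × S₂ × S₃) : Bool := q.1 ∈ T₁.final ∧ q.2.1 ∈ T₂.final ∧ q.2.2 ∈ T₃.final

theorem visit_spec (strat : Strategy) (disc : Discipline) (c : Config K A D (S₁ × S₂ × S₃))
    (q : S₁ × S₂ × S₃) :
    (visit strat cd tab T₁ T₂ T₃ disc c q).val =
      (expandList cd tab T₁ T₂ T₃ strat q).foldl (emitVal disc)
        (markVal (isInitTriple T₁ T₂ T₃) (isFinalTriple T₁ T₂ T₃)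
          (fun q => T₁.initWeight q.1 * T₂.initWeight q.2.1 * T₃.initWeight q.2.2)
          (fun q => T₁.finalWeight q.1 * T₂.finalWeight q.2.1 * T₃.finalWeight q.2.2) c q) ∧
    (visit strat cd tab T₁ T₂ T₃ disc c q).time ≤
      12 + 15 * lookups T₁ T₂ T₃ strat q + 9 * (expandList cd tab T₁ T₂ T₃ strat q).length := by
  have h := emits_expand (cd := cd) (tab := tab) (T₁ := T₁) (T₂ := T₂) (T₃ := T₃) strat disc q
    (markVal (isInitTriple T₁ T₂ T₃) (isFinalTriple T₁ T₂ T₃)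
      (fun q => T₁.initWeight q.1 * T₂.initWeight q.2.1 * T₃.initWeight q.2.2)
      (fun q => T₁.finalWeight q.1 * T₂.finalWeight q.2.1 * T₃.finalWeight q.2.2) c q)
  obtain ⟨h1, -, h2⟩ := h
  cases hi : decide (q.1 ∈ T₁.init ∧ q.2.1 ∈ T₂.init ∧ q.2.2 ∈ T₃.init) <;>
  cases hf : decide (q.1 ∈ T₁.final ∧ q.2.1 ∈ T₂.final ∧ q.2.2 ∈ T₃.final) <;>
  simp only [visit, Comp.bind, Comp.op, markVal, isInitTriple, isFinalTriple, markInit, markFinal,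
    hi, hf, if_true, if_false, Bool.false_eq_true] at h1 h2 ⊢ <;>
  exact ⟨h1, by omega⟩

omit [CommSemiring K] in
theorem emits_discover_triples (disc : Discipline) (I₁ : List S₁) (I₂ : List S₂)
    (I₃ : List S₃) :
    Emits (fun c : Config K A D (S₁ × S₂ × S₃) => Comp.forTriples I₁ I₂ I₃ c
      fun c q₁ q₂ q₃ => discover disc c (q₁, q₂, q₃)) (discoverVal disc)
      (I₁.flatMap fun q₁ => I₂.flatMap fun q₂ => I₃.flatMap fun q₃ => [(q₁, q₂, q₃)]) 0
      (8 * (I₁.length * (I₂.length * I₃.length)) + 2) := by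
  refine (Emits.forTriples fun q₁ _ q₂ _ q₃ _ =>
    (emits_discover disc (q₁, q₂, q₃)).mono (Nat.zero_le _) le_rfl).mono (Nat.zero_le _) ?_
  refine le_of_eq ?_
  ring

/-- Accessibility, defined from the transducers alone, is reachability along any lists that
enumerate the matches, whatever the strategy and the tables. -/
theorem accessible_iff_reach {L : S₁ × S₂ × S₃ → List (Transition K A D (S₁ × S₂ × S₃))}
    (hL : ∀ q, (L q : Multiset _) = tripleMatches T₁ T₂ T₃ q) (q : S₁ × S₂ × S₃) :
    Accessible T₁ T₂ T₃ q ↔ Reach (isInitTriple T₁ T₂ T₃) L q := by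
  constructor
  · intro h
    induction h with
    | start h1 h2 h3 => exact .start (by simp [isInitTriple, h1, h2, h3])
    | @step e₁ e₂ e₃ h1 h2 h3 h4 h5 _ ih =>
      refine .step (e := combine e₁ e₂ e₃) ih ?_
      rw [← Multiset.mem_coe, hL]
      exact mem_tripleMatches.2 ⟨e₁, h1, e₂, h2, e₃, h3, rfl, h4, h5, rfl⟩
  · intro h
    induction h with
    | start h =>
      simp only [isInitTriple, decide_eq_true_eq] at h
      exact .start h.1 h.2.1 h.2.2
    | step _ he ih =>
      rw [← Multiset.mem_coe, hL] at he
      obtain ⟨e₁, h1, e₂, h2, e₃, h3, rfl, h4, h5, rfl⟩ := mem_tripleMatches.1 he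
      exact .step h1 h2 h3 h4 h5 ih

omit [CommSemiring K] in
theorem Accessible.mem_states (h₁ : T₁.Valid) (h₂ : T₂.Valid) (h₃ : T₃.Valid)
    {q : S₁ × S₂ × S₃} (h : Accessible T₁ T₂ T₃ q) :
    q ∈ T₁.states.toFinset ×ˢ T₂.states.toFinset ×ˢ T₃.states.toFinset := by
  induction h with
  | start a b c => simp [h₁.init_subset a, h₂.init_subset b, h₃.init_subset c]
  | step a b c => simp [h₁.dst_mem _ a, h₂.dst_mem _ b, h₃.dst_mem _ c]

/-- The constant 21 covers, per state, 12 steps of visiting, 1 of dequeuing and 8 charged from the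
initial loop; it also dominates the coefficients 15 and 9. -/
theorem threeWay_ends (h₁ : T₁.Valid) (h₂ : T₂.Valid) (h₃ : T₃.Valid) {strat : Strategy}
    (htab : TablesFor cd T₁ T₂ T₃ tab strat) (disc : Discipline) :
    ∃ T t, ThreeWayEnds strat cd tab T₁ T₂ T₃ disc T t ∧
      Explored (isInitTriple T₁ T₂ T₃) (isFinalTriple T₁ T₂ T₃)
        (fun q => T₁.initWeight q.1 * T₂.initWeight q.2.1 * T₃.initWeight q.2.2)
        (fun q => T₁.finalWeight q.1 * T₂.finalWeight q.2.1 * T₃.finalWeight q.2.2)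
        (expandList cd tab T₁ T₂ T₃ strat) T ∧
      t ≤ 21 * (1 + (T.states.map fun q => 1 + lookups T₁ T₂ T₃ strat q
        + (expandList cd tab T₁ T₂ T₃ strat q).length).sum) := by
  set starts := T₁.init.flatMap fun q₁ => T₂.init.flatMap fun q₂ => T₃.init.flatMap fun q₃ =>
    [(q₁, q₂, q₃)] with hstarts
  have hs : ∀ q, q ∈ starts ↔ isInitTriple T₁ T₂ T₃ q = true := by
    rintro ⟨q₁, q₂, q₃⟩
    simp [hstarts, isInitTriple]
  obtain ⟨N, T, t, R, hN, hT, hR, -, ht⟩ := worklist_ends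
    (visit := visit strat cd tab T₁ T₂ T₃ disc) (disc := disc) (lo := fun _ => 0)
    (L := expandList cd tab T₁ T₂ T₃ strat)
    (fun c q => (visit_spec strat disc c q).1) (fun _ _ => Nat.zero_le _)
    (fun c q => (visit_spec strat disc c q).2)
    (T₁.states.toFinset ×ˢ T₂.states.toFinset ×ˢ T₃.states.toFinset)
    (fun q hq => ((accessible_iff_reach (coe_expandList htab) q).2 hq).mem_states h₁ h₂ h₃)
    _ _ [] (SearchInv.initial disc starts hs) (Nat.le_add_right _ _)
  obtain ⟨e1, -, e2⟩ := emits_discover_triples (A := A) (D := D) disc T₁.init T₂.init T₃.init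
    (Config.start (K := K))
  refine ⟨T, (Comp.forTriples T₁.init T₂.init T₃.init (Config.start (K := K) (A := A) (D := D))
      fun c q₁ q₂ q₃ => discover disc c (q₁, q₂, q₃)).time + t, ⟨N, ?_⟩, hT, ?_⟩
  · simp only [threeWay, Comp.bind]
    rw [e1, hN]
  -- Every initial triple is a state of the result, so scanning all of them is within the bound.
  have hinit : T₁.init.length * (T₂.init.length * T₃.init.length) ≤ T.states.length := by
    rw [← List.toFinset_card_of_nodup hT.nodup, ← List.toFinset_card_of_nodup h₁.init_nodup,
      ← List.toFinset_card_of_nodup h₂.init_nodup, ← List.toFinset_card_of_nodup h₃.init_nodup,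
      ← Finset.card_product, ← Finset.card_product]
    refine Finset.card_le_card fun q hq => ?_
    simp only [Finset.mem_product, List.mem_toFinset] at hq ⊢
    exact (hT.mem_states q).2 (.start (by simp [isInitTriple, hq]))
  have hsum : (R.map fun q => 12 + 15 * lookups T₁ T₂ T₃ strat q
      + 9 * (expandList cd tab T₁ T₂ T₃ strat q).length + 1).sum + 8 * T.states.length
      ≤ 21 * (T.states.map fun q => 1 + lookups T₁ T₂ T₃ strat q
        + (expandList cd tab T₁ T₂ T₃ strat q).length).sum := by
    rw [List.nil_append] at hR
    rw [hR.length_eq, (hR.map _).sum_eq]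
    clear * -
    induction R with
    | nil => simp
    | cons q R ih => simp only [List.map_cons, List.sum_cons, List.length_cons] at *; omega
  beta_reduce at e2
  omega

theorem isTripleProduct_of_explored [DecidableEq B] [DecidableEq C]
    {L : S₁ × S₂ × S₃ → List (Transition K A D (S₁ × S₂ × S₃))}
    (hL : ∀ q, (L q : Multiset _) = tripleMatches T₁ T₂ T₃ q)
    {T : WFST K A D (S₁ × S₂ × S₃)}
    (hT : Explored (isInitTriple T₁ T₂ T₃) (isFinalTriple T₁ T₂ T₃)
        (fun q => T₁.initWeight q.1 * T₂.initWeight q.2.1 * T₃.initWeight q.2.2)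
        (fun q => T₁.finalWeight q.1 * T₂.finalWeight q.2.1 * T₃.finalWeight q.2.2) L T) :
    IsTripleProduct T₁ T₂ T₃ T := by
  have hperm : ∀ q, (L q).Perm (matchesAt T₁ T₂ T₃ q) := fun q => by
    rw [← Multiset.coe_eq_coe, hL, coe_matchesAt]
  have htrans : ∀ e ∈ T.trans, ∃ q ∈ T.states, e ∈ L q := fun e he => by
    simpa using hT.trans_perm.mem_iff.1 he
  have hinit : ∀ q, q ∈ T.init ↔ q ∈ T.states ∧ isInitTriple T₁ T₂ T₃ q = true := fun q => by
    rw [hT.init_perm.mem_iff, List.mem_filter]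
  have hfinal : ∀ q, q ∈ T.final ↔ q ∈ T.states ∧ isFinalTriple T₁ T₂ T₃ q = true := fun q => by
    rw [hT.final_perm.mem_iff, List.mem_filter]
  refine ⟨⟨hT.nodup, hT.init_perm.nodup_iff.2 (hT.nodup.filter _),
    hT.final_perm.nodup_iff.2 (hT.nodup.filter _), fun q hq => ((hinit q).1 hq).1,
    fun q hq => ((hfinal q).1 hq).1, fun e he => ?_, fun e he => ?_⟩, fun q => ?_, fun q => ?_,
    fun q => ?_, hT.initWeight_eq, hT.finalWeight_eq, ?_⟩
  · obtain ⟨q, hq, heq⟩ := htrans e he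
    rw [← Multiset.mem_coe, hL] at heq
    obtain ⟨e₁, h1, e₂, h2, e₃, h3, rfl, h4, h5, rfl⟩ := mem_tripleMatches.1 heq
    exact hq
  · obtain ⟨q, hq, heq⟩ := htrans e he
    exact (hT.mem_states _).2 (.step ((hT.mem_states q).1 hq) heq)
  · rw [hT.mem_states, accessible_iff_reach hL]
  · rw [hinit]
    constructor
    · rintro ⟨-, h⟩; simpa [isInitTriple] using h
    · intro h
      have h' : isInitTriple T₁ T₂ T₃ q = true := by simpa [isInitTriple] using h
      exact ⟨(hT.mem_states q).2 (.start h'), h'⟩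
  · rw [hfinal]; simp [isFinalTriple]
  · exact hT.trans_perm.trans (List.Perm.flatMap_left _ fun q _ => hperm q)

theorem ThreeWayEnds.unique {strat : Strategy} {disc : Discipline}
    {T T' : WFST K A D (S₁ × S₂ × S₃)} {t t' : ℕ}
    (h : ThreeWayEnds strat cd tab T₁ T₂ T₃ disc T t)
    (h' : ThreeWayEnds strat cd tab T₁ T₂ T₃ disc T' t') : T = T' ∧ t = t' := by
  obtain ⟨N, h⟩ := h
  obtain ⟨N', h'⟩ := h'
  simp only [threeWay, Comp.bind, Comp.mk.injEq] at h h'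
  have := worklist_unique (N := N) (N' := N') (T := T) (T' := T') (by rw [← h.1]) (by rw [← h'.1])
  exact ⟨this.1, by omega⟩

end Correctness


/-! ### Standard composition -/

section StandardComposition

variable {p : ℕ} {K A B C S S' : Type*} [CommSemiring K]

/-- The transition made of two matching transitions. -/
def combinePair (e₁ : Transition K A B S) (e₂ : Transition K B C S') :
    Transition K A C (S × S') :=
  ⟨(e₁.src, e₂.src), e₁.inp, e₂.out, e₁.weight * e₂.weight, (e₁.dst, e₂.dst)⟩

open Classical in
/-- The transitions of the composition of two transducers that leave `q`. -/
noncomputable def pairMatches (U : WFST K A B S) (V : WFST K B C S') (q : S × S') :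
    Multiset (Transition K A C (S × S')) :=
  (U.trans : Multiset (Transition K A B S)).bind fun e₁ =>
    (V.trans : Multiset (Transition K B C S')).bind fun e₂ =>
      if (e₁.src = q.1 ∧ e₂.src = q.2) ∧ e₁.out = e₂.inp then {combinePair e₁ e₂} else 0

variable {U : WFST K A B S} {V : WFST K B C S'}

theorem dst_mem_of_mem_pairMatches (hU : U.Valid) (hV : V.Valid) {q : S × S'}
    {e : Transition K A C (S × S')} (h : e ∈ pairMatches U V q) :
    e.dst.1 ∈ U.states ∧ e.dst.2 ∈ V.states := by
  simp only [pairMatches, Multiset.mem_bind, Multiset.mem_coe] at h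
  obtain ⟨e₁, h1, e₂, h2, h⟩ := h
  split_ifs at h with hc
  · rw [Multiset.mem_singleton] at h
    subst h
    exact ⟨hU.dst_mem _ h1, hV.dst_mem _ h2⟩
  · simp at h

variable [DecidableEq S] [DecidableEq S']

/-- The transitions that standard composition generates at `q`. -/
def pairList (U : WFST K A B S) (V : WFST K B C S') (q : S × S') :
    Hashed p K A B C S S' → List (Transition K A C (S × S'))
  | .first code h => (V.leaving q.2).flatMap fun e₂ =>
      (lookup h (code (q.1, e₂.inp))).val.flatMap fun e₁ => [combinePair e₁ e₂]
  | .second code h => (U.leaving q.1).flatMap fun e₁ =>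
      (lookup h (code (q.2, e₁.out))).val.flatMap fun e₂ => [combinePair e₁ e₂]

/-- The number of transitions scanned at `q`. -/
def scanned (U : WFST K A B S) (V : WFST K B C S') (q : S × S') : Hashed p K A B C S S' → ℕ
  | .first _ _ => (V.leaving q.2).length
  | .second _ _ => (U.leaving q.1).length

/-- Whichever transducer is hashed, the result is the same double sum, in one of the two orders. -/
theorem coe_pairList [Fact p.Prime] {hs : Hashed p K A B C S S'} (h : hs.Prepared U V)
    (q : S × S') : (pairList U V q hs : Multiset _) = pairMatches U V q := by
  classical
  cases hs with
  | first code t =>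
    obtain ⟨N, h⟩ := h
    have hr := represents_of_returns h
    simp only [pairList, coe_flatMap, bind_leaving, hr.bind_lookup, ite_bind, pairMatches]
    rw [Multiset.bind_bind]
    refine Multiset.bind_congr fun e₁ _ => Multiset.bind_congr fun e₂ _ => ?_
    simp only [← ite_and, EmbeddingLike.apply_eq_iff_eq, Prod.mk.injEq, Multiset.coe_singleton]
    exact ite_eq_ite_of_iff (by grind) _ _
  | second code t =>
    obtain ⟨N, h⟩ := h
    have hr := represents_of_returns h
    simp only [pairList, coe_flatMap, bind_leaving, hr.bind_lookup, ite_bind, pairMatches]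
    refine Multiset.bind_congr fun e₁ _ => Multiset.bind_congr fun e₂ _ => ?_
    simp only [← ite_and, EmbeddingLike.apply_eq_iff_eq, Prod.mk.injEq, Multiset.coe_singleton]
    exact ite_eq_ite_of_iff (by grind) _ _

theorem emits_emitPair (disc : Discipline) (e₁ : Transition K A B S) (e₂ : Transition K B C S') :
    Emits (fun c => emitPair disc c e₁ e₂) (emitVal disc) [combinePair e₁ e₂] 0 5 :=
  ((emits_emit disc (combinePair e₁ e₂)).bind_left (Comp.op (e₁.weight * e₂.weight))).mono
    (Nat.zero_le _) (by simp [Comp.op])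

/-- The lower bound is kept because the comparison with 3-way composition needs standard composition
to pay at least one step per match. -/
theorem emits_lookup {V σ ε : Type*} {step : σ → ε → σ} {f : σ → V → Comp σ} {L : V → ε}
    (h : ∀ v, Emits (fun s => f s v) step [L v] 0 5) (t : HashTable p V) (k : ZMod p) :
    Emits (fun s => (lookup t k).bind fun G => Comp.forEach G s f) step
      ((lookup t k).val.flatMap fun v => [L v]) (lookup t k).val.length
      (7 + 6 * (lookup t k).val.length) := by
  refine (Emits.bind_left (lookup t k) (f := fun G s => Comp.forEach G s f)
    (Emits.forEach fun v _ => h v)).mono ?_ ?_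
  · simp only [List.map_const', List.sum_replicate, smul_eq_mul]
    omega
  · have := time_lookup t k
    simp only [List.map_const', List.sum_replicate, smul_eq_mul]
    omega

theorem emits_scan {α σ ε : Type*} {step : σ → ε → σ} {f : σ → α → Comp σ} {L : α → List ε}
    {xs : List α}
    (h : ∀ x ∈ xs, Emits (fun s => f s x) step (L x) (L x).length (7 + 6 * (L x).length)) :
    Emits (fun s => Comp.forEach xs s f) step (xs.flatMap L) (xs.length + (xs.flatMap L).length)
      (1 + 8 * xs.length + 6 * (xs.flatMap L).length) := by
  refine (Emits.forEach h).mono ?_ ?_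
  · have := sum_map_linear xs 1 1 fun x => (L x).length
    simp only [one_mul, Nat.add_comm 1] at this
    rw [this, List.length_flatMap]
    omega
  · simp only [add_right_comm 7 _ 1, sum_map_linear, List.length_flatMap]
    omega

theorem emits_expandPair (hs : Hashed p K A B C S S') (disc : Discipline) (q : S × S') :
    Emits (fun c => expandPair U V disc c q hs) (emitVal disc) (pairList U V q hs)
      (scanned U V q hs + (pairList U V q hs).length)
      (1 + 8 * scanned U V q hs + 6 * (pairList U V q hs).length) := by
  cases hs with
  | first code t =>
    refine emits_scan fun e₂ _ => ?_
    convert emits_lookup (fun e₁ => emits_emitPair disc e₁ e₂) t (code (q.1, e₂.inp)) using 1 <;>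
      simp [List.length_flatMap]
  | second code t =>
    refine emits_scan fun e₁ _ => ?_
    convert emits_lookup (fun e₂ => emits_emitPair disc e₁ e₂) t (code (q.2, e₁.out)) using 1 <;>
      simp [List.length_flatMap]

def isInitPair (U : WFST K A B S) (V : WFST K B C S') (q : S × S') : Bool :=
  q.1 ∈ U.init ∧ q.2 ∈ V.init

def isFinalPair (U : WFST K A B S) (V : WFST K B C S') (q : S × S') : Bool :=
  q.1 ∈ U.final ∧ q.2 ∈ V.final

theorem visitPair_spec (hs : Hashed p K A B C S S') (disc : Discipline)
    (c : Config K A C (S × S')) (q : S × S') :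
    (visitPair hs U V disc c q).val =
      (pairList U V q hs).foldl (emitVal disc)
        (markVal (isInitPair U V) (isFinalPair U V)
          (fun q => U.initWeight q.1 * V.initWeight q.2)
          (fun q => U.finalWeight q.1 * V.finalWeight q.2) c q) ∧
    scanned U V q hs + (pairList U V q hs).length ≤ (visitPair hs U V disc c q).time ∧
    (visitPair hs U V disc c q).time ≤
      7 + 8 * scanned U V q hs + 6 * (pairList U V q hs).length := by
  obtain ⟨h1, h2, h3⟩ := emits_expandPair (U := U) (V := V) hs disc q
    (markVal (isInitPair U V) (isFinalPair U V)
      (fun q => U.initWeight q.1 * V.initWeight q.2)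
      (fun q => U.finalWeight q.1 * V.finalWeight q.2) c q)
  cases hi : decide (q.1 ∈ U.init ∧ q.2 ∈ V.init) <;>
  cases hf : decide (q.1 ∈ U.final ∧ q.2 ∈ V.final) <;>
  simp only [visitPair, Comp.bind, Comp.op, markVal, isInitPair, isFinalPair, markInit, markFinal,
    hi, hf, if_true, if_false, Bool.false_eq_true] at h1 h2 h3 ⊢ <;>
  exact ⟨h1, by omega, by omega⟩

/-- Unlike in the 3-way case, the time is bounded from below: one step for each state, each
transition scanned and each transition emitted. -/
theorem standard_ends [Fact p.Prime] (hU : U.Valid) (hV : V.Valid) {hs : Hashed p K A B C S S'}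
    (hp : hs.Prepared U V) (disc : Discipline) :
    ∃ T t, StandardEnds hs U V disc T t ∧
      Explored (isInitPair U V) (isFinalPair U V)
        (fun q => U.initWeight q.1 * V.initWeight q.2)
        (fun q => U.finalWeight q.1 * V.finalWeight q.2) (fun q => pairList U V q hs) T ∧
      1 + (T.states.map fun q => 1 + scanned U V q hs + (pairList U V q hs).length).sum ≤ t := by
  set starts := U.init.flatMap fun q₁ => V.init.flatMap fun q₂ => [(q₁, q₂)] with hstarts
  have hst : ∀ q, q ∈ starts ↔ isInitPair U V q = true := by
    rintro ⟨q₁, q₂⟩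
    simp [hstarts, isInitPair]
  have hfin : ∀ q, Reach (isInitPair U V) (fun q => pairList U V q hs) q →
      q ∈ U.states.toFinset ×ˢ V.states.toFinset := by
    intro q hq
    induction hq with
    | start h =>
      simp only [isInitPair, decide_eq_true_eq] at h
      simp [hU.init_subset h.1, hV.init_subset h.2]
    | step _ he _ =>
      rw [← Multiset.mem_coe, coe_pairList hp] at he
      simpa using dst_mem_of_mem_pairMatches hU hV he
  obtain ⟨N, T, t, R, hN, hT, hR, ht, -⟩ := worklist_ends
    (visit := visitPair hs U V disc) (disc := disc) (L := fun q => pairList U V q hs)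
    (fun c q => (visitPair_spec hs disc c q).1) (fun c q => (visitPair_spec hs disc c q).2.1)
    (fun c q => (visitPair_spec hs disc c q).2.2) _ hfin
    _ _ [] (SearchInv.initial disc starts hst) (Nat.le_add_right _ _)
  have e1 := (Emits.forPairs (xs := U.init) (ys := V.init)
    (f := fun (c : Config K A C (S × S')) q₁ q₂ => discover disc c (q₁, q₂))
    (fun q₁ _ q₂ _ => (emits_discover disc (q₁, q₂)).mono (Nat.zero_le _) le_rfl)
    Config.start).1
  refine ⟨T, (Comp.forPairs U.init V.init (Config.start (K := K) (A := A) (D := C))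
      fun c q₁ q₂ => discover disc c (q₁, q₂)).time + t, ⟨N, ?_⟩, hT, ?_⟩
  · simp only [standard, Comp.bind]
    rw [e1, hN]
  · rw [List.nil_append] at hR
    rw [(hR.map _).sum_eq]
    simp only [Nat.add_comm _ 1, ← Nat.add_assoc] at ht ⊢
    omega

end StandardComposition

/-! ### Composition with the identity transducer -/

section Renaming

variable {K A D S S' : Type*} {isInit isFinal : S → Bool} {wi wf : S → K}
  {L : S → List (Transition K A D S)} {isInit' isFinal' : S' → Bool} {wi' wf' : S' → K}
  {L' : S' → List (Transition K A D S')}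

/-- The transition `e` with its states renamed. -/
def Transition.rename (f : S → S') (e : Transition K A D S) : Transition K A D S' :=
  ⟨f e.src, e.inp, e.out, e.weight, f e.dst⟩

theorem filter_map_perm {f : S → S'} {l : List S} {l' : List S'} (h : (l.map f).Perm l')
    {P : S → Bool} {P' : S' → Bool} (hP : ∀ q, P' (f q) = P q) :
    ((l.filter P).map f).Perm (l'.filter P') := by
  refine List.Perm.trans (.of_eq ?_) (h.filter P')
  rw [List.filter_map]
  congr 2
  funext q
  exact (hP q).symm

/-- Reachability is carried along `f` and back along its inverse `g`; as both state lists are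
duplicate-free, equal membership suffices. -/
theorem Explored.states_perm {f : S → S'} {g : S' → S} (hfg : ∀ r, f (g r) = r)
    (hgf : ∀ q, g (f q) = q) (hi : ∀ q, isInit' (f q) = isInit q)
    (hL : ∀ q, ((L q).map (Transition.rename f)).Perm (L' (f q)))
    {T : WFST K A D S} {T' : WFST K A D S'}
    (hT : Explored isInit isFinal wi wf L T) (hT' : Explored isInit' isFinal' wi' wf' L' T') :
    (T.states.map f).Perm T'.states := by
  have h1 : ∀ q, Reach isInit L q → Reach isInit' L' (f q) := by
    intro q h
    induction h with
    | start h => exact .start (by rw [hi, h])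
    | @step q e _ he ih =>
      exact .step (e := e.rename f) ih ((hL q).mem_iff.1 (List.mem_map_of_mem he))
  have h2 : ∀ r, Reach isInit' L' r → Reach isInit L (g r) := by
    intro r h
    induction h with
    | start h => exact .start (by rw [← hi, hfg, h])
    | @step r e _ he ih =>
      rw [← hfg r] at he
      obtain ⟨e', he', rfl⟩ := List.mem_map.1 ((hL (g r)).mem_iff.2 he)
      have := Reach.step ih he'
      simpa [Transition.rename, hgf] using this
  refine (List.perm_ext_iff_of_nodup (hT.nodup.map (Function.LeftInverse.injective hgf))
    hT'.nodup).2 fun r => ?_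
  rw [hT'.mem_states, List.mem_map]
  constructor
  · rintro ⟨q, hq, rfl⟩
    exact h1 q ((hT.mem_states q).1 hq)
  · intro hr
    exact ⟨g r, (hT.mem_states _).2 (h2 r hr), hfg r⟩

/-- Initial states, final states and transitions are determined by the list of states up to order,
so the agreement of the states carries over to all the data. -/
theorem Explored.renamesTo {f : S → S'} {g : S' → S} (hfg : ∀ r, f (g r) = r)
    (hgf : ∀ q, g (f q) = q) (hi : ∀ q, isInit' (f q) = isInit q)
    (hf : ∀ q, isFinal' (f q) = isFinal q) (hwi : ∀ q, wi' (f q) = wi q)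
    (hwf : ∀ q, wf' (f q) = wf q)
    (hL : ∀ q, ((L q).map (Transition.rename f)).Perm (L' (f q)))
    {T : WFST K A D S} {T' : WFST K A D S'}
    (hT : Explored isInit isFinal wi wf L T) (hT' : Explored isInit' isFinal' wi' wf' L' T') :
    T.RenamesTo f T' := by
  have hs := hT.states_perm hfg hgf hi hL hT'
  have hinit : (T.init.map f).Perm T'.init :=
    ((hT.init_perm.map f).trans (filter_map_perm hs hi)).trans hT'.init_perm.symm
  have hfinal : (T.final.map f).Perm T'.final :=
    ((hT.final_perm.map f).trans (filter_map_perm hs hf)).trans hT'.final_perm.symm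
  refine ⟨hs, hinit, hfinal, ?_, fun q hq => ?_, fun q hq => ?_⟩
  · refine (hT.trans_perm.map _).trans (.trans ?_ hT'.trans_perm.symm)
    refine .trans ?_ (hs.flatMap_right L')
    rw [List.map_flatMap, List.flatMap_map]
    exact List.Perm.flatMap_left _ fun q _ => hL q
  · rw [hT.initWeight_eq q hq, hT'.initWeight_eq _ (hinit.mem_iff.1 (List.mem_map_of_mem hq)), hwi]
  · rw [hT.finalWeight_eq q hq,
      hT'.finalWeight_eq _ (hfinal.mem_iff.1 (List.mem_map_of_mem hq)), hwf]

end Renaming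

/-! ### Matches that involve the identity transducer -/

section Identity

variable {K A B C S S' : Type*} [CommSemiring K]

theorem identity_valid (K : Type*) [Semiring K] (A : Type*) [Fintype A] :
    (identity K A).Valid := by
  constructor <;> simp [identity]

theorem bind_identity {β : Type*} [Fintype A] (f : Transition K A A Unit → Multiset β) :
    ((identity K A).trans : Multiset (Transition K A A Unit)).bind f
      = (Finset.univ : Finset A).val.bind fun a => f ⟨(), a, a, 1, ()⟩ := by
  rw [identity, ← Multiset.map_coe, Finset.coe_toList, Multiset.bind_map]

/-- Summing over the loops of the identity: matching forces the letter to be `b`, so a single term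
survives. -/
theorem bind_univ_ite {α β : Type*} [Fintype α] {P : α → Prop} {_ : DecidablePred P} {Q : Prop}
    [Decidable Q] (b : α) (f : α → Multiset β) (h : ∀ a, P a ↔ a = b ∧ Q) :
    ((Finset.univ : Finset α).val.bind fun a => if P a then f a else 0)
      = if Q then f b else 0 := by
  classical
  change (∑ a, if P a then f a else 0) = _
  rw [Finset.sum_eq_single b]
  · exact ite_eq_ite_of_iff (by simp [h]) _ _
  · intro a _ ha
    rw [if_neg (by simp [h, ha])]
  · simp

variable {U : WFST K A B S} {V : WFST K B C S'}

/-- Each matching pair extends by exactly one loop, labelled with the input of `e₁` and of weight 1,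
so nothing is lost, repeated or rescaled. -/
theorem map_tripleMatches_identity_left [Fintype A] (q : Unit × S × S') :
    (tripleMatches (identity K A) U V q).map (Transition.rename fun q => (q.2.1, q.2.2))
      = pairMatches U V (q.2.1, q.2.2) := by
  classical
  simp only [tripleMatches, pairMatches, bind_identity]
  rw [Multiset.bind_bind, Multiset.map_bind]
  refine Multiset.bind_congr fun e₁ _ => ?_
  rw [Multiset.bind_bind, Multiset.map_bind]
  refine Multiset.bind_congr fun e₂ _ => ?_
  rw [bind_univ_ite e₁.inp (Q := (e₁.src = q.2.1 ∧ e₂.src = q.2.2) ∧ e₁.out = e₂.inp)]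
  · split_ifs <;> simp [Transition.rename, combine, combinePair]
  · intro a; simp; tauto

theorem map_tripleMatches_identity_middle [Fintype B] (q : S × Unit × S') :
    (tripleMatches U (identity K B) V q).map (Transition.rename fun q => (q.1, q.2.2))
      = pairMatches U V (q.1, q.2.2) := by
  classical
  simp only [tripleMatches, pairMatches, bind_identity]
  rw [Multiset.map_bind]
  refine Multiset.bind_congr fun e₁ _ => ?_
  rw [Multiset.bind_bind, Multiset.map_bind]
  refine Multiset.bind_congr fun e₂ _ => ?_
  rw [bind_univ_ite e₁.out (Q := (e₁.src = q.1 ∧ e₂.src = q.2.2) ∧ e₁.out = e₂.inp)]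
  · split_ifs <;> simp [Transition.rename, combine, combinePair]
  · intro a; simp; grind

theorem map_tripleMatches_identity_right [Fintype C] (q : S × S' × Unit) :
    (tripleMatches U V (identity K C) q).map (Transition.rename fun q => (q.1, q.2.1))
      = pairMatches U V (q.1, q.2.1) := by
  classical
  simp only [tripleMatches, pairMatches, bind_identity]
  rw [Multiset.map_bind]
  refine Multiset.bind_congr fun e₁ _ => ?_
  rw [Multiset.map_bind]
  refine Multiset.bind_congr fun e₂ _ => ?_
  rw [bind_univ_ite e₂.out (Q := (e₁.src = q.1 ∧ e₂.src = q.2.1) ∧ e₁.out = e₂.inp)]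
  · split_ifs <;> simp [Transition.rename, combine, combinePair]
  · intro a; simp; grind

end Identity


/-! ### The weights assigned to pairs of strings -/

section Weights

namespace WFST

variable {K A B S : Type*} [CommSemiring K]

open Classical in
/-- The weight of the paths from `q` to a final state that are labelled with `(x, y)`, final
weights included. -/
noncomputable def weightFrom (T : WFST K A B S) : List A → List B → S → K
  | [], [], q => if q ∈ T.final then T.finalWeight q else 0
  | a :: x, b :: y, q => ∑ i : Fin T.trans.length,
      if (T.trans.get i).src = q ∧ (T.trans.get i).inp = a ∧ (T.trans.get i).out = b
      then (T.trans.get i).weight * weightFrom T x y (T.trans.get i).dst else 0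
  | [], _ :: _, _ => 0
  | _ :: _, [], _ => 0

/-- The paths counted by `weightFrom`, each with its destination. -/
def pathsFrom (T : WFST K A B S) (x : List A) (y : List B) (p : S) :
    Set (List (Fin T.trans.length) × S) :=
  {π | π.2 ∈ T.final ∧ T.IsPath p π.1 π.2 ∧ (π.1.map fun e => (T.trans.get e).inp) = x ∧
    (π.1.map fun e => (T.trans.get e).out) = y}

variable (T : WFST K A B S)

omit [CommSemiring K] in
theorem pathsFrom_finite (x : List A) (y : List B) (p : S) : (T.pathsFrom x y p).Finite := by
  refine ((List.finite_length_eq (Fin T.trans.length) x.length).prod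
    T.final.finite_toSet).subset ?_
  rintro ⟨π, q⟩ ⟨hq, -, hx, -⟩
  refine ⟨?_, hq⟩
  have := congrArg List.length hx
  simpa using this

theorem finsum_mem_eq_sum_ite {ι M : Type*} [Fintype ι] [AddCommMonoid M] (P : ι → Prop)
    [DecidablePred P] (f : ι → M) : (∑ᶠ i ∈ {i | P i}, f i) = ∑ i, if P i then f i else 0 := by
  rw [finsum_eq_sum_of_fintype]
  refine Finset.sum_congr rfl fun i _ => ?_
  rw [finsum_eq_if]
  rfl

omit [CommSemiring K] in
theorem pathsFrom_cons (a : A) (x : List A) (b : B) (y : List B) (p : S) :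
    T.pathsFrom (a :: x) (b :: y) p =
      ⋃ i ∈ {i : Fin T.trans.length | (T.trans.get i).src = p ∧ (T.trans.get i).inp = a ∧
        (T.trans.get i).out = b},
        (fun τ : List (Fin T.trans.length) × S => (i :: τ.1, τ.2)) ''
          T.pathsFrom x y (T.trans.get i).dst := by
  ext ⟨π, q⟩
  simp only [Set.mem_iUnion, Set.mem_image, Prod.mk.injEq, Prod.exists]
  constructor
  · rintro ⟨h1, h2, h3, h4⟩
    cases π with
    | nil => simp at h3
    | cons i π =>
      simp only [List.map_cons, List.cons.injEq] at h3 h4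
      exact ⟨i, ⟨h2.1, h3.1, h4.1⟩, π, q, ⟨h1, h2.2, h3.2, h4.2⟩, rfl, rfl⟩
  · rintro ⟨i, ⟨h1, h2, h3⟩, π', q', ⟨h4, h5, h6, h7⟩, rfl, rfl⟩
    exact ⟨h4, ⟨h1, h5⟩, by simp only [List.map_cons]; rw [h2]; exact congrArg _ h6,
      by simp only [List.map_cons]; rw [h3]; exact congrArg _ h7⟩

/-- Nonempty label strings split the paths by their first transition (`pathsFrom_cons`). Since paths
are lists of positions, the parts are disjoint even for repeated transitions. -/
theorem weightFrom_eq (x : List A) (y : List B) (p : S) :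
    T.weightFrom x y p = ∑ᶠ π ∈ T.pathsFrom x y p,
      (π.1.map fun e => (T.trans.get e).weight).prod * T.finalWeight π.2 := by
  classical
  induction x generalizing y p with
  | nil =>
    cases y with
    | nil =>
      have h : T.pathsFrom [] [] p = {π | π = ([], p) ∧ p ∈ T.final} := by
        ext ⟨π, q⟩
        constructor
        · rintro ⟨h1, h2, h3, h4⟩
          obtain rfl := List.map_eq_nil_iff.1 h3
          obtain rfl : p = q := h2
          exact ⟨rfl, h1⟩
        · rintro ⟨h1, h2⟩
          simp only [Prod.mk.injEq] at h1
          obtain ⟨rfl, rfl⟩ := h1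
          exact ⟨h2, rfl, rfl, rfl⟩
      rw [h, weightFrom]
      by_cases hp : p ∈ T.final
      · simp only [hp, and_true, if_true]
        have : {π : List (Fin T.trans.length) × S | π = ([], p)} = {([], p)} := rfl
        rw [this, finsum_mem_singleton]
        simp
      · simp [hp]
    | cons b y =>
      have h : T.pathsFrom [] (b :: y) p = ∅ := by
        refine Set.eq_empty_iff_forall_notMem.2 ?_
        rintro ⟨π, q⟩ ⟨-, -, h3, h4⟩
        obtain rfl := List.map_eq_nil_iff.1 h3
        simp at h4
      rw [h, finsum_mem_empty, weightFrom]
  | cons a x ih =>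
    cases y with
    | nil =>
      have h : T.pathsFrom (a :: x) [] p = ∅ := by
        refine Set.eq_empty_iff_forall_notMem.2 ?_
        rintro ⟨π, q⟩ ⟨-, -, h3, h4⟩
        obtain rfl := List.map_eq_nil_iff.1 h4
        simp at h3
      rw [h, finsum_mem_empty, weightFrom]
    | cons b y =>
      rw [pathsFrom_cons, finsum_mem_biUnion, finsum_mem_eq_sum_ite, weightFrom]
      · refine Finset.sum_congr rfl fun i _ => ite_congr rfl (fun _ => ?_) fun _ => rfl
        rw [finsum_mem_image, ih, mul_finsum_mem' _ _ (T.pathsFrom_finite _ _ _)]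
        · refine finsum_mem_congr rfl fun τ _ => ?_
          simp only [List.map_cons, List.prod_cons, mul_assoc]
        · rintro ⟨π, q⟩ - ⟨π', q'⟩ - h
          simpa using h
      · intro i _ j _ hij
        refine Set.disjoint_left.2 ?_
        rintro _ ⟨τ, -, rfl⟩ ⟨τ', -, h⟩
        simp only [Prod.mk.injEq, List.cons.injEq] at h
        exact hij h.1.1.symm
      · exact Set.toFinite _
      · exact fun i _ => (T.pathsFrom_finite _ _ _).image _

theorem weight_eq_sum [DecidableEq S] (x : List A) (y : List B) :
    T.weight x y = ∑ p ∈ T.init.toFinset, T.initWeight p * T.weightFrom x y p := by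
  have h : T.paths x y = ⋃ p ∈ (T.init.toFinset : Set S),
      (fun τ : List (Fin T.trans.length) × S => (p, τ)) '' T.pathsFrom x y p := by
    ext ⟨p, π, q⟩
    simp only [Set.mem_iUnion, Set.mem_image, Prod.mk.injEq, Prod.exists, List.coe_toFinset]
    constructor
    · rintro ⟨h1, h2⟩
      exact ⟨p, h1, π, q, h2, rfl, rfl, rfl⟩
    · rintro ⟨p', h1, π', q', h2, rfl, rfl, rfl⟩
      exact ⟨h1, h2⟩
  rw [weight, h, finsum_mem_biUnion, finsum_mem_coe_finset]
  · refine Finset.sum_congr rfl fun p _ => ?_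
    rw [finsum_mem_image, weightFrom_eq, mul_finsum_mem' _ _ (T.pathsFrom_finite _ _ _)]
    · simp only [mul_assoc]
    · intro τ _ τ' _ h
      exact (Prod.mk.injEq _ _ _ _ ▸ h).2
  · intro i _ j _ hij
    refine Set.disjoint_left.2 ?_
    rintro _ ⟨τ, -, rfl⟩ ⟨τ', -, h⟩
    exact hij (Prod.ext_iff.1 h).1.symm
  · exact Finset.finite_toSet _
  · exact fun i _ => (T.pathsFrom_finite _ _ _).image _

end WFST

def consEmbedding (B : Type*) : B × List B ↪ List B :=
  ⟨fun p => p.1 :: p.2, fun p q h => by simpa [Prod.ext_iff] using h⟩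

theorem consEmbedding_apply {B : Type*} (p : B × List B) : consEmbedding B p = p.1 :: p.2 := rfl

/-- The strings of length `n` with letters in `s`. -/
def words {B : Type*} (s : Finset B) : ℕ → Finset (List B)
  | 0 => {[]}
  | n + 1 => (s ×ˢ words s n).map (consEmbedding B)

theorem mem_words {B : Type*} {s : Finset B} {n : ℕ} {z : List B} :
    z ∈ words s n ↔ z.length = n ∧ ∀ b ∈ z, b ∈ s := by
  induction n generalizing z with
  | zero => simp only [words, Finset.mem_singleton, List.length_eq_zero_iff]; grind
  | succ n ih =>
    cases z with
    | nil => simp [words, consEmbedding_apply]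
    | cons b z => simp [words, ih, consEmbedding_apply]; tauto

theorem sum_words_succ {B C M : Type*} [AddCommMonoid M] (s : Finset B) (t : Finset C) (n : ℕ)
    (f : List B × List C → M) :
    ∑ z ∈ words s (n + 1) ×ˢ words t (n + 1), f z =
      ∑ bc ∈ s ×ˢ t, ∑ z ∈ words s n ×ˢ words t n, f (bc.1 :: z.1, bc.2 :: z.2) := by
  simp only [Finset.sum_product, words, Finset.sum_map, consEmbedding_apply]
  refine Finset.sum_congr rfl fun b _ => ?_
  rw [Finset.sum_comm]

/-- Each transition reads and writes one letter, so only output strings of the length of `x` over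
the occurring letters have nonzero weight. This bounds the intermediate strings. -/
theorem WFST.mem_words_of_weightFrom_ne_zero {K A B S : Type*} [CommSemiring K]
    {T : WFST K A B S} {s : Finset B} (hs : ∀ e ∈ T.trans, e.out ∈ s) {x : List A} {y : List B}
    {q : S} (h : T.weightFrom x y q ≠ 0) : y ∈ words s x.length := by
  classical
  induction x generalizing y q with
  | nil =>
    cases y with
    | nil => simp [words]
    | cons b y => simp [weightFrom] at h
  | cons a x ih =>
    cases y with
    | nil => simp [weightFrom] at h
    | cons b y =>
      rw [weightFrom] at h
      obtain ⟨i, -, hi⟩ := Finset.exists_ne_zero_of_sum_ne_zero h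
      split_ifs at hi with hc
      · have h1 := mem_words.1 (ih (right_ne_zero_of_mul hi))
        refine mem_words.2 ⟨by simp [h1.1], fun b' hb' => ?_⟩
        rcases List.mem_cons.1 hb' with rfl | hb'
        · rw [← hc.2.2]; exact hs _ (List.get_mem _ _)
        · exact h1.2 _ hb'
      · exact absurd rfl hi

theorem WFST.mem_words_of_weight_ne_zero {K A B S : Type*} [CommSemiring K]
    {T : WFST K A B S} {s : Finset B} (hs : ∀ e ∈ T.trans, e.out ∈ s) {x : List A} {y : List B}
    (h : T.weight x y ≠ 0) : y ∈ words s x.length := by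
  classical
  rw [weight_eq_sum] at h
  obtain ⟨p, -, hp⟩ := Finset.exists_ne_zero_of_sum_ne_zero h
  exact mem_words_of_weightFrom_ne_zero hs (right_ne_zero_of_mul hp)

end Weights

/-! ### The weights of the product transducer -/

section ProductWeights

variable {K A B C D S₁ S₂ S₃ : Type*} [CommSemiring K]
variable [DecidableEq S₁] [DecidableEq S₂] [DecidableEq S₃]
variable {T₁ : WFST K A B S₁} {T₂ : WFST K B C S₂} {T₃ : WFST K C D S₃}

theorem sum_get_eq {α M : Type*} [AddCommMonoid M] (l : List α) (f : α → M) :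
    ∑ i : Fin l.length, f (l.get i) = ((l : Multiset α).map f).sum := by
  rw [Multiset.map_coe, Multiset.sum_coe]
  exact Fin.sum_univ_fun_getElem l f

theorem sum_mul_sum_mul_sum {α β γ R : Type*} [CommSemiring R] (s : Finset α) (t : Finset β)
    (u : Finset γ) (f : α → R) (g : β → R) (h : γ → R) :
    (∑ i ∈ s, f i) * (∑ j ∈ t, g j) * (∑ k ∈ u, h k)
      = ∑ i ∈ s, ∑ j ∈ t, ∑ k ∈ u, f i * g j * h k := by
  rw [Finset.sum_mul_sum, Finset.sum_mul]
  refine Finset.sum_congr rfl fun i _ => ?_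
  rw [Finset.sum_mul]
  exact Finset.sum_congr rfl fun j _ => Finset.mul_sum _ _ _

theorem sum_sum_comm {α β ι κ μ M : Type*} [Fintype ι] [Fintype κ] [Fintype μ] [AddCommMonoid M]
    (s : Finset α) (t : Finset β) (F : α → β → ι → κ → μ → M) :
    ∑ a ∈ s, ∑ b ∈ t, ∑ i, ∑ j, ∑ k, F a b i j k
      = ∑ i, ∑ j, ∑ k, ∑ a ∈ s, ∑ b ∈ t, F a b i j k := by
  have := Finset.sum_comm (s := s ×ˢ t) (t := (Finset.univ : Finset (ι × κ × μ)))
    (f := fun p r => F p.1 p.2 r.1 r.2.1 r.2.2)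
  simpa only [Finset.sum_product, Fintype.sum_prod_type] using this

-- Positions in the transition list of the product are known only up to permutation, so the sum
-- passes through multisets and comes back as a sum over triples of positions.
open Classical in
theorem sum_trans_leaving [DecidableEq B] [DecidableEq C] {T : WFST K A D (S₁ × S₂ × S₃)}
    (hT : IsTripleProduct T₁ T₂ T₃ T) {q : S₁ × S₂ × S₃} (hq : q ∈ T.states)
    (f : Transition K A D (S₁ × S₂ × S₃) → K) :
    (∑ i : Fin T.trans.length, if (T.trans.get i).src = q then f (T.trans.get i) else 0) =
      ∑ i : Fin T₁.trans.length, ∑ j : Fin T₂.trans.length, ∑ k : Fin T₃.trans.length,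
        if ((T₁.trans.get i).src = q.1 ∧ (T₂.trans.get j).src = q.2.1 ∧
            (T₃.trans.get k).src = q.2.2) ∧
          (T₁.trans.get i).out = (T₂.trans.get j).inp ∧
          (T₂.trans.get j).out = (T₃.trans.get k).inp
        then f (combine (T₁.trans.get i) (T₂.trans.get j) (T₃.trans.get k)) else 0 := by
  have hsrc : ∀ q', ∀ e ∈ tripleMatches T₁ T₂ T₃ q', e.src = q' := by
    intro q' e he
    obtain ⟨e₁, h1, e₂, h2, e₃, h3, rfl, h4, h5, rfl⟩ := mem_tripleMatches.1 he
    rfl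
  have h1 : (∑ i : Fin T.trans.length, if (T.trans.get i).src = q then f (T.trans.get i) else 0)
      = ((tripleMatches T₁ T₂ T₃ q).map f).sum := by
    rw [sum_get_eq T.trans fun e => if e.src = q then f e else 0,
      Multiset.coe_eq_coe.2 hT.trans_perm, coe_flatMap, Multiset.map_bind, Multiset.sum_bind]
    have h2 : ∀ q' ∈ (T.states : Multiset (S₁ × S₂ × S₃)),
        (((matchesAt T₁ T₂ T₃ q' : Multiset _).map fun e => if e.src = q then f e else 0).sum)
          = if q' = q then ((tripleMatches T₁ T₂ T₃ q).map f).sum else 0 := by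
      intro q' _
      rw [coe_matchesAt]
      split_ifs with h
      · subst h
        rw [Multiset.map_congr rfl fun e he => if_pos (hsrc q' e he)]
      · rw [Multiset.map_congr rfl fun e he => if_neg (by rw [hsrc q' e he]; exact h)]
        simp
    rw [Multiset.map_congr rfl h2]
    -- The states are distinct, so the matches at `q` are counted exactly once.
    have hq' : q ∈ (⟨T.states, hT.valid.states_nodup⟩ : Finset (S₁ × S₂ × S₃)) := hq
    exact (Finset.sum_ite_eq' _ q _).trans (if_pos hq')
  rw [h1, tripleMatches]
  simp only [Multiset.map_bind, Multiset.sum_bind, ← sum_get_eq]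
  refine Finset.sum_congr rfl fun i _ => Finset.sum_congr rfl fun j _ =>
    Finset.sum_congr rfl fun k _ => ?_
  split_ifs <;> simp

/-- Induction on `x`: the first letters of the intermediate strings are the labels of the first
matching triple, and the rest is the same statement at its destination. Commutativity of `K`
collects the weights of each factor. -/
theorem weightFrom_product [DecidableEq B] [DecidableEq C] {T : WFST K A D (S₁ × S₂ × S₃)}
    (hT : IsTripleProduct T₁ T₂ T₃ T) {s : Finset B} {s' : Finset C}
    (hs : ∀ e ∈ T₁.trans, e.out ∈ s) (hs' : ∀ e ∈ T₂.trans, e.out ∈ s') (x : List A) (y : List D)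
    {q : S₁ × S₂ × S₃} (hq : q ∈ T.states) :
    T.weightFrom x y q = ∑ z ∈ words s x.length ×ˢ words s' x.length,
      T₁.weightFrom x z.1 q.1 * T₂.weightFrom z.1 z.2 q.2.1 * T₃.weightFrom z.2 y q.2.2 := by
  classical
  induction x generalizing y q with
  | nil =>
    simp only [List.length_nil, words, Finset.singleton_product_singleton, Finset.sum_singleton]
    cases y with
    | nil =>
      simp only [WFST.weightFrom]
      by_cases h : q ∈ T.final
      · obtain ⟨-, h1, h2, h3⟩ := (hT.mem_final q).1 h
        simp [h, h1, h2, h3, hT.finalWeight_eq]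
      · rw [if_neg h]
        by_cases h1 : q.1 ∈ T₁.final <;> by_cases h2 : q.2.1 ∈ T₂.final <;>
          by_cases h3 : q.2.2 ∈ T₃.final <;> simp [h1, h2, h3]
        exact absurd ((hT.mem_final q).2 ⟨hq, h1, h2, h3⟩) h
    | cons d y => simp [WFST.weightFrom]
  | cons a x ih =>
    rw [List.length_cons, sum_words_succ]
    cases y with
    | nil => simp [WFST.weightFrom]
    | cons d y =>
      rw [WFST.weightFrom]
      have h1 := sum_trans_leaving hT hq fun e =>
        if e.inp = a ∧ e.out = d then e.weight * T.weightFrom x y e.dst else 0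
      simp only [← ite_and] at h1
      -- The conditions agree; only their decidability instances are reconciled.
      refine Eq.trans (Finset.sum_congr rfl fun i _ => ite_eq_ite_of_iff (Iff.rfl) _ _)
        (h1.trans ?_)
      simp only [WFST.weightFrom, sum_mul_sum_mul_sum]
      rw [sum_sum_comm]
      refine Finset.sum_congr rfl fun i _ => Finset.sum_congr rfl fun j _ =>
        Finset.sum_congr rfl fun k _ => ?_
      set e₁ := T₁.trans.get i with he₁
      set e₂ := T₂.trans.get j with he₂
      set e₃ := T₃.trans.get k with he₃
      have m1 : e₁ ∈ T₁.trans := List.get_mem _ _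
      have m2 : e₂ ∈ T₂.trans := List.get_mem _ _
      have m3 : e₃ ∈ T₃.trans := List.get_mem _ _
      -- For fixed transitions, only their own output letters can begin the intermediate strings.
      rw [Finset.sum_eq_single (e₁.out, e₂.out)]
      · by_cases c1 : e₁.src = q.1 ∧ e₁.inp = a
        · by_cases c2 : e₂.src = q.2.1 ∧ e₂.inp = e₁.out
          · by_cases c3 : e₃.src = q.2.2 ∧ e₃.inp = e₂.out ∧ e₃.out = d
            -- The induction hypothesis applies only at states of `T`; matching transitions keep to
            -- accessible triples.
            · have hmem : (e₁.dst, e₂.dst, e₃.dst) ∈ T.states := by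
                refine (hT.mem_states _).2 (.step m1 m2 m3 c2.2.symm c3.2.1.symm ?_)
                rw [c1.1, c2.1, c3.1]
                exact (hT.mem_states _).1 hq
              rw [if_pos (by simp only [combine]; tauto)]
              simp only [combine, ih y hmem, Finset.mul_sum]
              refine Finset.sum_congr rfl fun z _ => ?_
              rw [if_pos (by tauto), if_pos (by tauto), if_pos (by tauto)]
              ring
            · rw [if_neg (by simp only [combine]; grind)]
              simp [if_neg c3]
          · rw [if_neg (by simp only [combine]; grind)]
            simp [c2]
        · rw [if_neg (by simp only [combine]; grind)]
          simp [c1]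
      · rintro ⟨b, c⟩ - hbc
        refine Finset.sum_eq_zero fun z _ => ?_
        by_cases hb : e₁.out = b
        · have hc : e₂.out ≠ c := fun hc => hbc (by rw [hb, hc])
          simp [hc]
        · simp [hb]
      · intro h
        exact absurd (Finset.mk_mem_product (hs _ m1) (hs' _ m2)) h

theorem weight_product [DecidableEq B] [DecidableEq C] {T : WFST K A D (S₁ × S₂ × S₃)}
    (hT : IsTripleProduct T₁ T₂ T₃ T) (x : List A) (y : List D) :
    (Function.support fun z : List B × List C =>
      T₁.weight x z.1 * T₂.weight z.1 z.2 * T₃.weight z.2 y).Finite ∧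
    T.weight x y = ∑ᶠ z : List B × List C,
      T₁.weight x z.1 * T₂.weight z.1 z.2 * T₃.weight z.2 y := by
  set s := (T₁.trans.map Transition.out).toFinset
  set s' := (T₂.trans.map Transition.out).toFinset
  have hs : ∀ e ∈ T₁.trans, e.out ∈ s := fun e he =>
    List.mem_toFinset.2 (List.mem_map_of_mem he)
  have hs' : ∀ e ∈ T₂.trans, e.out ∈ s' := fun e he =>
    List.mem_toFinset.2 (List.mem_map_of_mem he)
  have hsupp : (Function.support fun z : List B × List C =>
      T₁.weight x z.1 * T₂.weight z.1 z.2 * T₃.weight z.2 y)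
      ⊆ (words s x.length ×ˢ words s' x.length : Finset (List B × List C)) := by
    rintro ⟨z, z'⟩ hz
    rw [Function.mem_support] at hz
    have h1 := WFST.mem_words_of_weight_ne_zero hs (left_ne_zero_of_mul (left_ne_zero_of_mul hz))
    have h2 := WFST.mem_words_of_weight_ne_zero hs' (right_ne_zero_of_mul (left_ne_zero_of_mul hz))
    -- The second intermediate string has the length of the first, which is that of `x`.
    rw [(mem_words.1 h1).1] at h2
    simp [h1, h2]
  refine ⟨(Finset.finite_toSet _).subset hsupp, ?_⟩
  rw [finsum_eq_sum_of_support_subset _ hsupp, WFST.weight_eq_sum]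
  have hinit : T.init.toFinset = T₁.init.toFinset ×ˢ T₂.init.toFinset ×ˢ T₃.init.toFinset := by
    ext q
    simp [hT.mem_init]
  simp only [WFST.weight_eq_sum (S := S₁), WFST.weight_eq_sum (S := S₂),
    WFST.weight_eq_sum (S := S₃)]
  have h : ∀ q ∈ T.init.toFinset, T.initWeight q * T.weightFrom x y q =
      ∑ z ∈ words s x.length ×ˢ words s' x.length,
        (T₁.initWeight q.1 * T₁.weightFrom x z.1 q.1) *
        (T₂.initWeight q.2.1 * T₂.weightFrom z.1 z.2 q.2.1) *
        (T₃.initWeight q.2.2 * T₃.weightFrom z.2 y q.2.2) := by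
    intro q hq
    rw [List.mem_toFinset] at hq
    rw [weightFrom_product hT hs hs' x y (hT.valid.init_subset hq), hT.initWeight_eq q hq,
      Finset.mul_sum]
    exact Finset.sum_congr rfl fun z _ => by ring
  rw [Finset.sum_congr rfl h, Finset.sum_comm, hinit]
  refine Finset.sum_congr rfl fun z _ => ?_
  simp only [Finset.sum_product, sum_mul_sum_mul_sum]

end ProductWeights


/-! ### The main theorem -/

section Main

variable {p : ℕ} [Fact p.Prime] {K A B C D S₁ S₂ S₃ : Type*} [CommSemiring K]
variable [DecidableEq S₁] [DecidableEq S₂] [DecidableEq S₃]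

-- At each state `1 + lookups` is at most `2 * max 1 b`, which doubles the constant 21.
omit [Fact p.Prime] in
theorem threeWay_correct [DecidableEq B] [DecidableEq C] {cd : Codes p B C S₁ S₂ S₃}
    {tab : Tables p K A B C D S₁ S₂ S₃} {T₁ : WFST K A B S₁} {T₂ : WFST K B C S₂}
    {T₃ : WFST K C D S₃} (h₁ : T₁.Valid) (h₂ : T₂.Valid) (h₃ : T₃.Valid) {strat : Strategy}
    (htab : TablesFor cd T₁ T₂ T₃ tab strat) (disc : Discipline) :
    ∃ T t, ThreeWayEnds strat cd tab T₁ T₂ T₃ disc T t ∧ IsTripleProduct T₁ T₂ T₃ T ∧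
      t ≤ 42 * (T.numStates * max 1 (branching T₁ T₂ T₃ strat) + T.numTrans + 1) := by
  obtain ⟨T, t, h1, h2, h3⟩ := threeWay_ends h₁ h₂ h₃ htab disc
  refine ⟨T, t, h1, isTripleProduct_of_explored (coe_expandList htab) h2, h3.trans ?_⟩
  have e1 : T.numTrans = (T.states.map fun q =>
      (expandList cd tab T₁ T₂ T₃ strat q).length).sum := by
    rw [WFST.numTrans, h2.trans_perm.length_eq, List.length_flatMap]
  have e2 : (T.states.map fun q => 1 + lookups T₁ T₂ T₃ strat q
      + (expandList cd tab T₁ T₂ T₃ strat q).length).sum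
      ≤ 2 * (T.numStates * max 1 (branching T₁ T₂ T₃ strat)) + T.numTrans := by
    rw [e1, WFST.numStates]
    generalize T.states = l
    induction l with
    | nil => simp
    | cons q l ih =>
      have := lookups_le h₁ h₂ h₃ strat q
      have h4 := le_max_left 1 (branching T₁ T₂ T₃ strat)
      have h5 := le_max_right 1 (branching T₁ T₂ T₃ strat)
      simp only [List.map_cons, List.sum_cons, List.length_cons, Nat.succ_mul]
      omega
  omega

variable {S S' : Type*} [DecidableEq S] [DecidableEq S']

theorem threeWay_identity_left [Fintype A] {U : WFST K A B S} {V : WFST K B C S'}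
    (hU : U.Valid) (hV : V.Valid) {hs : Hashed p K A B C S S'} (hp : hs.Prepared U V)
    {T' : WFST K A C (S × S')}
    (hT' : Explored (isInitPair U V) (isFinalPair U V)
      (fun q => U.initWeight q.1 * V.initWeight q.2)
      (fun q => U.finalWeight q.1 * V.finalWeight q.2) (fun q => pairList U V q hs) T')
    {cd : Codes p A B Unit S S'} {tab : Tables p K A A B C Unit S S'} {strat : Strategy}
    {disc : Discipline} {T : WFST K A C (Unit × S × S')} {t : ℕ}
    (htab : TablesFor cd (identity K A) U V tab strat)
    (h : ThreeWayEnds strat cd tab (identity K A) U V disc T t) :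
    T.RenamesTo (fun q => (q.2.1, q.2.2)) T' ∧ ∀ code tb, strat = .central →
      hs = .second code tb → t ≤ 21 * (1 + (T'.states.map fun q =>
        1 + scanned U V q hs + (pairList U V q hs).length).sum) := by
  obtain ⟨T₀, t₀, h1, h2, h3⟩ := threeWay_ends (identity_valid K A) hU hV htab disc
  obtain ⟨rfl, rfl⟩ := h.unique h1
  have hL : ∀ q : Unit × S × S', ((expandList cd tab (identity K A) U V strat q).map
      (Transition.rename fun q => (q.2.1, q.2.2))).Perm (pairList U V (q.2.1, q.2.2) hs) := by
    intro q
    rw [← Multiset.coe_eq_coe, ← Multiset.map_coe, coe_expandList htab, coe_pairList hp,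
      map_tripleMatches_identity_left]
  have hi : ∀ q : Unit × S × S', isInitPair U V (q.2.1, q.2.2)
      = isInitTriple (identity K A) U V q := fun q => by
    simp [isInitPair, isInitTriple, identity]
  refine ⟨h2.renamesTo (f := fun q => (q.2.1, q.2.2)) (g := fun r => ((), r)) (fun _ => rfl)
    (fun _ => rfl) hi
    (fun q => by simp [isFinalPair, isFinalTriple, identity]) (fun q => by simp [identity])
    (fun q => by simp [identity]) hL hT', ?_⟩
  rintro code tb rfl rfl
  refine h3.trans (le_of_eq ?_)
  have hperm := h2.states_perm (f := fun q => (q.2.1, q.2.2)) (g := fun r => ((), r))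
    (fun _ => rfl) (fun _ => rfl) hi hL hT'
  rw [← (hperm.map _).sum_eq, List.map_map]
  congr 3
  refine List.map_congr_left fun q _ => ?_
  rw [Function.comp_apply, ← (hL q).length_eq, List.length_map]
  -- The central strategy does one round of lookups for each transition of `U` leaving the state;
  -- these are the transitions scanned when `V` is hashed.
  rfl

theorem threeWay_identity_middle [Fintype B] {U : WFST K A B S} {V : WFST K B C S'}
    (hU : U.Valid) (hV : V.Valid) {hs : Hashed p K A B C S S'} (hp : hs.Prepared U V)
    {T' : WFST K A C (S × S')}
    (hT' : Explored (isInitPair U V) (isFinalPair U V)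
      (fun q => U.initWeight q.1 * V.initWeight q.2)
      (fun q => U.finalWeight q.1 * V.finalWeight q.2) (fun q => pairList U V q hs) T')
    {cd : Codes p B B S Unit S'} {tab : Tables p K A B B C S Unit S'} {strat : Strategy}
    {disc : Discipline} {T : WFST K A C (S × Unit × S')} {t : ℕ}
    (htab : TablesFor cd U (identity K B) V tab strat)
    (h : ThreeWayEnds strat cd tab U (identity K B) V disc T t) :
    T.RenamesTo (fun q => (q.1, q.2.2)) T' := by
  obtain ⟨T₀, t₀, h1, h2, h3⟩ := threeWay_ends hU (identity_valid K B) hV htab disc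
  obtain ⟨rfl, rfl⟩ := h.unique h1
  have hL : ∀ q : S × Unit × S', ((expandList cd tab U (identity K B) V strat q).map
      (Transition.rename fun q => (q.1, q.2.2))).Perm (pairList U V (q.1, q.2.2) hs) := by
    intro q
    rw [← Multiset.coe_eq_coe, ← Multiset.map_coe, coe_expandList htab, coe_pairList hp,
      map_tripleMatches_identity_middle]
  exact h2.renamesTo (f := fun q => (q.1, q.2.2)) (g := fun r => (r.1, (), r.2)) (fun _ => rfl)
    (fun _ => rfl) (fun q => by simp [isInitPair, isInitTriple, identity])
    (fun q => by simp [isFinalPair, isFinalTriple, identity]) (fun q => by simp [identity])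
    (fun q => by simp [identity]) hL hT'

theorem threeWay_identity_right [Fintype C] {U : WFST K A B S} {V : WFST K B C S'}
    (hU : U.Valid) (hV : V.Valid) {hs : Hashed p K A B C S S'} (hp : hs.Prepared U V)
    {T' : WFST K A C (S × S')}
    (hT' : Explored (isInitPair U V) (isFinalPair U V)
      (fun q => U.initWeight q.1 * V.initWeight q.2)
      (fun q => U.finalWeight q.1 * V.finalWeight q.2) (fun q => pairList U V q hs) T')
    {cd : Codes p B C S S' Unit} {tab : Tables p K A B C C S S' Unit} {strat : Strategy}
    {disc : Discipline} {T : WFST K A C (S × S' × Unit)} {t : ℕ}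
    (htab : TablesFor cd U V (identity K C) tab strat)
    (h : ThreeWayEnds strat cd tab U V (identity K C) disc T t) :
    T.RenamesTo (fun q => (q.1, q.2.1)) T' ∧ ∀ code tb, strat = .central →
      hs = .first code tb → t ≤ 21 * (1 + (T'.states.map fun q =>
        1 + scanned U V q hs + (pairList U V q hs).length).sum) := by
  obtain ⟨T₀, t₀, h1, h2, h3⟩ := threeWay_ends hU hV (identity_valid K C) htab disc
  obtain ⟨rfl, rfl⟩ := h.unique h1
  have hL : ∀ q : S × S' × Unit, ((expandList cd tab U V (identity K C) strat q).map
      (Transition.rename fun q => (q.1, q.2.1))).Perm (pairList U V (q.1, q.2.1) hs) := by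
    intro q
    rw [← Multiset.coe_eq_coe, ← Multiset.map_coe, coe_expandList htab, coe_pairList hp,
      map_tripleMatches_identity_right]
  have hi : ∀ q : S × S' × Unit, isInitPair U V (q.1, q.2.1)
      = isInitTriple U V (identity K C) q := fun q => by
    simp [isInitPair, isInitTriple, identity]
  refine ⟨h2.renamesTo (f := fun q => (q.1, q.2.1)) (g := fun r => (r.1, r.2, ())) (fun _ => rfl)
    (fun _ => rfl) hi
    (fun q => by simp [isFinalPair, isFinalTriple, identity]) (fun q => by simp [identity])
    (fun q => by simp [identity]) hL hT', ?_⟩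
  rintro code tb rfl rfl
  refine h3.trans (le_of_eq ?_)
  have hperm := h2.states_perm (f := fun q => (q.1, q.2.1)) (g := fun r => (r.1, r.2, ()))
    (fun _ => rfl) (fun _ => rfl) hi hL hT'
  rw [← (hperm.map _).sum_eq, List.map_map]
  congr 3
  refine List.map_congr_left fun q _ => ?_
  rw [Function.comp_apply, ← (hL q).length_eq, List.length_map]
  rfl

end Main

end ThreeWay

theorem mainTheorem3 :
    ∃ M : ℕ,
      -- preprocessing, correctness and running time of 3-way composition
      (∀ (p : ℕ) [Fact p.Prime] (K A B C D S₁ S₂ S₃ : Type*) [CommSemiring K]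
        [DecidableEq B] [DecidableEq C] [DecidableEq S₁] [DecidableEq S₂] [DecidableEq S₃]
        (cd : Codes p B C S₁ S₂ S₃)
        (T₁ : WFST K A B S₁) (T₂ : WFST K B C S₂) (T₃ : WFST K C D S₃),
        T₁.Valid → T₂.Valid → T₃.Valid → ∀ strat : Strategy,
          (∀ N, (preprocess N cd T₁ T₂ T₃ strat).expectedTime
              ≤ ((M * (hashedTrans T₁ T₂ T₃ strat + 1) : ℕ) : ℝ≥0∞)) ∧
          Tendsto (fun N => (preprocess N cd T₁ T₂ T₃ strat).failure) atTop (𝓝 0) ∧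
          ∀ N tab, (preprocess N cd T₁ T₂ T₃ strat).Returns tab → ∀ disc : Discipline,
            ∃ T t, ThreeWayEnds strat cd tab T₁ T₂ T₃ disc T t ∧
              IsTripleProduct T₁ T₂ T₃ T ∧
              (∀ (x : List A) (y : List D),
                (Function.support fun z : List B × List C =>
                  T₁.weight x z.1 * T₂.weight z.1 z.2 * T₃.weight z.2 y).Finite ∧
                T.weight x y = ∑ᶠ z : List B × List C,
                  T₁.weight x z.1 * T₂.weight z.1 z.2 * T₃.weight z.2 y) ∧
              t ≤ M * (T.numStates * max 1 (branching T₁ T₂ T₃ strat) + T.numTrans + 1)) ∧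
      -- standard composition is the case where one of the three transducers is the identity
      (∀ (p : ℕ) [Fact p.Prime] (K A B C S S' : Type*) [CommSemiring K]
        [Fintype A] [Fintype B] [Fintype C] [DecidableEq S] [DecidableEq S']
        (U : WFST K A B S) (V : WFST K B C S'), U.Valid → V.Valid →
        ∀ (hs : Hashed p K A B C S S'), hs.Prepared U V → ∀ (disc disc' : Discipline)
          (strat : Strategy) (N : ℕ),
          ∃ T' t', StandardEnds hs U V disc' T' t' ∧
            (∀ (cd : Codes p A B Unit S S') tab T t,
              (preprocess N cd (identity K A) U V strat).Returns tab →
              ThreeWayEnds strat cd tab (identity K A) U V disc T t →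
              T.RenamesTo (fun q => (q.2.1, q.2.2)) T' ∧
              ∀ code h, strat = .central → hs = .second code h → t ≤ M * t') ∧
            (∀ (cd : Codes p B B S Unit S') tab T t,
              (preprocess N cd U (identity K B) V strat).Returns tab →
              ThreeWayEnds strat cd tab U (identity K B) V disc T t →
              T.RenamesTo (fun q => (q.1, q.2.2)) T') ∧
            (∀ (cd : Codes p B C S S' Unit) tab T t,
              (preprocess N cd U V (identity K C) strat).Returns tab →
              ThreeWayEnds strat cd tab U V (identity K C) disc T t →
              T.RenamesTo (fun q => (q.1, q.2.1)) T' ∧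
              ∀ code h, strat = .central → hs = .first code h → t ≤ M * t')) := by

  -- The largest of the constants: 361 for the preprocessing, 42 for the composition, 21 for the
  -- comparison with standard composition.
  refine ⟨361, ?_, ?_⟩
  · intro p _ K A B C D S₁ S₂ S₃ _ _ _ _ _ _ cd T₁ T₂ T₃ h₁ h₂ h₃ strat
    refine ⟨fun N => expectedTime_preprocess_le cd T₁ T₂ T₃ N strat,
      tendsto_failure_preprocess cd T₁ T₂ T₃ strat, fun N tab hr disc => ?_⟩
    obtain ⟨T, t, h, hT, ht⟩ := threeWay_correct h₁ h₂ h₃ (tablesFor_of_returns hr) disc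
    exact ⟨T, t, h, hT, weight_product hT, ht.trans (Nat.mul_le_mul_right _ (by norm_num))⟩
  · intro p _ K A B C S S' _ _ _ _ _ _ U V hU hV hs hp disc disc' strat N
    obtain ⟨T', t', h', hT', ht'⟩ := standard_ends hU hV hp disc'
    refine ⟨T', t', h', fun cd tab T t hr h => ?_, fun cd tab T t hr h => ?_,
      fun cd tab T t hr h => ?_⟩
    · obtain ⟨r1, r2⟩ := threeWay_identity_left hU hV hp hT' (tablesFor_of_returns hr) h
      refine ⟨r1, fun code tb hc hh => (r2 code tb hc hh).trans ?_⟩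
      exact Nat.mul_le_mul (by norm_num) ht'
    · exact threeWay_identity_middle hU hV hp hT' (tablesFor_of_returns hr) h
    · obtain ⟨r1, r2⟩ := threeWay_identity_right hU hV hp hT' (tablesFor_of_returns hr) h
      refine ⟨r1, fun code tb hc hh => (r2 code tb hc hh).trans ?_⟩
      exact Nat.mul_le_mul (by norm_num) ht'
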